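/- Setting. Fix $0<v_{\min}<v_{\max}$, densities $n_\pm>0$ and even probability densities $f_\pm$ on $\mathbb R$ that vanish unless $v_{\min}<|v|<v_{\max}$, and put $p_\pm=n_\pm f_\pm$. At time $0$ the positions and velocities of the atoms (point particles of mass $m$) form a Poisson process on the $(x,v)$-plane with density $p_-(v)$ for $x<0$ and $p_+(v)$ for $x>0$. A piston (a point particle of mass $M$) starts at the origin with velocity $u$. Atoms do not interact with each other. When an atom of velocity $v$ meets the piston of velocity $V$, the atom gets the velocity $$v'=-\frac{M-m}{M+m}\,v+\frac{2M}{M+m}\,V,$$ and the piston gets the velocity $V'=\frac{M-m}{M+m}V+\frac{2m}{M+m}v$, replaced by $2\bar V-V'$ if $V'>\bar V$ and by $-2\bar V-V'$ if $V'<-\bar V$. Between collisions all velocities are constant. Here $\bar V>0$ is a fixed cutoff with $\bar V<\frac{M-m}{3M+m}\,v_{\min}$. Let $W(t)$ be the velocity of the piston, let $\mu_0$ be a stationary probability measure on $[-\bar V,\bar V]$ for the transition probabilities of $W$, and let $\langle\cdot\rangle$ denote the average with respect to $\mu_0$. Let $\mathcal E_-$ and $\mathcal M_-$ be the kinetic energy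 and the momentum of the gas on the left of the piston. Their rates of change $d\mathcal E_- /dt$ and $d\mathcal M_- /dt$ at $u$ are the derivatives at $\Delta t=0^+$ of the conditional mean changes of $\mathcal E_-$ and $\mathcal M_-$ during a time $\Delta t$, given that the piston starts with velocity $u$. The heat flow from right to left is $$R_{+\to-}=\langle d\mathcal E_- /dt\rangle-\langle d\mathcal M_- /dt\rangle\,\langle W\rangle .$$ Put $F_k^-=\int_{v_{\min}}^{v_{\max}}v^kp_-(v)\,dv$, $F_k^+=\int_{-v_{\max}}^{-v_{\min}}v^kp_+(v)\,dv$, $Q_k=F_k^--F_k^+$ and $\varepsilon=m/M$. Claim. Assume that the pressures are equal, i.e. $Q_2=0$. Then there are constants $C$ and $\varepsilon_0>0$, depending only on $p_\pm$, $v_{\min}$, $v_{\max}$ and $\bar V$, such that, whenever $\varepsilon<\varepsilon_0$ (and $\bar V<\frac{M-m}{3M+m}v_{\min}$), the means and rates above exist and $$\left|R_{+\to-}-\frac{2m\varepsilon}{Q_1}\left(F_1^+F_3^--F_1^-F_3^+\right)\right|\le C\,m\,\varepsilon^2 .$$ In particular, for fixed $m$, $R_{+\to-}=\frac{2m\varepsilon}{Q_1}(F_1^+F_3^--F_1^-F_3^+)+O(\varepsilon^2)$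 as $\varepsilon\to0$. -/

import Mathlib

open MeasureTheory ProbabilityTheory Filter Topology Set

noncomputable section

namespace Piston

/-! ### The gas -/

/-- `f` is an even probability density on the line that vanishes unless `vmin < |v| < vmax`. -/
structure IsVelocityDensity (vmin vmax : ℝ) (f : ℝ → ℝ) : Prop where
  measurable : Measurable f
  nonneg : ∀ v, 0 ≤ f v
  even : ∀ v, f (-v) = f v
  integrable : Integrable f
  integral_eq_one : ∫ v, f v = 1
  cutoff : ∀ v, |v| ≤ vmin ∨ vmax ≤ |v| → f v = 0

/-- The measure `p(x, v) dx dv` on the phase plane of one atom, where `p(x, v)` is `pL v` to the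
left of the origin and `pR v` to the right of it. -/
def gasIntensity (pL pR : ℝ → ℝ) : Measure (ℝ × ℝ) :=
  (volume : Measure (ℝ × ℝ)).withDensity
    fun z => ENNReal.ofReal (if z.1 < 0 then pL z.2 else pR z.2)

/-- The random set `Γ` is a Poisson process with intensity measure `ν`: it is a countable set, the
number of its points in a measurable set of finite `ν`-measure has the Poisson law with
parameter `ν D`, and the numbers of points in pairwise disjoint sets are independent. -/
structure IsPoissonProcess {Ω S : Type*} [MeasurableSpace Ω] [MeasurableSpace S]
    (Γ : Ω → Set S) (ν : Measure S) (P : Measure Ω) : Prop where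
  countable : ∀ ω, (Γ ω).Countable
  measurable_count : ∀ D : Set S, MeasurableSet D → Measurable fun ω => (Γ ω ∩ D).encard
  law_count : ∀ D : Set S, MeasurableSet D → ν D ≠ ⊤ →
    ∀ k : ℕ, P {ω | (Γ ω ∩ D).encard = k} = poissonMeasure (ν D).toNNReal {k}
  indep_count : ∀ (n : ℕ) (D : Fin n → Set S), (∀ i, MeasurableSet (D i)) →
    Pairwise (fun i j => Disjoint (D i) (D j)) →
    iIndepFun (fun i ω => (Γ ω ∩ D i).encard) P

/-- `F_k^- = ∫_{vmin}^{vmax} v^k p_-(v) dv`. -/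
def momentL (vmin vmax : ℝ) (pL : ℝ → ℝ) (k : ℕ) : ℝ :=
  ∫ v in vmin..vmax, v ^ k * pL v

/-- `F_k^+ = ∫_{-vmax}^{-vmin} v^k p_+(v) dv`. -/
def momentR (vmin vmax : ℝ) (pR : ℝ → ℝ) (k : ℕ) : ℝ :=
  ∫ v in (-vmax)..(-vmin), v ^ k * pR v

/-! ### The dynamics -/

/-- Velocity of the piston (mass `M`) after an elastic collision with an atom (mass `m`), the
velocities before the collision being `V` and `v`. -/
def pistonAfter (m M V v : ℝ) : ℝ := (M - m) / (M + m) * V + 2 * m / (M + m) * v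

/-- Velocity of the atom after that collision. -/
def atomAfter (m M V v : ℝ) : ℝ := -((M - m) / (M + m)) * v + 2 * M / (M + m) * V

/-- The reflection of the velocity of the piston at `±Vbar`. -/
def reflectVel (Vbar w : ℝ) : ℝ :=
  if Vbar < w then 2 * Vbar - w else if w < -Vbar then -2 * Vbar - w else w

/-- The upper bound `V_max` on the cutoff velocity of the piston. -/
def vMax (m M vmin : ℝ) : ℝ := (M - m) / (3 * M + m) * vmin

/-- The piston, with velocity `W s` at time `s` and initial position `0`, and the atom with initial
position and velocity `z = (x, v)` and velocity `c z s` at time `s` have the same position at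
time `t`. -/
def Meets (W : ℝ → ℝ) (c : ℝ × ℝ → ℝ → ℝ) (z : ℝ × ℝ) (t : ℝ) : Prop :=
  z.1 + ∫ s in (0 : ℝ)..t, c z s = ∫ s in (0 : ℝ)..t, W s

/-- The motion, at times `t ≥ 0`, of the piston and the atoms: `Γ` is the set of the initial
positions and velocities of the atoms, `u` the initial velocity of the piston, `W t` the velocity
of the piston and `c z t` the velocity of the atom that starts from `z ∈ Γ`. All velocities are
piecewise constant and right-continuous. They change only at collisions, by the elastic rule,
after which the velocity of the piston is reflected at `±Vbar`. Atoms do not interact with each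
other. -/
structure IsMotion (m M Vbar : ℝ) (Γ : Set (ℝ × ℝ)) (u : ℝ) (W : ℝ → ℝ)
    (c : ℝ × ℝ → ℝ → ℝ) : Prop where
  piston_init : W 0 = u
  atom_init : ∀ z ∈ Γ, c z 0 = z.2
  piston_right : ∀ t, 0 ≤ t → ∀ᶠ s in 𝓝[>] t, W s = W t
  atom_right : ∀ z ∈ Γ, ∀ t, 0 ≤ t → ∀ᶠ s in 𝓝[>] t, c z s = c z t
  piston_free : ∀ t, 0 < t → (∀ z ∈ Γ, ¬ Meets W c z t) → ∀ᶠ s in 𝓝[<] t, W s = W t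
  atom_free : ∀ z ∈ Γ, ∀ t, 0 < t → ¬ Meets W c z t → ∀ᶠ s in 𝓝[<] t, c z s = c z t
  collision : ∀ z ∈ Γ, ∀ t, 0 < t → Meets W c z t →
    ∃ V v : ℝ, (∀ᶠ s in 𝓝[<] t, W s = V ∧ c z s = v) ∧
      W t = reflectVel Vbar (pistonAfter m M V v) ∧ c z t = atomAfter m M V v

/-- The change, during `[0, t]`, of the kinetic energy of the gas on the left of the piston. -/
def leftEnergyGain (m : ℝ) (Γ : Set (ℝ × ℝ)) (c : ℝ × ℝ → ℝ → ℝ) (t : ℝ) : ℝ :=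
  ∑' z : {z : ℝ × ℝ // z ∈ Γ ∧ z.1 < 0}, (m / 2 * c z.1 t ^ 2 - m / 2 * z.1.2 ^ 2)

/-- The change, during `[0, t]`, of the momentum of the gas on the left of the piston. -/
def leftMomentumGain (m : ℝ) (Γ : Set (ℝ × ℝ)) (c : ℝ × ℝ → ℝ → ℝ) (t : ℝ) : ℝ :=
  ∑' z : {z : ℝ × ℝ // z ∈ Γ ∧ z.1 < 0}, (m * c z.1 t - m * z.1.2)

/-! ### The velocity process, its stationary measures and the heat flow -/

/-- For each initial velocity `u ∈ [-Vbar, Vbar]` of the piston, `W u ω t` and `c u ω z t` are the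
velocities of the piston and of the atoms in the random gas `Γ ω`. -/
structure IsPistonProcess {Ω : Type*} [MeasurableSpace Ω] (P : Measure Ω) (m M Vbar : ℝ)
    (Γ : Ω → Set (ℝ × ℝ)) (W : ℝ → Ω → ℝ → ℝ) (c : ℝ → Ω → ℝ × ℝ → ℝ → ℝ) : Prop where
  motion : ∀ u ∈ Icc (-Vbar) Vbar, ∀ᵐ ω ∂P, IsMotion m M Vbar (Γ ω) u (W u ω) (c u ω)
  measurable_velocity : ∀ t, 0 ≤ t → Measurable fun q : ℝ × Ω => W q.1 q.2 t
  measurable_energy : ∀ u ∈ Icc (-Vbar) Vbar, ∀ t, 0 ≤ t →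
    AEStronglyMeasurable (fun ω => leftEnergyGain m (Γ ω) (c u ω) t) P
  measurable_momentum : ∀ u ∈ Icc (-Vbar) Vbar, ∀ t, 0 ≤ t →
    AEStronglyMeasurable (fun ω => leftMomentumGain m (Γ ω) (c u ω) t) P

/-- The transition probability: the law of the velocity of the piston at time `t` when its velocity
at time `0` is `u`. -/
def transition {Ω : Type*} [MeasurableSpace Ω] (P : Measure Ω) (W : ℝ → Ω → ℝ → ℝ)
    (u t : ℝ) : Measure ℝ :=
  P.map fun ω => W u ω t

/-- `μ` is a stationary probability measure, on the interval `[-Vbar, Vbar]`, of the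
process of the velocity of the piston. -/
structure IsStationary {Ω : Type*} [MeasurableSpace Ω] (P : Measure Ω) (Vbar : ℝ)
    (W : ℝ → Ω → ℝ → ℝ) (μ : Measure ℝ) : Prop where
  prob : IsProbabilityMeasure μ
  supp : μ (Icc (-Vbar) Vbar)ᶜ = 0
  invariant : ∀ t, 0 ≤ t → ∀ A : Set ℝ, MeasurableSet A →
    ∫⁻ u, transition P W u t A ∂μ = μ A

/-- The conditional mean change of the kinetic energy of the left gas during `[0, t]`, given that
the piston has velocity `u` at time `0`. -/
def meanEnergyGain {Ω : Type*} [MeasurableSpace Ω] (P : Measure Ω) (m : ℝ)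
    (Γ : Ω → Set (ℝ × ℝ)) (c : ℝ → Ω → ℝ × ℝ → ℝ → ℝ) (u t : ℝ) : ℝ :=
  ∫ ω, leftEnergyGain m (Γ ω) (c u ω) t ∂P

/-- The conditional mean change of the momentum of the left gas during `[0, t]`, given that
the piston has velocity `u` at time `0`. -/
def meanMomentumGain {Ω : Type*} [MeasurableSpace Ω] (P : Measure Ω) (m : ℝ)
    (Γ : Ω → Set (ℝ × ℝ)) (c : ℝ → Ω → ℝ × ℝ → ℝ → ℝ) (u t : ℝ) : ℝ :=
  ∫ ω, leftMomentumGain m (Γ ω) (c u ω) t ∂P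

/-- The rate of change of the kinetic energy of the left gas, given that the
piston has velocity `u`. -/
def energyRate {Ω : Type*} [MeasurableSpace Ω] (P : Measure Ω) (m : ℝ)
    (Γ : Ω → Set (ℝ × ℝ)) (c : ℝ → Ω → ℝ × ℝ → ℝ → ℝ) (u : ℝ) : ℝ :=
  derivWithin (meanEnergyGain P m Γ c u) (Ici 0) 0

/-- The rate of change of the momentum of the left gas, given that the
piston has velocity `u`. -/
def momentumRate {Ω : Type*} [MeasurableSpace Ω] (P : Measure Ω) (m : ℝ)
    (Γ : Ω → Set (ℝ × ℝ)) (c : ℝ → Ω → ℝ × ℝ → ℝ → ℝ) (u : ℝ) : ℝ :=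
  derivWithin (meanMomentumGain P m Γ c u) (Ici 0) 0

/-- The means and derivatives that enter the definition of the heat flow exist. -/
structure HeatFlowExists {Ω : Type*} [MeasurableSpace Ω] (P : Measure Ω) (m Vbar : ℝ)
    (Γ : Ω → Set (ℝ × ℝ)) (c : ℝ → Ω → ℝ × ℝ → ℝ → ℝ) (μ : Measure ℝ) : Prop where
  integrable_energy : ∀ u ∈ Icc (-Vbar) Vbar, ∀ t, 0 ≤ t →
    Integrable (fun ω => leftEnergyGain m (Γ ω) (c u ω) t) P
  integrable_momentum : ∀ u ∈ Icc (-Vbar) Vbar, ∀ t, 0 ≤ t →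
    Integrable (fun ω => leftMomentumGain m (Γ ω) (c u ω) t) P
  differentiable_energy : ∀ u ∈ Icc (-Vbar) Vbar,
    DifferentiableWithinAt ℝ (meanEnergyGain P m Γ c u) (Ici 0) 0
  differentiable_momentum : ∀ u ∈ Icc (-Vbar) Vbar,
    DifferentiableWithinAt ℝ (meanMomentumGain P m Γ c u) (Ici 0) 0
  integrable_energyRate : Integrable (energyRate P m Γ c) μ
  integrable_momentumRate : Integrable (momentumRate P m Γ c) μ
  integrable_velocity : Integrable (fun w : ℝ => w) μ

/-- The heat flow from right to left: the average energy rate of the left gas, less the product of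
its average momentum rate and the average velocity of the piston. Averages are over `μ`. -/
def heatFlow {Ω : Type*} [MeasurableSpace Ω] (P : Measure Ω) (m : ℝ)
    (Γ : Ω → Set (ℝ × ℝ)) (c : ℝ → Ω → ℝ × ℝ → ℝ → ℝ) (μ : Measure ℝ) : ℝ :=
  (∫ u, energyRate P m Γ c u ∂μ) - (∫ u, momentumRate P m Γ c u ∂μ) * ∫ w, w ∂μ

end Piston

end

/-!
Since the cutoff makes the piston slower than every atom, also after collisions, no atom meets the
piston twice. Up to an error of order `t ^ 2`, the change of an observable during `[0, t]` is then
the contribution of the gas configurations in which a single atom comes near the piston, and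
Campbell's formula for the Poisson process expresses it by the flux of collisions. This gives the
generator of the velocity of the piston and the rates of change of the energy and of the momentum of
the left gas, both of which are polynomials in the velocity `u` of the piston.

One collision with an atom of velocity `v` moves `u` to `u - a * (u - v)`, where `a = 2m / (M + m)`.
The integrals of the generator of `u`, `u ^ 2`, `u ^ 3` and `u ^ 4` against a stationary measure
vanish, which gives relations between its moments. Reflections happen only for `Vbar / 2 ≤ |u|`, so
that their effect is controlled by the fourth moment. At equal pressures `u` relaxes to `0` at a
rate of order `a`, and therefore `⟨W⟩ = O(a)`, `⟨W ^ 2⟩ = a Q₃ / (4 Q₁) + O(a ^ 2)`, and `⟨W ^ 3⟩`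
and `⟨W ^ 4⟩` are `O(a ^ 2)`. With `a = 2 ε + O(ε ^ 2)` these give the expansion of the heat flow.
-/

namespace Piston

/-! ### The motion of the piston and of the atoms -/

section StepFunctions

variable {α E : Type*} [NormedAddCommGroup E]

theorem integrableAtFilter_of_eventually_eq_const [MeasurableSpace α] {μ : Measure α} {f : α → E}
    {l : Filter α} [l.IsMeasurablyGenerated] (hμ : μ.FiniteAtFilter l) {C : E}
    (h : ∀ᶠ x in l, f x = C) : IntegrableAtFilter f l μ := by
  obtain ⟨s, hs, hμs⟩ := hμ
  obtain ⟨t, ht, htm, hft⟩ := (h.and hs).exists_measurable_mem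
  have hμt : μ t ≠ ⊤ := ((measure_mono fun x hx => (hft x hx).2).trans_lt hμs).ne
  exact ⟨t, ht, (integrableOn_const hμt).congr_fun (fun x hx => (hft x hx).1.symm) htm⟩

theorem nhdsWithin_Icc_le {a b t : ℝ} : 𝓝[Icc a b] t ≤ 𝓝[Ico a t] t ⊔ 𝓝[Icc t b] t := by
  rw [← nhdsWithin_union]
  exact nhdsWithin_mono _ fun s hs => (lt_or_ge s t).imp (⟨hs.1, ·⟩) (⟨·, hs.2⟩)

theorem eventually_nhdsGE_iff {p : ℝ → Prop} {t : ℝ} :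
    (∀ᶠ s in 𝓝[≥] t, p s) ↔ p t ∧ ∀ᶠ s in 𝓝[>] t, p s := by
  rw [← Ioi_insert, nhdsWithin_insert, eventually_sup, eventually_pure]

theorem eq_of_eventually_eq_nhdsWithin [TopologicalSpace α] {β : Type*} {s : Set α}
    (hs : IsPreconnected s) {f : α → β} (h : ∀ x ∈ s, ∀ᶠ y in 𝓝[s] x, f y = f x) {x y : α}
    (hx : x ∈ s) (hy : y ∈ s) : f x = f y :=
  hs.induction₂ (fun x y => f y = f x) h (fun _ _ _ _ _ _ h₁ h₂ => h₂.trans h₁)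
    (fun _ _ _ _ => Eq.symm) hy hx

theorem eq_left_of_eventually_eq {β : Type*} {f : ℝ → β} {a b : ℝ}
    (hr : ∀ t ∈ Ico a b, ∀ᶠ s in 𝓝[>] t, f s = f t)
    (hl : ∀ t ∈ Ioc a b, ∀ᶠ s in 𝓝[<] t, f s = f t) {t : ℝ} (ht : t ∈ Icc a b) :
    f t = f a := by
  refine eq_of_eventually_eq_nhdsWithin isPreconnected_Icc (fun x hx => ?_) ht
    (left_mem_Icc.2 (ht.1.trans ht.2))
  refine nhdsWithin_Icc_le (eventually_sup.2 ⟨?_, ?_⟩)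
  · rcases hx.1.eq_or_lt with rfl | h
    · simp
    · exact nhdsWithin_mono x Ico_subset_Iio_self (hl x ⟨h, hx.2⟩)
  · rcases hx.2.eq_or_lt with rfl | h
    · simp
    · exact nhdsWithin_mono x Icc_subset_Ici_self (eventually_nhdsGE_iff.2 ⟨rfl, hr x ⟨hx.1, h⟩⟩)

/-- A right-continuous, piecewise constant function on `[0, ∞)`; its values at negative times are
arbitrary. -/
structure IsStep (f : ℝ → E) : Prop where
  right : ∀ t, 0 ≤ t → ∀ᶠ s in 𝓝[>] t, f s = f t
  left : ∀ t, 0 < t → ∃ V, ∀ᶠ s in 𝓝[<] t, f s = V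

namespace IsStep

variable {f : ℝ → E} {a b : ℝ}

theorem integrableOn_Icc (hf : IsStep f) (b : ℝ) : IntegrableOn f (Icc 0 b) := by
  refine LocallyIntegrableOn.integrableOn_isCompact (fun t ht => ?_) isCompact_Icc
  obtain ⟨V, hV⟩ : ∃ V, ∀ᶠ s in 𝓝[Ico 0 t] t, f s = V := by
    rcases ht.1.eq_or_lt with rfl | h
    · simp
    · exact (hf.left t h).imp fun V hV => nhdsWithin_mono t Ico_subset_Iio_self hV
  have hr : ∀ᶠ s in 𝓝[Icc t b] t, f s = f t :=
    nhdsWithin_mono t Icc_subset_Ici_self (eventually_nhdsGE_iff.2 ⟨rfl, hf.right t ht.1⟩)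
  have := (measurableSet_Ico (a := (0 : ℝ)) (b := t)).nhdsWithin_isMeasurablyGenerated t
  exact .filter_mono nhdsWithin_Icc_le (.sup_iff.2
    ⟨integrableAtFilter_of_eventually_eq_const (volume.finiteAt_nhdsWithin _ _) hV,
      integrableAtFilter_of_eventually_eq_const (volume.finiteAt_nhdsWithin _ _) hr⟩)

theorem intervalIntegrable (hf : IsStep f) (ha : 0 ≤ a) (hb : 0 ≤ b) :
    IntervalIntegrable f volume a b := by
  refine ((hf.integrableOn_Icc (max a b)).mono_set fun s hs => ?_).intervalIntegrable
  exact ⟨(le_min ha hb).trans hs.1, hs.2⟩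

variable [NormedSpace ℝ E]

theorem integral_sub (hf : IsStep f) (ha : 0 ≤ a) (hb : 0 ≤ b) :
    (∫ s in (0 : ℝ)..b, f s) - ∫ s in (0 : ℝ)..a, f s = ∫ s in a..b, f s :=
  intervalIntegral.integral_interval_sub_left (hf.intervalIntegrable le_rfl hb)
    (hf.intervalIntegrable le_rfl ha)

theorem continuousOn_integral (hf : IsStep f) (hb : 0 ≤ b) :
    ContinuousOn (fun t => ∫ s in (0 : ℝ)..t, f s) (Icc 0 b) := by
  have := intervalIntegral.continuousOn_primitive_interval (f := f) (a := 0) (b := b)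
    (μ := volume) (by rw [uIcc_of_le hb]; exact hf.integrableOn_Icc b)
  rwa [uIcc_of_le hb] at this

end IsStep

variable [NormedSpace ℝ E] {f : ℝ → E} {a b : ℝ}

theorem integral_of_eqOn_Ico [CompleteSpace E] {V : E} (hab : a ≤ b) (h : ∀ s ∈ Ico a b, f s = V) :
    ∫ s in a..b, f s = (b - a) • V := by
  rw [intervalIntegral.integral_congr_Ioo_of_le (g := fun _ => V) hab
    fun s hs => h s (Ioo_subset_Ico_self hs), intervalIntegral.integral_const]

theorem norm_integral_le_of_norm_le_Ico {K : ℝ} (hab : a ≤ b) (h : ∀ s ∈ Ico a b, ‖f s‖ ≤ K) :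
    ‖∫ s in a..b, f s‖ ≤ K * (b - a) := by
  rw [intervalIntegral.integral_of_le hab, integral_Ioc_eq_integral_Ioo]
  simpa [hab] using norm_setIntegral_le_of_norm_le_const (μ := volume) (s := Ioo a b) (by simp)
    fun s hs => h s (Ioo_subset_Ico_self hs)

end StepFunctions

/-- The fraction `2 m / (M + m)` of its velocity relative to the atom that the piston loses in a
collision. It is the small parameter of the expansion. -/
noncomputable def recoil (m M : ℝ) : ℝ := 2 * m / (M + m)

section Collision

variable {m M : ℝ}

theorem pistonAfter_eq (h : M + m ≠ 0) (V v : ℝ) :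
    pistonAfter m M V v = V + recoil m M * (v - V) := by
  unfold pistonAfter recoil; field_simp; ring

theorem atomAfter_eq (h : M + m ≠ 0) (V v : ℝ) :
    atomAfter m M V v = v - (2 - recoil m M) * (v - V) := by
  unfold atomAfter recoil; field_simp; ring

end Collision

/-- The regime of parameters of the paper: the cutoff prevents recollisions, and one collision
changes the velocity of the piston by at most `Vbar / 2`. -/
structure Admissible (m M Vbar vmin vmax : ℝ) : Prop where
  m_pos : 0 < m
  M_pos : 0 < M
  Vbar_pos : 0 < Vbar
  vmin_pos : 0 < vmin
  vmin_lt : vmin < vmax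
  cutoff : Vbar < vMax m M vmin
  small : recoil m M * (vmax + Vbar) ≤ Vbar / 2

namespace Admissible

variable {m M Vbar vmin vmax : ℝ}

theorem add_ne_zero (h : Admissible m M Vbar vmin vmax) : M + m ≠ 0 :=
  (add_pos h.M_pos h.m_pos).ne'

theorem recoil_pos (h : Admissible m M Vbar vmin vmax) : 0 < recoil m M :=
  div_pos (mul_pos two_pos h.m_pos) (add_pos h.M_pos h.m_pos)

theorem cutoff_mul (h : Admissible m M Vbar vmin vmax) :
    Vbar * (3 * M + m) < (M - m) * vmin := by
  have hpos : 0 < 3 * M + m := by linarith [h.m_pos, h.M_pos]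
  simpa only [vMax, div_mul_eq_mul_div, lt_div_iff₀ hpos] using h.cutoff

theorem m_lt_M (h : Admissible m M Vbar vmin vmax) : m < M := by
  have hpos : 0 < (M - m) * vmin := by
    have := h.m_pos
    have := h.M_pos
    have := h.Vbar_pos
    exact lt_trans (by positivity) h.cutoff_mul
  exact sub_pos.1 (pos_of_mul_pos_left hpos h.vmin_pos.le)

theorem three_mul_Vbar_lt (h : Admissible m M Vbar vmin vmax) : 3 * Vbar < vmin := by
  have hm := mul_pos h.m_pos h.Vbar_pos
  have hv := mul_pos h.m_pos h.vmin_pos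
  by_contra! hcon
  linarith [h.cutoff_mul, mul_le_mul_of_nonneg_left hcon h.M_pos.le]

theorem Vbar_lt (h : Admissible m M Vbar vmin vmax) : Vbar < vmin := by
  linarith [h.three_mul_Vbar_lt, h.Vbar_pos]

theorem abs_lt_vmin (h : Admissible m M Vbar vmin vmax) {V : ℝ} (hV : |V| ≤ Vbar) : |V| < vmin :=
  hV.trans_lt h.Vbar_lt

theorem atomAfter_lt (h : Admissible m M Vbar vmin vmax) {σ V v : ℝ} (hσ : |σ| = 1)
    (hV : |V| ≤ Vbar) (hv : vmin < σ * v) : σ * atomAfter m M V v < -Vbar := by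
  have hσV : σ * V ≤ Vbar := (le_abs_self _).trans (by rwa [abs_mul, hσ, one_mul])
  have key : σ * atomAfter m M V v = (-(M - m) * (σ * v) + 2 * M * (σ * V)) / (M + m) := by
    unfold atomAfter; field_simp
  rw [key, div_lt_iff₀ (add_pos h.M_pos h.m_pos)]
  linarith [h.cutoff_mul, mul_lt_mul_of_pos_left hv (sub_pos.2 h.m_lt_M),
    mul_le_mul_of_nonneg_left hσV h.M_pos.le]

theorem abs_pistonAfter_sub_le (h : Admissible m M Vbar vmin vmax) {V v : ℝ} (hV : |V| ≤ Vbar)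
    (hv : |v| ≤ vmax) : |pistonAfter m M V v - V| ≤ recoil m M * (vmax + Vbar) := by
  rw [pistonAfter_eq h.add_ne_zero, add_sub_cancel_left, abs_mul, abs_of_pos h.recoil_pos]
  exact mul_le_mul_of_nonneg_left ((abs_sub _ _).trans (add_le_add hv hV)) h.recoil_pos.le

theorem abs_reflectVel_pistonAfter_le (h : Admissible m M Vbar vmin vmax) {V v : ℝ}
    (hV : |V| ≤ Vbar) (hv : |v| ≤ vmax) : |reflectVel Vbar (pistonAfter m M V v)| ≤ Vbar := by
  have hjump := (h.abs_pistonAfter_sub_le hV hv).trans h.small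
  rw [abs_le] at hjump hV ⊢
  have := h.Vbar_pos
  unfold reflectVel
  split_ifs <;> constructor <;> linarith

end Admissible

section RealAnalysis

theorem exists_first_zero {f : ℝ → ℝ} {a b : ℝ} (hab : a < b) (hf : ContinuousOn f (Icc a b))
    (ha : ∀ᶠ s in 𝓝[>] a, f s ≠ 0) (hb : f b = 0) :
    ∃ τ ∈ Ioc a b, f τ = 0 ∧ ∀ s ∈ Ioo a τ, f s ≠ 0 := by
  obtain ⟨d, hd, had⟩ := mem_nhdsGT_iff_exists_Ioc_subset.1 ha
  have hdb : d < b := not_le.1 fun hbd => had ⟨hab, hbd⟩ hb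
  have hsub : Icc d b ⊆ Icc a b := Icc_subset_Icc_left (le_of_lt hd)
  have hcompact : IsCompact (Icc d b ∩ f ⁻¹' {0}) := isCompact_Icc.of_isClosed_subset
    ((hf.mono hsub).preimage_isClosed_of_isClosed isClosed_Icc isClosed_singleton) inter_subset_left
  obtain ⟨τ, ⟨hτ, h0⟩, hleast⟩ := hcompact.exists_isLeast ⟨b, ⟨hdb.le, le_rfl⟩, hb⟩
  refine ⟨τ, ⟨lt_of_lt_of_le hd hτ.1, hτ.2⟩, h0, fun s hs hs0 => ?_⟩
  rcases le_total s d with hsd | hsd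
  · exact had ⟨hs.1, hsd⟩ hs0
  · exact (hleast ⟨⟨hsd, hs.2.le.trans hτ.2⟩, hs0⟩).not_gt hs.2

theorem forall_ge_of_forall_Ico {p : ℝ → Prop} {a : ℝ}
    (h : ∀ T, a ≤ T → (∀ s ∈ Ico a T, p s) → p T ∧ ∀ᶠ s in 𝓝[>] T, p s) {t : ℝ} (ht : a ≤ t) :
    p t := by
  by_contra hpt
  set S := {s : ℝ | a ≤ s ∧ ¬ p s}
  have hne : S.Nonempty := ⟨t, ht, hpt⟩
  have hbdd : BddBelow S := ⟨a, fun s hs => hs.1⟩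
  obtain ⟨hT, hright⟩ := h (sInf S) (le_csInf hne fun s hs => hs.1) fun s hs =>
    not_not.1 fun hps => (csInf_le hbdd ⟨hs.1, hps⟩).not_gt hs.2
  obtain ⟨d, hd, hpd⟩ := mem_nhdsGE_iff_exists_Ico_subset.1 (eventually_nhdsGE_iff.2 ⟨hT, hright⟩)
  refine (le_csInf hne fun s hs => not_lt.1 fun hsd => ?_).not_gt hd
  exact hs.2 (hpd ⟨csInf_le hbdd hs, hsd⟩)

theorem exists_sign_mul_neg {x : ℝ} (hx : x ≠ 0) : ∃ σ : ℝ, |σ| = 1 ∧ σ * x < 0 := by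
  rcases hx.lt_or_gt with h | h
  · exact ⟨1, by simp, by linarith⟩
  · exact ⟨-1, by simp, by linarith⟩

end RealAnalysis

/-- The position of the piston relative to the atom that starts from `z`. -/
noncomputable def gap (W : ℝ → ℝ) (c : ℝ × ℝ → ℝ → ℝ) (z : ℝ × ℝ) (t : ℝ) : ℝ :=
  (∫ s in (0 : ℝ)..t, W s) - (z.1 + ∫ s in (0 : ℝ)..t, c z s)

theorem meets_iff_gap_eq_zero {W : ℝ → ℝ} {c : ℝ × ℝ → ℝ → ℝ} {z : ℝ × ℝ} {t : ℝ} :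
    Meets W c z t ↔ gap W c z t = 0 := by
  rw [Meets, gap, sub_eq_zero, eq_comm]

theorem gap_zero (W : ℝ → ℝ) (c : ℝ × ℝ → ℝ → ℝ) (z : ℝ × ℝ) : gap W c z 0 = -z.1 := by
  simp [gap]

namespace IsMotion

variable {m M Vbar u : ℝ} {Γ : Set (ℝ × ℝ)} {W : ℝ → ℝ} {c : ℝ × ℝ → ℝ → ℝ} {z : ℝ × ℝ}
  {a b : ℝ}

theorem isStep_piston (h : IsMotion m M Vbar Γ u W c) : IsStep W where
  right := h.piston_right
  left t ht := by
    by_cases! hm : ∀ z ∈ Γ, ¬ Meets W c z t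
    · exact ⟨_, h.piston_free t ht hm⟩
    · obtain ⟨z, hz, hzt⟩ := hm
      obtain ⟨V, v, hV, -⟩ := h.collision z hz t ht hzt
      exact ⟨V, hV.mono fun s hs => hs.1⟩

theorem isStep_atom (h : IsMotion m M Vbar Γ u W c) (hz : z ∈ Γ) : IsStep (c z) where
  right := h.atom_right z hz
  left t ht := by
    by_cases hm : Meets W c z t
    · obtain ⟨V, v, hV, -⟩ := h.collision z hz t ht hm
      exact ⟨v, hV.mono fun s hs => hs.2⟩
    · exact ⟨_, h.atom_free z hz t ht hm⟩

theorem continuousOn_gap (h : IsMotion m M Vbar Γ u W c) (hz : z ∈ Γ) (ha : 0 ≤ a) (hab : a ≤ b) :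
    ContinuousOn (gap W c z) (Icc a b) :=
  have hb := ha.trans hab
  ((h.isStep_piston.continuousOn_integral hb).sub
    (continuousOn_const.add ((h.isStep_atom hz).continuousOn_integral hb))).mono
      (Icc_subset_Icc_left ha)

theorem atom_eq_of_not_meets (h : IsMotion m M Vbar Γ u W c) (hz : z ∈ Γ) (ha : 0 ≤ a)
    (hab : a ≤ b) (hm : ∀ s ∈ Ioc a b, ¬ Meets W c z s) : c z b = c z a :=
  eq_left_of_eventually_eq (fun t ht => h.atom_right z hz t (ha.trans ht.1))
    (fun t ht => h.atom_free z hz t (ha.trans_lt ht.1) (hm t ht)) (right_mem_Icc.2 hab)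

theorem piston_eq_of_not_meets (h : IsMotion m M Vbar Γ u W c) (ha : 0 ≤ a) (hab : a ≤ b)
    (hm : ∀ s ∈ Ioc a b, ∀ z ∈ Γ, ¬ Meets W c z s) : W b = W a :=
  eq_left_of_eventually_eq (fun t ht => h.piston_right t (ha.trans ht.1))
    (fun t ht => h.piston_free t (ha.trans_lt ht.1) (hm t ht)) (right_mem_Icc.2 hab)

theorem atom_eq_of_not_meets_Ioo (h : IsMotion m M Vbar Γ u W c) (hz : z ∈ Γ) (ha : 0 ≤ a)
    (hm : ∀ s ∈ Ioo a b, ¬ Meets W c z s) : ∀ s ∈ Ico a b, c z s = c z a :=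
  fun _ hs => h.atom_eq_of_not_meets hz ha hs.1 fun r hr => hm r ⟨hr.1, hr.2.trans_lt hs.2⟩

theorem piston_eq_of_not_meets_Ioo (h : IsMotion m M Vbar Γ u W c) (ha : 0 ≤ a)
    (hm : ∀ s ∈ Ioo a b, ∀ z ∈ Γ, ¬ Meets W c z s) : ∀ s ∈ Ico a b, W s = W a :=
  fun _ hs => h.piston_eq_of_not_meets ha hs.1 fun r hr => hm r ⟨hr.1, hr.2.trans_lt hs.2⟩

theorem mul_le_sign_mul_gap_sub (h : IsMotion m M Vbar Γ u W c) (hz : z ∈ Γ) {σ k K : ℝ}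
    (hσ : |σ| = 1) (ha : 0 ≤ a) (hab : a ≤ b) (hW : ∀ s ∈ Ico a b, |W s| ≤ K)
    (hc : ∀ s ∈ Ico a b, c z s = k) :
    (-K - σ * k) * (b - a) ≤ σ * gap W c z b - σ * gap W c z a := by
  have hpiston := h.isStep_piston.integral_sub ha (ha.trans hab)
  have hatom := (h.isStep_atom hz).integral_sub ha (ha.trans hab)
  rw [integral_of_eqOn_Ico hab hc, smul_eq_mul] at hatom
  have hbound : |σ * ∫ s in a..b, W s| ≤ K * (b - a) := by
    rw [abs_mul, hσ, one_mul]
    exact norm_integral_le_of_norm_le_Ico (f := W) hab hW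
  rw [← hpiston] at hbound
  unfold gap
  linear_combination neg_le_of_abs_le hbound + σ * hatom

theorem sign_mul_gap_pos (h : IsMotion m M Vbar Γ u W c) (hz : z ∈ Γ) {σ K : ℝ} (hσ : |σ| = 1)
    (ha : 0 ≤ a) (hab : a < b) (hW : ∀ s ∈ Ico a b, |W s| ≤ K)
    (hc : ∀ s ∈ Ico a b, c z s = c z a) (hfast : σ * c z a < -K) (hgap : 0 ≤ σ * gap W c z a) :
    0 < σ * gap W c z b := by
  have hrate : 0 < (-K - σ * c z a) * (b - a) := mul_pos (by linarith) (sub_pos.2 hab)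
  linarith [h.mul_le_sign_mul_gap_sub hz hσ ha hab.le hW hc]

theorem not_meets_of_escape (h : IsMotion m M Vbar Γ u W c) (hz : z ∈ Γ) {σ K : ℝ}
    (hσ : |σ| = 1) (ha : 0 ≤ a) (hab : a < b) (hW : ∀ s ∈ Ico a b, |W s| ≤ K)
    (hfast : σ * c z a < -K) (hgap : 0 ≤ σ * gap W c z a) : ¬ Meets W c z b := by
  have gap_ne_zero : ∀ s ∈ Ioc a b, (∀ r ∈ Ico a s, c z r = c z a) → gap W c z s ≠ 0 :=
    fun s hs hc h0 => (h.sign_mul_gap_pos hz hσ ha hs.1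
      (fun r hr => hW r ⟨hr.1, hr.2.trans_le hs.2⟩) hc hfast hgap).ne' (by rw [h0, mul_zero])
  intro hmeets
  obtain ⟨d, hd, hconst⟩ := mem_nhdsGE_iff_exists_Ico_subset.1
    (eventually_nhdsGE_iff (p := fun s => c z s = c z a).2 ⟨rfl, h.atom_right z hz a ha⟩)
  have hnear : ∀ᶠ s in 𝓝[>] a, gap W c z s ≠ 0 := by
    filter_upwards [Ioc_mem_nhdsGT hab, Ioo_mem_nhdsGT hd] with s hsb hsd
    exact gap_ne_zero s hsb fun r hr => hconst ⟨hr.1, hr.2.trans hsd.2⟩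
  obtain ⟨τ, hτ, h0, hfirst⟩ := exists_first_zero hab (h.continuousOn_gap hz ha hab.le) hnear
    (meets_iff_gap_eq_zero.1 hmeets)
  refine gap_ne_zero τ hτ (h.atom_eq_of_not_meets_Ioo hz ha fun s hs => ?_) h0
  exact mt meets_iff_gap_eq_zero.1 (hfirst s hs)

theorem exists_first_meeting (h : IsMotion m M Vbar Γ u W c) (hz : z ∈ Γ) (hz₁ : z.1 ≠ 0) {t : ℝ}
    (ht : 0 < t) (hm : Meets W c z t) :
    ∃ τ ∈ Ioc 0 t, Meets W c z τ ∧ ∀ s ∈ Ioo 0 τ, ¬ Meets W c z s := by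
  have hcont := h.continuousOn_gap hz le_rfl ht.le
  have hnear : ∀ᶠ s in 𝓝[>] 0, gap W c z s ≠ 0 := by
    rw [← nhdsWithin_Ioc_eq_nhdsGT ht]
    refine ((hcont 0 (left_mem_Icc.2 ht.le)).mono Ioc_subset_Icc_self).eventually_ne ?_
    rwa [gap_zero, neg_ne_zero]
  simpa only [meets_iff_gap_eq_zero] using
    exists_first_zero ht hcont hnear (meets_iff_gap_eq_zero.1 hm)

end IsMotion

/-- An atom that starts off the piston, with a velocity in the range of the gas. -/
structure IsGeneric (vmin vmax : ℝ) (z : ℝ × ℝ) : Prop where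
  fst_ne_zero : z.1 ≠ 0
  lt_abs_snd : vmin < |z.2|
  abs_snd_lt : |z.2| < vmax

/-- A motion in the regime of the paper: the parameters are admissible, the atoms generic, and the
initial velocity of the piston respects the cutoff. -/
structure IsRegularMotion (m M Vbar vmin vmax : ℝ) (Γ : Set (ℝ × ℝ)) (u : ℝ) (W : ℝ → ℝ)
    (c : ℝ × ℝ → ℝ → ℝ) : Prop extends IsMotion m M Vbar Γ u W c where
  admissible : Admissible m M Vbar vmin vmax
  generic : ∀ z ∈ Γ, IsGeneric vmin vmax z
  abs_init_le : |u| ≤ Vbar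

/-- The atoms that can meet the piston up to time `t` start in this set. -/
def window (vmax Vbar t : ℝ) : Set (ℝ × ℝ) :=
  Icc (-((vmax + Vbar) * t)) ((vmax + Vbar) * t) ×ˢ univ

/-- The starting points of the atoms that reach, up to time `t` and from the left, a piston of
constant velocity `u`. -/
def hitL (vmin vmax u t : ℝ) : Set (ℝ × ℝ) :=
  {z | z.1 < 0 ∧ z.2 ∈ Ioo vmin vmax ∧ -((z.2 - u) * t) ≤ z.1}

/-- The starting points of the atoms that reach, up to time `t` and from the right, a piston of
constant velocity `u`. -/
def hitR (vmin vmax u t : ℝ) : Set (ℝ × ℝ) :=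
  {z | 0 < z.1 ∧ z.2 ∈ Ioo (-vmax) (-vmin) ∧ z.1 ≤ (u - z.2) * t}

theorem exists_mem_Ioc_mul_eq_iff {x w t : ℝ} (hx : 0 < x) :
    (∃ s ∈ Ioc 0 t, w * s = x) ↔ 0 < w ∧ x ≤ w * t := by
  constructor
  · rintro ⟨s, hs, rfl⟩
    have hw := pos_of_mul_pos_left hx hs.1.le
    exact ⟨hw, mul_le_mul_of_nonneg_left hs.2 hw.le⟩
  · rintro ⟨hw, hxt⟩
    exact ⟨x / w, ⟨div_pos hx hw, (div_le_iff₀' hw).2 hxt⟩, mul_div_cancel₀ x hw.ne'⟩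

theorem IsGeneric.mem_hit_iff {vmin vmax u t : ℝ} {z : ℝ × ℝ} (hz : IsGeneric vmin vmax z)
    (hu : |u| < vmin) :
    z ∈ hitL vmin vmax u t ∪ hitR vmin vmax u t ↔ ∃ s ∈ Ioc 0 t, z.1 + z.2 * s = u * s := by
  obtain ⟨hu₁, hu₂⟩ := abs_lt.1 hu
  obtain ⟨hv₁, hv₂⟩ := abs_lt.1 hz.abs_snd_lt
  rcases hz.fst_ne_zero.lt_or_gt with hneg | hpos
  · have hmeet : (∃ s ∈ Ioc 0 t, z.1 + z.2 * s = u * s) ↔ 0 < z.2 - u ∧ -z.1 ≤ (z.2 - u) * t := by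
      rw [← exists_mem_Ioc_mul_eq_iff (neg_pos.2 hneg)]
      exact exists_congr fun s => and_congr_right fun _ => by grind
    rw [hmeet]
    simp only [hitL, hitR, mem_union, mem_ofPred_eq, mem_Ioo]
    grind [lt_abs.1 hz.lt_abs_snd]
  · have hmeet : (∃ s ∈ Ioc 0 t, z.1 + z.2 * s = u * s) ↔ 0 < u - z.2 ∧ z.1 ≤ (u - z.2) * t := by
      rw [← exists_mem_Ioc_mul_eq_iff hpos]
      exact exists_congr fun s => and_congr_right fun _ => by grind
    rw [hmeet]
    simp only [hitL, hitR, mem_union, mem_ofPred_eq, mem_Ioo]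
    grind [lt_abs.1 hz.lt_abs_snd]

namespace IsRegularMotion

variable {m M Vbar vmin vmax u t τ : ℝ} {Γ : Set (ℝ × ℝ)} {W : ℝ → ℝ} {c : ℝ × ℝ → ℝ → ℝ}
  {z : ℝ × ℝ}

theorem atom_eq_of_first (h : IsRegularMotion m M Vbar vmin vmax Γ u W c) (hz : z ∈ Γ)
    (hfirst : ∀ s ∈ Ioo 0 τ, ¬ Meets W c z s) : ∀ s ∈ Ico 0 τ, c z s = z.2 :=
  fun s hs => (h.atom_eq_of_not_meets_Ioo hz le_rfl hfirst s hs).trans (h.atom_init z hz)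

theorem lt_sign_mul_snd_of_first (h : IsRegularMotion m M Vbar vmin vmax Γ u W c) (hz : z ∈ Γ)
    {σ : ℝ} (hσ : |σ| = 1) (hσz : σ * z.1 < 0) (hτ : 0 < τ) (hm : Meets W c z τ)
    (hfirst : ∀ s ∈ Ioo 0 τ, ¬ Meets W c z s) (hW : ∀ s ∈ Ico 0 τ, |W s| ≤ Vbar) :
    vmin < σ * z.2 := by
  have hgap := h.mul_le_sign_mul_gap_sub hz hσ le_rfl hτ.le hW (h.atom_eq_of_first hz hfirst)
  rw [meets_iff_gap_eq_zero.1 hm, gap_zero] at hgap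
  have hslow : -Vbar - σ * z.2 < 0 := by
    by_contra! hcon
    linarith [mul_nonneg hcon (sub_nonneg.2 hτ.le)]
  have hfast : vmin < |σ * z.2| := by
    rw [abs_mul, hσ, one_mul]
    exact (h.generic z hz).lt_abs_snd
  exact (lt_abs.1 hfast).resolve_right (by linarith [h.admissible.Vbar_lt])

theorem exists_collision_of_first (h : IsRegularMotion m M Vbar vmin vmax Γ u W c) (hz : z ∈ Γ)
    (hτ : 0 < τ) (hm : Meets W c z τ) (hfirst : ∀ s ∈ Ioo 0 τ, ¬ Meets W c z s)
    (hW : ∀ s ∈ Ico 0 τ, |W s| ≤ Vbar) :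
    ∃ V, |V| ≤ Vbar ∧ (∀ᶠ s in 𝓝[<] τ, W s = V) ∧
      W τ = reflectVel Vbar (pistonAfter m M V z.2) ∧ c z τ = atomAfter m M V z.2 := by
  obtain ⟨V, v, hbefore, hWτ, hcτ⟩ := h.collision z hz τ hτ hm
  obtain ⟨s, ⟨rfl, rfl⟩, hs⟩ := (hbefore.and (Ioo_mem_nhdsLT hτ)).exists
  have hs' : s ∈ Ico 0 τ := Ioo_subset_Ico_self hs
  rw [h.atom_eq_of_first hz hfirst s hs'] at hWτ hcτ
  exact ⟨W s, hW s hs', hbefore.mono fun r hr => hr.1, hWτ, hcτ⟩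

theorem not_meets_after_first (h : IsRegularMotion m M Vbar vmin vmax Γ u W c) (hz : z ∈ Γ)
    (hτ : 0 < τ) (hτt : τ < t) (hm : Meets W c z τ) (hfirst : ∀ s ∈ Ioo 0 τ, ¬ Meets W c z s)
    (hW : ∀ s ∈ Ico 0 t, |W s| ≤ Vbar) : ¬ Meets W c z t := by
  have hWτ : ∀ s ∈ Ico 0 τ, |W s| ≤ Vbar := fun s hs => hW s ⟨hs.1, hs.2.trans hτt⟩
  obtain ⟨σ, hσ, hσz⟩ := exists_sign_mul_neg (h.generic z hz).fst_ne_zero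
  have hv := h.lt_sign_mul_snd_of_first hz hσ hσz hτ hm hfirst hWτ
  obtain ⟨V, hV, -, -, hc⟩ := h.exists_collision_of_first hz hτ hm hfirst hWτ
  refine h.not_meets_of_escape hz hσ hτ.le hτt (fun s hs => hW s ⟨hτ.le.trans hs.1, hs.2⟩) ?_ ?_
  · rw [hc]
    exact h.admissible.atomAfter_lt hσ hV hv
  · rw [meets_iff_gap_eq_zero.1 hm, mul_zero]

theorem not_meets_before_of_abs_le (h : IsRegularMotion m M Vbar vmin vmax Γ u W c) (hz : z ∈ Γ)
    (ht : 0 < t) (hm : Meets W c z t) (hW : ∀ s ∈ Ico 0 t, |W s| ≤ Vbar) :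
    ∀ s ∈ Ioo 0 t, ¬ Meets W c z s := by
  obtain ⟨τ, hτ, hmτ, hfirst⟩ := h.exists_first_meeting hz (h.generic z hz).fst_ne_zero ht hm
  obtain rfl | hτt := hτ.2.eq_or_lt
  · exact hfirst
  · exact absurd hm (h.not_meets_after_first hz hτ.1 hτt hmτ hfirst hW)

theorem abs_piston_le (h : IsRegularMotion m M Vbar vmin vmax Γ u W c) (ht : 0 ≤ t) :
    |W t| ≤ Vbar := by
  refine forall_ge_of_forall_Ico (p := fun t => |W t| ≤ Vbar) (fun T hT hbelow => ?_) ht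
  have hWT : |W T| ≤ Vbar := by
    obtain rfl | hT := hT.eq_or_lt
    · rw [h.piston_init]
      exact h.abs_init_le
    by_cases! hm : ∀ z ∈ Γ, ¬ Meets W c z T
    · obtain ⟨s, hWs, hs⟩ := ((h.piston_free T hT hm).and (Ioo_mem_nhdsLT hT)).exists
      exact hWs ▸ hbelow s (Ioo_subset_Ico_self hs)
    · obtain ⟨z, hz, hzT⟩ := hm
      obtain ⟨V, hV, -, hWV, -⟩ := h.exists_collision_of_first hz hT hzT
        (h.not_meets_before_of_abs_le hz hT hzT hbelow) hbelow
      rw [hWV]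
      exact h.admissible.abs_reflectVel_pistonAfter_le hV (h.generic z hz).abs_snd_lt.le
  exact ⟨hWT, (h.piston_right T hT).mono fun s hs => hs ▸ hWT⟩

theorem not_meets_before (h : IsRegularMotion m M Vbar vmin vmax Γ u W c) (hz : z ∈ Γ)
    (hτ : 0 < τ) (hm : Meets W c z τ) : ∀ s ∈ Ioo 0 τ, ¬ Meets W c z s :=
  h.not_meets_before_of_abs_le hz hτ hm fun _ hs => h.abs_piston_le hs.1

theorem not_meets_after (h : IsRegularMotion m M Vbar vmin vmax Γ u W c) (hz : z ∈ Γ)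
    (hτ : 0 < τ) (hm : Meets W c z τ) : ∀ s ∈ Ioc τ t, ¬ Meets W c z s :=
  fun _ hs hms => h.not_meets_before hz (hτ.trans hs.1) hms τ ⟨hτ, hs.1⟩ hm

theorem exists_collision (h : IsRegularMotion m M Vbar vmin vmax Γ u W c) (hz : z ∈ Γ)
    (hτ : 0 < τ) (hm : Meets W c z τ) :
    ∃ V, |V| ≤ Vbar ∧ (∀ᶠ s in 𝓝[<] τ, W s = V) ∧
      W τ = reflectVel Vbar (pistonAfter m M V z.2) ∧ c z τ = atomAfter m M V z.2 :=
  h.exists_collision_of_first hz hτ hm (h.not_meets_before hz hτ hm)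
    fun _ hs => h.abs_piston_le hs.1

theorem fst_add_snd_mul_eq_integral (h : IsRegularMotion m M Vbar vmin vmax Γ u W c) (hz : z ∈ Γ)
    (hτ : 0 < τ) (hm : Meets W c z τ) : z.1 + z.2 * τ = ∫ s in (0 : ℝ)..τ, W s := by
  rw [← hm, integral_of_eqOn_Ico hτ.le (h.atom_eq_of_first hz (h.not_meets_before hz hτ hm)),
    smul_eq_mul, sub_zero, mul_comm]

theorem atom_eq_of_meets (h : IsRegularMotion m M Vbar vmin vmax Γ u W c) (hz : z ∈ Γ)
    (hτ : τ ∈ Ioc 0 t) (hm : Meets W c z τ) : c z t = c z τ :=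
  h.atom_eq_of_not_meets hz hτ.1.le hτ.2 (h.not_meets_after hz hτ.1 hm)

theorem atom_eq_snd_of_not_meets (h : IsRegularMotion m M Vbar vmin vmax Γ u W c) (hz : z ∈ Γ)
    (ht : 0 ≤ t) (hm : ∀ s ∈ Ioc 0 t, ¬ Meets W c z s) : c z t = z.2 :=
  (h.atom_eq_of_not_meets hz le_rfl ht hm).trans (h.atom_init z hz)

theorem atom_eq_or_exists (h : IsRegularMotion m M Vbar vmin vmax Γ u W c) (hz : z ∈ Γ)
    (ht : 0 ≤ t) : c z t = z.2 ∨ ∃ V, |V| ≤ Vbar ∧ c z t = atomAfter m M V z.2 := by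
  by_cases! hm : ∃ s ∈ Ioc 0 t, Meets W c z s
  · obtain ⟨s, hs, hms⟩ := hm
    obtain ⟨V, hV, -, -, hc⟩ := h.exists_collision hz hs.1 hms
    exact Or.inr ⟨V, hV, (h.atom_eq_of_meets hz hs hms).trans hc⟩
  · exact Or.inl (h.atom_eq_snd_of_not_meets hz ht hm)

theorem mem_window_of_meets (h : IsRegularMotion m M Vbar vmin vmax Γ u W c) (hz : z ∈ Γ)
    (hτ : τ ∈ Ioc 0 t) (hm : Meets W c z τ) : z ∈ window vmax Vbar t := by
  have hpiston : |∫ s in (0 : ℝ)..τ, W s| ≤ Vbar * (τ - 0) :=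
    norm_integral_le_of_norm_le_Ico (f := W) hτ.1.le fun _ hs => h.abs_piston_le hs.1
  have hatom : |z.2 * τ| ≤ vmax * τ := by
    rw [abs_mul, abs_of_pos hτ.1]
    exact mul_le_mul_of_nonneg_right (h.generic z hz).abs_snd_lt.le hτ.1.le
  have htime : (vmax + Vbar) * τ ≤ (vmax + Vbar) * t := by
    have := h.admissible
    exact mul_le_mul_of_nonneg_left hτ.2 (by linarith [this.vmin_lt, this.vmin_pos, this.Vbar_pos])
  rw [← h.fst_add_snd_mul_eq_integral hz hτ.1 hm, abs_le] at hpiston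
  rw [abs_le] at hatom
  exact ⟨⟨by linarith, by linarith⟩, mem_univ _⟩

theorem atom_eq_of_notMem_window (h : IsRegularMotion m M Vbar vmin vmax Γ u W c) (hz : z ∈ Γ)
    (ht : 0 ≤ t) (hzt : z ∉ window vmax Vbar t) : c z t = z.2 :=
  h.atom_eq_snd_of_not_meets hz ht fun _ hs hm => hzt (h.mem_window_of_meets hz hs hm)

theorem piston_eq_of_inter_window_eq_empty (h : IsRegularMotion m M Vbar vmin vmax Γ u W c)
    (ht : 0 ≤ t) (he : Γ ∩ window vmax Vbar t = ∅) : W t = u := by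
  refine (h.piston_eq_of_not_meets le_rfl ht fun s hs z hz hm => ?_).trans h.piston_init
  exact eq_empty_iff_forall_notMem.1 he z ⟨hz, h.mem_window_of_meets hz hs hm⟩

section SingleAtom

theorem eq_of_meets_of_inter_window_eq_singleton
    (h : IsRegularMotion m M Vbar vmin vmax Γ u W c) (he : Γ ∩ window vmax Vbar t = {z})
    {y : ℝ × ℝ} (hy : y ∈ Γ) {s : ℝ} (hs : s ∈ Ioc 0 t) (hm : Meets W c y s) : y = z :=
  he.subset ⟨hy, h.mem_window_of_meets hy hs hm⟩

theorem collision_of_single_atom (h : IsRegularMotion m M Vbar vmin vmax Γ u W c)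
    (he : Γ ∩ window vmax Vbar t = {z}) (hz : z ∈ Γ) (hτ : τ ∈ Ioc 0 t) (hm : Meets W c z τ) :
    z.1 + z.2 * τ = u * τ ∧ c z t = atomAfter m M u z.2 ∧
      W t = reflectVel Vbar (pistonAfter m M u z.2) := by
  have hbefore : ∀ r ∈ Ico 0 τ, W r = u := by
    intro r hr
    refine (h.piston_eq_of_not_meets_Ioo le_rfl (fun s hs y hy hms => ?_) r hr).trans h.piston_init
    have hsτ : s ∈ Ioc 0 t := ⟨hs.1, hs.2.le.trans hτ.2⟩
    obtain rfl := h.eq_of_meets_of_inter_window_eq_singleton he hy hsτ hms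
    exact h.not_meets_before hy hτ.1 hm s hs hms
  have hafter : W t = W τ := h.piston_eq_of_not_meets hτ.1.le hτ.2 fun s hs y hy hms => by
    obtain rfl := h.eq_of_meets_of_inter_window_eq_singleton he hy ⟨hτ.1.trans hs.1, hs.2⟩ hms
    exact h.not_meets_after hy hτ.1 hm s hs hms
  obtain ⟨V, -, hV, hWτ, hcτ⟩ := h.exists_collision hz hτ.1 hm
  obtain ⟨r, rfl, hr⟩ := (hV.and (Ioo_mem_nhdsLT hτ.1)).exists
  rw [hbefore r (Ioo_subset_Ico_self hr)] at hWτ hcτ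
  refine ⟨?_, (h.atom_eq_of_meets hz hτ hm).trans hcτ, hafter.trans hWτ⟩
  rw [h.fst_add_snd_mul_eq_integral hz hτ.1 hm, integral_of_eqOn_Ico hτ.1.le hbefore, smul_eq_mul,
    sub_zero, mul_comm]

theorem meets_of_single_atom (h : IsRegularMotion m M Vbar vmin vmax Γ u W c)
    (he : Γ ∩ window vmax Vbar t = {z}) (hz : z ∈ Γ) (hτ : τ ∈ Ioc 0 t)
    (hmeet : z.1 + z.2 * τ = u * τ) : ∃ s ∈ Ioc 0 t, Meets W c z s := by
  by_contra! hm
  have hpiston : ∀ r ∈ Ico 0 τ, W r = u := fun r hr =>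
    (h.piston_eq_of_not_meets le_rfl hr.1 fun s hs y hy hms => by
      have hst : s ∈ Ioc 0 t := ⟨hs.1, hs.2.trans (hr.2.le.trans hτ.2)⟩
      obtain rfl := h.eq_of_meets_of_inter_window_eq_singleton he hy hst hms
      exact hm s hst hms).trans h.piston_init
  have hatom := h.atom_eq_of_first hz fun s hs => hm s ⟨hs.1, hs.2.le.trans hτ.2⟩
  refine hm τ hτ ?_
  rw [Meets, integral_of_eqOn_Ico hτ.1.le hpiston, integral_of_eqOn_Ico hτ.1.le hatom,
    smul_eq_mul, smul_eq_mul, sub_zero, mul_comm τ, mul_comm τ, hmeet]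

theorem single_atom (h : IsRegularMotion m M Vbar vmin vmax Γ u W c) (ht : 0 ≤ t)
    (he : Γ ∩ window vmax Vbar t = {z}) :
    (z ∈ hitL vmin vmax u t ∪ hitR vmin vmax u t ∧ c z t = atomAfter m M u z.2 ∧
      W t = reflectVel Vbar (pistonAfter m M u z.2)) ∨
    (z ∉ hitL vmin vmax u t ∪ hitR vmin vmax u t ∧ c z t = z.2 ∧ W t = u) := by
  have hz : z ∈ Γ := (he.symm.subset rfl).1
  rw [(h.generic z hz).mem_hit_iff (h.admissible.abs_lt_vmin h.abs_init_le)]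
  by_cases! hm : ∃ s ∈ Ioc 0 t, Meets W c z s
  · obtain ⟨τ, hτ, hmτ⟩ := hm
    obtain ⟨hmeet, hafter⟩ := h.collision_of_single_atom he hz hτ hmτ
    exact Or.inl ⟨⟨τ, hτ, hmeet⟩, hafter⟩
  · refine Or.inr ⟨fun ⟨τ, hτ, hmeet⟩ => ?_, h.atom_eq_snd_of_not_meets hz ht hm, ?_⟩
    · obtain ⟨s, hs, hms⟩ := h.meets_of_single_atom he hz hτ hmeet
      exact hm s hs hms
    · refine (h.piston_eq_of_not_meets le_rfl ht fun s hs y hy hms => ?_).trans h.piston_init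
      obtain rfl := h.eq_of_meets_of_inter_window_eq_singleton he hy hs hms
      exact hm s hs hms

end SingleAtom

end IsRegularMotion

/-! ### Integrals over a Poisson process -/

section CountedSums

variable {S : Type*}

theorem tsum_eq_of_inter_eq_singleton {Γ D : Set S} {p : S → Prop} [DecidablePred p] {F : S → ℝ}
    (h0 : ∀ z ∈ Γ, z ∉ D → F z = 0) {z : S} (he : Γ ∩ D = {z}) :
    ∑' y : {y // y ∈ Γ ∧ p y}, F y = if p z then F z else 0 := by
  have hz : z ∈ Γ := (he.symm.subset rfl).1
  have hzero : ∀ y : {y // y ∈ Γ ∧ p y}, (y : S) ≠ z → F y = 0 := fun y hy =>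
    h0 y y.2.1 fun hD => hy (he.subset ⟨y.2.1, hD⟩)
  split_ifs with hpz
  · exact tsum_eq_single (⟨z, hz, hpz⟩ : {y // y ∈ Γ ∧ p y})
      fun y hy => hzero y fun h => hy (Subtype.ext h)
  · exact (tsum_congr fun y => hzero y fun h => hpz (h ▸ y.2.2)).trans tsum_zero

theorem abs_tsum_le_mul_ncard {Γ D : Set S} {p : S → Prop} {F : S → ℝ} {K : ℝ} (hK : 0 ≤ K)
    (h0 : ∀ z ∈ Γ, z ∉ D → F z = 0) (hF : ∀ z ∈ Γ, |F z| ≤ K) (hfin : (Γ ∩ D).Finite) :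
    |∑' y : {y // y ∈ Γ ∧ p y}, F y| ≤ K * (Γ ∩ D).ncard := by
  have hfin' : {y : {y // y ∈ Γ ∧ p y} | (y : S) ∈ Γ ∩ D}.Finite :=
    hfin.preimage Subtype.val_injective.injOn
  have hcard : hfin'.toFinset.card ≤ (Γ ∩ D).ncard := by
    rw [← ncard_eq_toFinset_card _ hfin']
    exact ncard_le_ncard_of_injOn Subtype.val (fun y hy => hy) Subtype.val_injective.injOn hfin
  rw [tsum_eq_sum (s := hfin'.toFinset) fun y hy =>
    h0 y y.2.1 fun hD => hy (hfin'.mem_toFinset.2 ⟨y.2.1, hD⟩)]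
  calc |∑ y ∈ hfin'.toFinset, F y|
      ≤ ∑ y ∈ hfin'.toFinset, |F y| := Finset.abs_sum_le_sum_abs _ _
    _ ≤ hfin'.toFinset.card • K := Finset.sum_le_card_nsmul _ _ K fun y _ => hF y y.2.1
    _ ≤ K * (Γ ∩ D).ncard := by
        rw [nsmul_eq_mul, mul_comm]
        exact mul_le_mul_of_nonneg_left (Nat.cast_le.2 hcard) hK

variable [MeasurableSpace S] [MeasurableSingletonClass S]

theorem isFiniteMeasure_count_restrict {s : Set S} (hs : s.Finite) :
    IsFiniteMeasure (Measure.count.restrict s : Measure S) :=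
  ⟨by rw [Measure.restrict_apply_univ]; exact Measure.count_apply_lt_top.2 hs⟩

theorem abs_integral_count_le {s : Set S} (hs : s.Finite) {G : S → ℝ} {K : ℝ}
    (hK : ∀ z, |G z| ≤ K) : |∫ z in s, G z ∂Measure.count| ≤ K * s.ncard := by
  have := isFiniteMeasure_count_restrict hs
  refine (norm_integral_le_of_norm_le_const (f := G) (Eventually.of_forall hK)).trans_eq ?_
  rw [measureReal_restrict_apply_univ, Measure.real, Measure.count_apply hs.measurableSet,
    ← hs.cast_ncard_eq]
  simp

theorem abs_sub_integral_count_le {s : Set S} (hs : s.Finite) {G : S → ℝ} {K y : ℝ}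
    (hK : ∀ z, |G z| ≤ K) (hy : |y| ≤ K * s.ncard) (hy₁ : ∀ z, s = {z} → y = G z) :
    |y - ∫ z in s, G z ∂Measure.count| ≤ 2 * K * (if 2 ≤ s.ncard then (s.ncard : ℝ) else 0) := by
  split_ifs with htwo
  · linarith [abs_sub y (∫ z in s, G z ∂Measure.count), abs_integral_count_le hs hK]
  obtain hzero | hone : s.ncard = 0 ∨ s.ncard = 1 := by lia
  · rw [hzero, Nat.cast_zero, mul_zero] at hy
    rw [(ncard_eq_zero hs).1 hzero, abs_nonpos_iff.1 hy]
    simp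
  · obtain ⟨z, rfl⟩ := ncard_eq_one.1 hone
    rw [hy₁ z rfl]
    simp [Measure.restrict_singleton]

end CountedSums

section PoissonMoments

theorem hasSum_poisson_mul_id (r : NNReal) :
    HasSum (fun n : ℕ => Real.exp (-r) * (r : ℝ) ^ n / (n.factorial : ℝ) * n) r := by
  rw [← hasSum_nat_add_iff' 1]
  have h := (hasSum_one_poissonMeasure r).mul_right (r : ℝ)
  simp only [Finset.range_one, Finset.sum_singleton, Nat.cast_zero, mul_zero, sub_zero]
  rw [one_mul] at h
  refine h.congr_fun fun n => ?_
  rw [Nat.factorial_succ]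
  push_cast
  field_simp
  ring

theorem integrable_natCast_poissonMeasure (r : NNReal) :
    Integrable (fun n : ℕ => (n : ℝ)) (poissonMeasure r) := by
  rw [integrable_poissonMeasure_iff]
  simpa using (hasSum_poisson_mul_id r).summable

theorem integral_natCast_poissonMeasure (r : NNReal) :
    ∫ n : ℕ, (n : ℝ) ∂(poissonMeasure r) = r := by
  rw [integral_poissonMeasure]
  simpa using (hasSum_poisson_mul_id r).tsum_eq

theorem integral_two_le_poissonMeasure_le (r : NNReal) :
    ∫ n : ℕ, (if 2 ≤ n then (n : ℝ) else 0) ∂(poissonMeasure r) ≤ (r : ℝ) ^ 2 := by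
  have hsplit : (fun n : ℕ => if 2 ≤ n then (n : ℝ) else 0) =
      fun n : ℕ => (n : ℝ) - ({1} : Set ℕ).indicator (fun _ => (1 : ℝ)) n := by
    funext n
    rcases n with _ | _ | n <;> simp
  rw [hsplit, integral_sub (integrable_natCast_poissonMeasure r)
    ((integrable_const _).indicator (measurableSet_singleton _)), integral_natCast_poissonMeasure,
    integral_indicator_const _ (measurableSet_singleton _), poissonMeasure_real_singleton]
  have hexp := mul_le_mul_of_nonneg_left (Real.add_one_le_exp (-(r : ℝ))) r.coe_nonneg
  simp only [pow_one, Nat.factorial_one, Nat.cast_one, div_one, smul_eq_mul, mul_one]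
  nlinarith [hexp]

end PoissonMoments

namespace IsPoissonProcess

variable {Ω S : Type*} [MeasurableSpace Ω] [MeasurableSpace S]
  {Γ : Ω → Set S} {ν : Measure S} {P : Measure Ω} {D : Set S}

theorem count_restrict_apply [MeasurableSingletonClass S] (h : IsPoissonProcess Γ ν P)
    (hD : MeasurableSet D) (ω : Ω) {A : Set S} (hA : MeasurableSet A) :
    Measure.count.restrict (Γ ω ∩ D) A = ((Γ ω ∩ (A ∩ D)).encard : ENNReal) := by
  rw [Measure.restrict_apply hA, inter_left_comm, Measure.count_apply
    ((h.countable ω).measurableSet.inter (hA.inter hD))]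

theorem measurable_count_restrict [MeasurableSingletonClass S] (h : IsPoissonProcess Γ ν P)
    (hD : MeasurableSet D) :
    Measurable fun ω => (Measure.count.restrict (Γ ω ∩ D) : Measure S) := by
  refine Measure.measurable_of_measurable_coe _ fun A hA => ?_
  simp_rw [h.count_restrict_apply hD _ hA]
  exact (measurable_of_countable (fun n : ℕ∞ => (n : ENNReal))).comp
    (h.measurable_count _ (hA.inter hD))

variable [IsProbabilityMeasure P]

theorem ae_finite (h : IsPoissonProcess Γ ν P) (hD : MeasurableSet D) (hν : ν D ≠ ⊤) :
    ∀ᵐ ω ∂P, (Γ ω ∩ D).Finite := by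
  have hmeas : ∀ k : ℕ, MeasurableSet {ω | (Γ ω ∩ D).encard = k} := fun k =>
    h.measurable_count D hD (measurableSet_singleton (k : ℕ∞))
  have hdisj : Pairwise (Function.onFun Disjoint fun k : ℕ => {ω | (Γ ω ∩ D).encard = k}) :=
    fun i j hij => Set.disjoint_left.2 fun ω hi hj => hij (ENat.natCast_inj.1 (hi.symm.trans hj))
  have htotal : P (⋃ k : ℕ, {ω | (Γ ω ∩ D).encard = k}) = 1 := by
    rw [measure_iUnion hdisj hmeas]
    simp_rw [h.law_count D hD hν]
    rw [← measure_iUnion (fun i j hij => by simpa using hij) fun k => measurableSet_singleton k,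
      iUnion_of_singleton, measure_univ]
  filter_upwards [(prob_compl_eq_zero_iff (MeasurableSet.iUnion hmeas)).2 htotal] with ω hω
  obtain ⟨k, hk⟩ := mem_iUnion.1 hω
  exact finite_of_encard_eq_coe hk

theorem hasLaw_ncard (h : IsPoissonProcess Γ ν P) (hD : MeasurableSet D) (hν : ν D ≠ ⊤) :
    HasLaw (fun ω => (Γ ω ∩ D).ncard) (poissonMeasure (ν D).toNNReal) P := by
  have hmeas : Measurable fun ω => (Γ ω ∩ D).ncard :=
    (measurable_of_countable ENat.toNat).comp (h.measurable_count D hD)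
  refine ⟨hmeas.aemeasurable, Measure.ext_of_singleton fun k => ?_⟩
  rw [Measure.map_apply hmeas (measurableSet_singleton k), ← h.law_count D hD hν k]
  refine measure_congr ?_
  filter_upwards [h.ae_finite hD hν] with ω hω
  refine propext (?_ : (Γ ω ∩ D).ncard = k ↔ (Γ ω ∩ D).encard = k)
  rw [← hω.cast_ncard_eq, ENat.natCast_inj]

theorem integrable_ncard (h : IsPoissonProcess Γ ν P) (hD : MeasurableSet D) (hν : ν D ≠ ⊤) :
    Integrable (fun ω => ((Γ ω ∩ D).ncard : ℝ)) P :=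
  have hlaw := h.hasLaw_ncard hD hν
  (hlaw.map_eq ▸ integrable_natCast_poissonMeasure _).comp_aemeasurable hlaw.aemeasurable

theorem integral_two_le_ncard_le (h : IsPoissonProcess Γ ν P) (hD : MeasurableSet D)
    (hν : ν D ≠ ⊤) :
    ∫ ω, (if 2 ≤ (Γ ω ∩ D).ncard then ((Γ ω ∩ D).ncard : ℝ) else 0) ∂P ≤ ν.real D ^ 2 :=
  ((h.hasLaw_ncard hD hν).integral_comp (f := fun n : ℕ => if 2 ≤ n then (n : ℝ) else 0)
    (measurable_of_countable _).aestronglyMeasurable).trans_le (integral_two_le_poissonMeasure_le _)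

theorem lintegral_encard (h : IsPoissonProcess Γ ν P) (hD : MeasurableSet D) (hν : ν D ≠ ⊤) :
    ∫⁻ ω, ((Γ ω ∩ D).encard : ENNReal) ∂P = ν D := by
  have hmean : ∫ ω, ((Γ ω ∩ D).ncard : ℝ) ∂P = (ν D).toReal :=
    ((h.hasLaw_ncard hD hν).integral_comp (f := fun n : ℕ => (n : ℝ))
      (measurable_of_countable _).aestronglyMeasurable).trans (integral_natCast_poissonMeasure _)
  rw [← ENNReal.ofReal_toReal hν, ← hmean, ofReal_integral_eq_lintegral_ofReal
    (h.integrable_ncard hD hν) (Eventually.of_forall fun ω => Nat.cast_nonneg _)]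
  refine lintegral_congr_ae ?_
  filter_upwards [h.ae_finite hD hν] with ω hω
  rw [← hω.cast_ncard_eq]
  simp

theorem ae_inter_eq_empty (h : IsPoissonProcess Γ ν P) (hD : MeasurableSet D) (hν : ν D = 0) :
    ∀ᵐ ω ∂P, Γ ω ∩ D = ∅ := by
  have hmean := h.lintegral_encard hD (hν ▸ ENNReal.zero_ne_top)
  have hmeas : Measurable fun ω => ((Γ ω ∩ D).encard : ENNReal) :=
    (measurable_of_countable fun n : ℕ∞ => (n : ENNReal)).comp (h.measurable_count D hD)
  filter_upwards [(lintegral_eq_zero_iff hmeas).1 (hmean.trans hν)] with ω hω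
  simpa using hω

section Campbell

variable [MeasurableSingletonClass S]

theorem bind_count_restrict (h : IsPoissonProcess Γ ν P) (hD : MeasurableSet D) (hν : ν D ≠ ⊤) :
    P.bind (fun ω => (Measure.count.restrict (Γ ω ∩ D) : Measure S)) = ν.restrict D := by
  refine Measure.ext fun A hA => ?_
  rw [Measure.bind_apply hA (h.measurable_count_restrict hD).aemeasurable,
    Measure.restrict_apply hA]
  simp_rw [h.count_restrict_apply hD _ hA]
  exact h.lintegral_encard (hA.inter hD) (measure_ne_top_of_subset inter_subset_right hν)

theorem integral_toReal_lintegral_count (h : IsPoissonProcess Γ ν P) (hD : MeasurableSet D)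
    (hν : ν D ≠ ⊤) {g : S → ENNReal} (hg : Measurable g) (hgν : ∫⁻ z in D, g z ∂ν ≠ ⊤) :
    Integrable (fun ω => (∫⁻ z in Γ ω ∩ D, g z ∂Measure.count).toReal) P ∧
      ∫ ω, (∫⁻ z in Γ ω ∩ D, g z ∂Measure.count).toReal ∂P = (∫⁻ z in D, g z ∂ν).toReal := by
  have hmeas : Measurable fun ω => ∫⁻ z in Γ ω ∩ D, g z ∂Measure.count :=
    (Measure.measurable_lintegral hg).comp (h.measurable_count_restrict hD)
  rw [← h.bind_count_restrict hD hν, Measure.lintegral_bind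
    (h.measurable_count_restrict hD).aemeasurable hg.aemeasurable] at hgν ⊢
  exact ⟨integrable_toReal_of_lintegral_ne_top hmeas.aemeasurable hgν,
    integral_toReal hmeas.aemeasurable (ae_lt_top hmeas hgν)⟩

theorem integral_integral_count (h : IsPoissonProcess Γ ν P) (hD : MeasurableSet D)
    (hν : ν D ≠ ⊤) {G : S → ℝ} (hG : Measurable G) {K : ℝ} (hK : ∀ z, |G z| ≤ K) :
    Integrable (fun ω => ∫ z in Γ ω ∩ D, G z ∂Measure.count) P ∧
      ∫ ω, ∫ z in Γ ω ∩ D, G z ∂Measure.count ∂P = ∫ z in D, G z ∂ν := by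
  have : IsFiniteMeasure (ν.restrict D) := isFiniteMeasure_restrict.2 hν
  have hint : ∀ (ρ : Measure S) [IsFiniteMeasure ρ], Integrable G ρ := fun ρ _ =>
    Integrable.of_bound hG.aestronglyMeasurable K (Eventually.of_forall hK)
  have hparts : (fun ω => ∫ z in Γ ω ∩ D, G z ∂Measure.count) =ᵐ[P] fun ω =>
      (∫⁻ z in Γ ω ∩ D, ENNReal.ofReal (G z) ∂Measure.count).toReal -
      (∫⁻ z in Γ ω ∩ D, ENNReal.ofReal (-G z) ∂Measure.count).toReal := by
    filter_upwards [h.ae_finite hD hν] with ω hω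
    have := isFiniteMeasure_count_restrict hω
    exact integral_eq_lintegral_pos_part_sub_lintegral_neg_part (hint _)
  have hpos := h.integral_toReal_lintegral_count hD hν hG.ennreal_ofReal
    (hint (ν.restrict D)).lintegral_lt_top.ne
  have hneg := h.integral_toReal_lintegral_count hD hν (g := fun z => ENNReal.ofReal (-G z))
    hG.neg.ennreal_ofReal (hint (ν.restrict D)).neg.lintegral_lt_top.ne
  refine ⟨(hpos.1.sub hneg.1).congr hparts.symm, ?_⟩
  rw [integral_congr_ae hparts, integral_sub hpos.1 hneg.1, hpos.2, hneg.2]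
  exact (integral_eq_lintegral_pos_part_sub_lintegral_neg_part (hint _)).symm

theorem abs_integral_sub_le (h : IsPoissonProcess Γ ν P) (hD : MeasurableSet D) (hν : ν D ≠ ⊤)
    {G : S → ℝ} (hG : Measurable G) {K : ℝ} (hK0 : 0 ≤ K) (hK : ∀ z, |G z| ≤ K) {Y : Ω → ℝ}
    (hY : AEStronglyMeasurable Y P)
    (hbound : ∀ᵐ ω ∂P, (Γ ω ∩ D).Finite → |Y ω| ≤ K * (Γ ω ∩ D).ncard)
    (hsingle : ∀ᵐ ω ∂P, ∀ z, Γ ω ∩ D = {z} → Y ω = G z) :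
    Integrable Y P ∧ |∫ ω, Y ω ∂P - ∫ z in D, G z ∂ν| ≤ 2 * K * ν.real D ^ 2 := by
  have hfin := h.ae_finite hD hν
  have hcount := h.integrable_ncard hD hν
  have hYint : Integrable Y P := (hcount.const_mul K).mono' hY <| by
    filter_upwards [hbound, hfin] with ω hω hω' using hω hω'
  have htwo : Integrable
      (fun ω => if 2 ≤ (Γ ω ∩ D).ncard then ((Γ ω ∩ D).ncard : ℝ) else 0) P := by
    refine hcount.mono' ?_ (Eventually.of_forall fun ω => by split_ifs <;> simp)
    exact ((measurable_of_countable (fun n : ℕ => if 2 ≤ n then (n : ℝ) else 0)).comp_aemeasurable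
      (h.hasLaw_ncard hD hν).aemeasurable).aestronglyMeasurable
  obtain ⟨hGint, hcampbell⟩ := h.integral_integral_count hD hν hG hK
  refine ⟨hYint, ?_⟩
  rw [← hcampbell, ← integral_sub hYint hGint]
  calc |∫ ω, (Y ω - ∫ z in Γ ω ∩ D, G z ∂Measure.count) ∂P|
      ≤ ∫ ω, 2 * K * (if 2 ≤ (Γ ω ∩ D).ncard then ((Γ ω ∩ D).ncard : ℝ) else 0) ∂P := by
        refine norm_integral_le_of_norm_le (f := fun ω => Y ω - ∫ z in Γ ω ∩ D, G z ∂Measure.count)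
          (htwo.const_mul _) ?_
        filter_upwards [hbound, hsingle, hfin] with ω hω hω₁ hω'
        exact abs_sub_integral_count_le hω' hK (hω hω') hω₁
    _ ≤ 2 * K * ν.real D ^ 2 := by
        rw [integral_const_mul]
        exact mul_le_mul_of_nonneg_left (h.integral_two_le_ncard_le hD hν) (by positivity)

end Campbell

end IsPoissonProcess

/-! ### Rates of collisions -/

/-- The velocity density of a gas with velocities in the range `vmin < |v| < vmax`, which need be
neither even nor normalized. -/
structure IsGasDensity (vmin vmax : ℝ) (p : ℝ → ℝ) : Prop where
  measurable : Measurable p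
  nonneg : ∀ v, 0 ≤ p v
  integrable : Integrable p
  cutoff : ∀ v, |v| ≤ vmin ∨ vmax ≤ |v| → p v = 0

theorem IsVelocityDensity.isGasDensity {vmin vmax : ℝ} {f p : ℝ → ℝ}
    (hf : IsVelocityDensity vmin vmax f) {n : ℝ} (hn : 0 ≤ n) (hp : ∀ v, p v = n * f v) :
    IsGasDensity vmin vmax p := by
  obtain rfl : p = fun v => n * f v := funext hp
  exact ⟨hf.measurable.const_mul n, fun v => mul_nonneg hn (hf.nonneg v),
    hf.integrable.const_mul n, fun v hv => by rw [hf.cutoff v hv, mul_zero]⟩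

theorem IsGasDensity.integrable_mul {vmin vmax : ℝ} {p : ℝ → ℝ} (hp : IsGasDensity vmin vmax p)
    {g : ℝ → ℝ} (hg : Measurable g) {K : ℝ} (hK : ∀ v, |v| < vmax → |g v| ≤ K) :
    Integrable fun v => g v * p v := by
  refine (hp.integrable.const_mul K).mono' (hg.mul hp.measurable).aestronglyMeasurable
    (Eventually.of_forall fun v => ?_)
  rw [Real.norm_eq_abs, abs_mul, abs_of_nonneg (hp.nonneg v)]
  rcases lt_or_ge |v| vmax with hv | hv
  · exact mul_le_mul_of_nonneg_right (hK v hv) (hp.nonneg v)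
  · simp only [hp.cutoff v (Or.inr hv), mul_zero, le_refl]

theorem setIntegral_comp_snd {E : Set (ℝ × ℝ)} (hE : MeasurableSet E) {R : ℝ}
    (hER : E ⊆ Icc (-R) R ×ˢ univ) {h : ℝ → ℝ} (hh : Integrable h) :
    ∫ z in E, h z.2 = ∫ v, volume.real {x | (x, v) ∈ E} * h v := by
  have hint : IntegrableOn (fun z : ℝ × ℝ => h z.2) E := by
    refine IntegrableOn.mono_set ?_ hER
    rw [IntegrableOn, Measure.volume_eq_prod, ← Measure.prod_restrict, Measure.restrict_univ]
    exact hh.comp_snd _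
  rw [← integral_indicator hE, Measure.volume_eq_prod, integral_prod_symm _
    ((integrable_indicator_iff hE).2 hint)]
  refine integral_congr_ae (Eventually.of_forall fun v => ?_)
  exact integral_indicator_const (h v) (hE.preimage measurable_prodMk_right)

theorem integrable_indicator_snd {ν : Measure (ℝ × ℝ)} [IsFiniteMeasure ν] {E : Set (ℝ × ℝ)}
    (hE : MeasurableSet E) {g : ℝ → ℝ} {K : ℝ} (hgK : ∀ z ∈ E, |g z.2| ≤ K) (hK : 0 ≤ K)
    (hg : Measurable g) : Integrable (E.indicator fun z => g z.2) ν := by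
  refine Integrable.of_bound ((hg.comp measurable_snd).indicator hE).aestronglyMeasurable K
    (Eventually.of_forall fun z => ?_)
  by_cases hz : z ∈ E
  · rw [indicator_of_mem hz]
    exact hgK z hz
  · rwa [indicator_of_notMem hz, norm_zero]

theorem integral_indicator_Ioo_mul {a b : ℝ} (hab : a ≤ b) (f g : ℝ → ℝ) :
    ∫ v, (Ioo a b).indicator f v * g v = ∫ v in a..b, f v * g v := by
  rw [intervalIntegral.integral_of_le hab, integral_Ioc_eq_integral_Ioo,
    ← integral_indicator measurableSet_Ioo]
  exact integral_congr_ae (Eventually.of_forall fun v => (indicator_mul_left _ _ _).symm)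

section Window

variable {vmin vmax Vbar t : ℝ}

theorem measurableSet_window : MeasurableSet (window vmax Vbar t) :=
  measurableSet_Icc.prod MeasurableSet.univ

theorem measurableSet_hitL {u : ℝ} : MeasurableSet (hitL vmin vmax u t) :=
  (measurableSet_lt measurable_fst measurable_const).inter
    ((measurable_snd measurableSet_Ioo).inter
      (measurableSet_le (((measurable_snd.sub_const u).mul_const t).neg) measurable_fst))

theorem measurableSet_hitR {u : ℝ} : MeasurableSet (hitR vmin vmax u t) :=
  (measurableSet_lt measurable_const measurable_fst).inter
    ((measurable_snd measurableSet_Ioo).inter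
      (measurableSet_le measurable_fst ((measurable_snd.const_sub u).mul_const t)))

theorem disjoint_hitL_hitR {u : ℝ} : Disjoint (hitL vmin vmax u t) (hitR vmin vmax u t) :=
  Set.disjoint_left.2 fun _ hL hR => hL.1.not_gt hR.1

variable {u : ℝ} {z : ℝ × ℝ}

theorem abs_snd_lt_of_mem_hitL (hmin : 0 ≤ vmin) (hz : z ∈ hitL vmin vmax u t) : |z.2| < vmax :=
  abs_lt.2 ⟨by linarith [hz.2.1.1, hz.2.1.2], hz.2.1.2⟩

theorem abs_snd_lt_of_mem_hitR (hmin : 0 ≤ vmin) (hz : z ∈ hitR vmin vmax u t) : |z.2| < vmax :=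
  abs_lt.2 ⟨hz.2.1.1, by linarith [hz.2.1.1, hz.2.1.2]⟩

theorem hitL_subset_window (ht : 0 ≤ t) (hu : |u| ≤ Vbar) :
    hitL vmin vmax u t ⊆ window vmax Vbar t := by
  rintro z ⟨hneg, hv, hreach⟩
  have hspeed := mul_le_mul_of_nonneg_right
    (show z.2 - u ≤ vmax + Vbar by linarith [hv.2, (abs_le.1 hu).1]) ht
  exact ⟨⟨by linarith, by linarith⟩, mem_univ _⟩

theorem hitR_subset_window (ht : 0 ≤ t) (hu : |u| ≤ Vbar) :
    hitR vmin vmax u t ⊆ window vmax Vbar t := by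
  rintro z ⟨hpos, hv, hreach⟩
  have hspeed := mul_le_mul_of_nonneg_right
    (show u - z.2 ≤ vmax + Vbar by linarith [hv.1, (abs_le.1 hu).2]) ht
  exact ⟨⟨by linarith, by linarith⟩, mem_univ _⟩

theorem volume_section_hitL (ht : 0 ≤ t) (hu : |u| ≤ vmin) (v : ℝ) :
    volume.real {x | (x, v) ∈ hitL vmin vmax u t} =
      (Ioo vmin vmax).indicator (fun v => t * (v - u)) v := by
  by_cases hv : v ∈ Ioo vmin vmax
  · have hsection : {x | (x, v) ∈ hitL vmin vmax u t} = Ico (-((v - u) * t)) 0 := by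
      ext x
      simp only [hitL, mem_ofPred_eq, mem_Ico]
      tauto
    have hlen : 0 ≤ (v - u) * t := mul_nonneg (by linarith [hv.1, (abs_le.1 hu).2]) ht
    rw [hsection, indicator_of_mem hv, Real.volume_real_Ico_of_le (neg_nonpos.2 hlen), zero_sub,
      neg_neg, mul_comm]
  · have hsection : {x | (x, v) ∈ hitL vmin vmax u t} = ∅ :=
      eq_empty_of_forall_notMem fun _ hx => hv hx.2.1
    rw [hsection, indicator_of_notMem hv, measureReal_empty]

theorem volume_section_hitR (ht : 0 ≤ t) (hu : |u| ≤ vmin) (v : ℝ) :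
    volume.real {x | (x, v) ∈ hitR vmin vmax u t} =
      (Ioo (-vmax) (-vmin)).indicator (fun v => t * (u - v)) v := by
  by_cases hv : v ∈ Ioo (-vmax) (-vmin)
  · have hsection : {x | (x, v) ∈ hitR vmin vmax u t} = Ioc 0 ((u - v) * t) := by
      ext x
      simp only [hitR, mem_ofPred_eq, mem_Ioc]
      tauto
    have hlen : 0 ≤ (u - v) * t := mul_nonneg (by linarith [hv.2, (abs_le.1 hu).1]) ht
    rw [hsection, indicator_of_mem hv, Real.volume_real_Ioc_of_le hlen, sub_zero, mul_comm]
  · have hsection : {x | (x, v) ∈ hitR vmin vmax u t} = ∅ :=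
      eq_empty_of_forall_notMem fun _ hx => hv hx.2.1
    rw [hsection, indicator_of_notMem hv, measureReal_empty]

end Window

section HitValue

variable {vmin vmax u t : ℝ} {gL gR : ℝ → ℝ} {z : ℝ × ℝ}

/-- The contribution of an atom that starts from `z` to a quantity that changes by `gL v` or `gR v`
when an atom of velocity `v` hits, from the left or from the right, a piston of constant
velocity `u`. -/
noncomputable def hitValue (vmin vmax u t : ℝ) (gL gR : ℝ → ℝ) (z : ℝ × ℝ) : ℝ :=
  (hitL vmin vmax u t).indicator (fun z => gL z.2) z +
    (hitR vmin vmax u t).indicator (fun z => gR z.2) z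

theorem hitValue_of_mem_hitL (hz : z ∈ hitL vmin vmax u t) :
    hitValue vmin vmax u t gL gR z = gL z.2 := by
  rw [hitValue, indicator_of_mem hz,
    indicator_of_notMem (Set.disjoint_left.1 disjoint_hitL_hitR hz), add_zero]

theorem hitValue_of_mem_hitR (hz : z ∈ hitR vmin vmax u t) :
    hitValue vmin vmax u t gL gR z = gR z.2 := by
  rw [hitValue, indicator_of_mem hz,
    indicator_of_notMem (Set.disjoint_right.1 disjoint_hitL_hitR hz), zero_add]

theorem hitValue_of_notMem (hz : z ∉ hitL vmin vmax u t ∪ hitR vmin vmax u t) :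
    hitValue vmin vmax u t gL gR z = 0 := by
  rw [hitValue, indicator_of_notMem fun h => hz (Or.inl h),
    indicator_of_notMem fun h => hz (Or.inr h), add_zero]

theorem measurable_hitValue (hgL : Measurable gL) (hgR : Measurable gR) :
    Measurable (hitValue vmin vmax u t gL gR) :=
  ((hgL.comp measurable_snd).indicator measurableSet_hitL).add
    ((hgR.comp measurable_snd).indicator measurableSet_hitR)

theorem abs_hitValue_le {K : ℝ} (hmin : 0 ≤ vmin) (hK : 0 ≤ K)
    (hgL : ∀ v, |v| < vmax → |gL v| ≤ K) (hgR : ∀ v, |v| < vmax → |gR v| ≤ K) (z : ℝ × ℝ) :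
    |hitValue vmin vmax u t gL gR z| ≤ K := by
  by_cases! hz : z ∈ hitL vmin vmax u t ∪ hitR vmin vmax u t
  · rcases hz with hz | hz
    · rw [hitValue_of_mem_hitL hz]
      exact hgL _ (abs_snd_lt_of_mem_hitL hmin hz)
    · rw [hitValue_of_mem_hitR hz]
      exact hgR _ (abs_snd_lt_of_mem_hitR hmin hz)
  · rwa [hitValue_of_notMem hz, abs_zero]

end HitValue

section Intensity

variable {vmin vmax Vbar u t : ℝ} {pL pR : ℝ → ℝ}

theorem measurable_gas (hL : IsGasDensity vmin vmax pL) (hR : IsGasDensity vmin vmax pR) :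
    Measurable fun z : ℝ × ℝ => if z.1 < 0 then pL z.2 else pR z.2 :=
  Measurable.ite (measurableSet_lt measurable_fst measurable_const)
    (hL.measurable.comp measurable_snd) (hR.measurable.comp measurable_snd)

theorem ae_isGeneric (hL : IsGasDensity vmin vmax pL) (hR : IsGasDensity vmin vmax pR)
    {Ω : Type*} [MeasurableSpace Ω] {P : Measure Ω} [IsProbabilityMeasure P]
    {Γ : Ω → Set (ℝ × ℝ)} (h : IsPoissonProcess Γ (gasIntensity pL pR) P) :
    ∀ᵐ ω ∂P, ∀ z ∈ Γ ω, IsGeneric vmin vmax z := by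
  have hm₁ : MeasurableSet (({0} : Set ℝ) ×ˢ (univ : Set ℝ)) :=
    (measurableSet_singleton 0).prod MeasurableSet.univ
  have hm₂ : MeasurableSet {z : ℝ × ℝ | |z.2| ≤ vmin ∨ vmax ≤ |z.2|} :=
    (measurableSet_le measurable_snd.abs measurable_const).union
      (measurableSet_le measurable_const measurable_snd.abs)
  have hzero₁ : gasIntensity pL pR (({0} : Set ℝ) ×ˢ (univ : Set ℝ)) = 0 := by
    refine withDensity_absolutelyContinuous _ _ ?_
    rw [Measure.volume_eq_prod, Measure.prod_prod, Real.volume_singleton, zero_mul]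
  have hzero₂ : gasIntensity pL pR {z : ℝ × ℝ | |z.2| ≤ vmin ∨ vmax ≤ |z.2|} = 0 := by
    rw [gasIntensity, withDensity_apply _ hm₂, setLIntegral_congr_fun (g := fun _ => 0) hm₂
      (fun z hz => ?_), lintegral_zero]
    simp only [hL.cutoff z.2 hz, hR.cutoff z.2 hz, ite_self, ENNReal.ofReal_zero]
  filter_upwards [h.ae_inter_eq_empty hm₁ hzero₁, h.ae_inter_eq_empty hm₂ hzero₂]
    with ω hω₁ hω₂ z hz
  have hcutoff : ¬(|z.2| ≤ vmin ∨ vmax ≤ |z.2|) := fun hc => hω₂.subset ⟨hz, hc⟩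
  rw [not_or, not_le, not_le] at hcutoff
  exact ⟨fun h0 => hω₁.subset ⟨hz, h0, mem_univ _⟩, hcutoff.1, hcutoff.2⟩

theorem gasIntensity_window_le (hL : IsGasDensity vmin vmax pL)
    (hR : IsGasDensity vmin vmax pR) :
    gasIntensity pL pR (window vmax Vbar t) ≤
      ENNReal.ofReal (2 * (vmax + Vbar) * t) * ENNReal.ofReal ((∫ v, pL v) + ∫ v, pR v) := by
  have hmeas : Measurable fun v => ENNReal.ofReal (pL v + pR v) :=
    (hL.measurable.add hR.measurable).ennreal_ofReal
  have hmass : ENNReal.ofReal ((∫ v, pL v) + ∫ v, pR v) = ∫⁻ v, ENNReal.ofReal (pL v + pR v) := by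
    rw [← integral_add hL.integrable hR.integrable]
    exact ofReal_integral_eq_lintegral_ofReal (hL.integrable.add hR.integrable)
      (Eventually.of_forall fun v => add_nonneg (hL.nonneg v) (hR.nonneg v))
  rw [gasIntensity, withDensity_apply _ measurableSet_window]
  calc ∫⁻ z in window vmax Vbar t, ENNReal.ofReal (if z.1 < 0 then pL z.2 else pR z.2)
      ≤ ∫⁻ z in window vmax Vbar t, ENNReal.ofReal (pL z.2 + pR z.2) := by
        refine lintegral_mono fun z => ENNReal.ofReal_le_ofReal ?_
        split_ifs
        · exact le_add_of_nonneg_right (hR.nonneg z.2)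
        · exact le_add_of_nonneg_left (hL.nonneg z.2)
    _ = volume (Icc (-((vmax + Vbar) * t)) ((vmax + Vbar) * t)) *
          ENNReal.ofReal ((∫ v, pL v) + ∫ v, pR v) := by
        rw [window, Measure.volume_eq_prod, ← Measure.prod_restrict, Measure.restrict_univ,
          lintegral_prod (fun z => ENNReal.ofReal (pL z.2 + pR z.2))
            (hmeas.comp measurable_snd).aemeasurable]
        simp only [lintegral_const, Measure.restrict_apply_univ, hmass, mul_comm]
    _ = ENNReal.ofReal (2 * (vmax + Vbar) * t) * ENNReal.ofReal ((∫ v, pL v) + ∫ v, pR v) := by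
        rw [Real.volume_Icc]
        ring_nf

theorem gasIntensity_window_ne_top (hL : IsGasDensity vmin vmax pL)
    (hR : IsGasDensity vmin vmax pR) : gasIntensity pL pR (window vmax Vbar t) ≠ ⊤ :=
  ne_top_of_le_ne_top (ENNReal.mul_ne_top ENNReal.ofReal_ne_top ENNReal.ofReal_ne_top)
    (gasIntensity_window_le hL hR)

theorem gasIntensity_real_window_le (hL : IsGasDensity vmin vmax pL)
    (hR : IsGasDensity vmin vmax pR) (hV : 0 ≤ vmax + Vbar) (ht : 0 ≤ t) :
    (gasIntensity pL pR).real (window vmax Vbar t) ≤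
      2 * (vmax + Vbar) * t * ((∫ v, pL v) + ∫ v, pR v) := by
  have hlen : 0 ≤ 2 * (vmax + Vbar) * t := by positivity
  refine ENNReal.toReal_le_of_le_ofReal (mul_nonneg hlen
    (add_nonneg (integral_nonneg hL.nonneg) (integral_nonneg hR.nonneg))) ?_
  rw [ENNReal.ofReal_mul hlen]
  exact gasIntensity_window_le hL hR

theorem setIntegral_gasIntensity (hL : IsGasDensity vmin vmax pL) (hR : IsGasDensity vmin vmax pR)
    {E : Set (ℝ × ℝ)} (hE : MeasurableSet E) {p : ℝ → ℝ}
    (hp : ∀ z ∈ E, (if z.1 < 0 then pL z.2 else pR z.2) = p z.2) (g : ℝ → ℝ) :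
    ∫ z in E, g z.2 ∂gasIntensity pL pR = ∫ z in E, g z.2 * p z.2 := by
  rw [gasIntensity, setIntegral_withDensity_eq_setIntegral_toReal_smul
    (measurable_gas hL hR).ennreal_ofReal (Eventually.of_forall fun z => ENNReal.ofReal_lt_top) _
    hE]
  refine setIntegral_congr_fun hE fun z hz => ?_
  have hnonneg : 0 ≤ if z.1 < 0 then pL z.2 else pR z.2 := by
    split_ifs
    exacts [hL.nonneg _, hR.nonneg _]
  simp only [ENNReal.toReal_ofReal hnonneg]
  rw [hp z hz, smul_eq_mul, mul_comm]

theorem setIntegral_hitL (hL : IsGasDensity vmin vmax pL) (hR : IsGasDensity vmin vmax pR)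
    (hv : vmin ≤ vmax) (ht : 0 ≤ t) (hu : |u| ≤ vmin) {g : ℝ → ℝ} (hg : Measurable g) {K : ℝ}
    (hK : ∀ v, |v| < vmax → |g v| ≤ K) :
    ∫ z in hitL vmin vmax u t, g z.2 ∂gasIntensity pL pR =
      t * ∫ v in vmin..vmax, (v - u) * g v * pL v := by
  rw [setIntegral_gasIntensity hL hR measurableSet_hitL (p := pL) fun z hz => if_pos hz.1,
    setIntegral_comp_snd measurableSet_hitL (hitL_subset_window ht le_rfl)
      (hL.integrable_mul hg hK)]
  simp_rw [volume_section_hitL ht hu]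
  rw [integral_indicator_Ioo_mul hv, ← intervalIntegral.integral_const_mul]
  simp only [mul_assoc]

theorem setIntegral_hitR (hL : IsGasDensity vmin vmax pL) (hR : IsGasDensity vmin vmax pR)
    (hv : vmin ≤ vmax) (ht : 0 ≤ t) (hu : |u| ≤ vmin) {g : ℝ → ℝ} (hg : Measurable g) {K : ℝ}
    (hK : ∀ v, |v| < vmax → |g v| ≤ K) :
    ∫ z in hitR vmin vmax u t, g z.2 ∂gasIntensity pL pR =
      t * ∫ v in (-vmax)..(-vmin), (u - v) * g v * pR v := by
  rw [setIntegral_gasIntensity hL hR measurableSet_hitR (p := pR) fun z hz => if_neg hz.1.not_gt,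
    setIntegral_comp_snd measurableSet_hitR (hitR_subset_window ht le_rfl)
      (hR.integrable_mul hg hK)]
  simp_rw [volume_section_hitR ht hu]
  rw [integral_indicator_Ioo_mul (neg_le_neg hv), ← intervalIntegral.integral_const_mul]
  simp only [mul_assoc]

/-- The rate at which a quantity changes that jumps by `gL v` or `gR v` when an atom of velocity `v`
hits, from the left or from the right, the piston of velocity `u`. -/
noncomputable def rate (vmin vmax : ℝ) (pL pR : ℝ → ℝ) (u : ℝ) (gL gR : ℝ → ℝ) : ℝ :=
  (∫ v in vmin..vmax, (v - u) * gL v * pL v) +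
    ∫ v in (-vmax)..(-vmin), (u - v) * gR v * pR v

theorem setIntegral_hitValue (hL : IsGasDensity vmin vmax pL) (hR : IsGasDensity vmin vmax pR)
    (hmin : 0 ≤ vmin) (hv : vmin ≤ vmax) (hV : Vbar ≤ vmin) (ht : 0 ≤ t) (hu : |u| ≤ Vbar)
    {gL gR : ℝ → ℝ} (hgL : Measurable gL) (hgR : Measurable gR) {K : ℝ} (hK : 0 ≤ K)
    (hKL : ∀ v, |v| < vmax → |gL v| ≤ K) (hKR : ∀ v, |v| < vmax → |gR v| ≤ K) :
    ∫ z in window vmax Vbar t, hitValue vmin vmax u t gL gR z ∂gasIntensity pL pR =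
      t * rate vmin vmax pL pR u gL gR := by
  have hfin : IsFiniteMeasure ((gasIntensity pL pR).restrict (window vmax Vbar t)) :=
    isFiniteMeasure_restrict.2 (gasIntensity_window_ne_top hL hR)
  simp only [hitValue]
  rw [integral_add (integrable_indicator_snd measurableSet_hitL
    (fun _ hz => hKL _ (abs_snd_lt_of_mem_hitL hmin hz)) hK hgL)
    (integrable_indicator_snd measurableSet_hitR
    (fun _ hz => hKR _ (abs_snd_lt_of_mem_hitR hmin hz)) hK hgR),
    setIntegral_indicator measurableSet_hitL,
    setIntegral_indicator measurableSet_hitR,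
    inter_eq_right.2 (hitL_subset_window ht hu), inter_eq_right.2 (hitR_subset_window ht hu),
    setIntegral_hitL hL hR hv ht (hu.trans hV) hgL hKL,
    setIntegral_hitR hL hR hv ht (hu.trans hV) hgR hKR, rate, mul_add]

end Intensity

/-- The setting of the paper: the process of the velocity of a piston in a Poisson gas with
admissible parameters. -/
structure IsPistonInGas {Ω : Type*} [MeasurableSpace Ω] (P : Measure Ω)
    (m M Vbar vmin vmax : ℝ) (pL pR : ℝ → ℝ) (Γ : Ω → Set (ℝ × ℝ)) (W : ℝ → Ω → ℝ → ℝ)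
    (c : ℝ → Ω → ℝ × ℝ → ℝ → ℝ) : Prop where
  admissible : Admissible m M Vbar vmin vmax
  gasL : IsGasDensity vmin vmax pL
  gasR : IsGasDensity vmin vmax pR
  poisson : IsPoissonProcess Γ (gasIntensity pL pR) P
  process : IsPistonProcess P m M Vbar Γ W c

/-- The change, during `[0, t]`, of the sum of `ψ` over the velocities of the gas on the left of the
piston. -/
noncomputable def leftGain (ψ : ℝ → ℝ) (Γ : Set (ℝ × ℝ)) (c : ℝ × ℝ → ℝ → ℝ) (t : ℝ) : ℝ :=
  ∑' z : {z : ℝ × ℝ // z ∈ Γ ∧ z.1 < 0}, (ψ (c z t) - ψ z.1.2)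

/-- The change of the function `φ` of the velocity of the piston when it collides with an atom, the
velocities before the collision being `u` and `v`. -/
noncomputable def jump (m M Vbar : ℝ) (φ : ℝ → ℝ) (u v : ℝ) : ℝ :=
  φ (reflectVel Vbar (pistonAfter m M u v)) - φ u

/-- The generator of the process of the velocity of the piston. -/
noncomputable def generator (m M Vbar vmin vmax : ℝ) (pL pR φ : ℝ → ℝ) (u : ℝ) : ℝ :=
  rate vmin vmax pL pR u (jump m M Vbar φ u) (jump m M Vbar φ u)

/-- A bound for the rate at which atoms enter the window. -/
noncomputable def windowRate (vmax Vbar : ℝ) (pL pR : ℝ → ℝ) : ℝ :=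
  2 * (vmax + Vbar) * ((∫ v, pL v) + ∫ v, pR v)

theorem measurable_atomAfter (m M : ℝ) : Measurable fun q : ℝ × ℝ => atomAfter m M q.1 q.2 := by
  unfold atomAfter
  fun_prop

theorem measurable_reflectVel (Vbar : ℝ) : Measurable (reflectVel Vbar) :=
  Measurable.ite (measurableSet_lt measurable_const measurable_id)
    (measurable_const.sub measurable_id)
    (Measurable.ite (measurableSet_lt measurable_id measurable_const)
      (measurable_const.sub measurable_id) measurable_id)

theorem measurable_jump {m M Vbar : ℝ} {φ : ℝ → ℝ} (hφ : Measurable φ) :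
    Measurable fun q : ℝ × ℝ => jump m M Vbar φ q.1 q.2 := by
  have hafter : Measurable fun q : ℝ × ℝ => pistonAfter m M q.1 q.2 := by
    unfold pistonAfter
    fun_prop
  exact (hφ.comp ((measurable_reflectVel Vbar).comp hafter)).sub (hφ.comp measurable_fst)

namespace Admissible

variable {m M Vbar vmin vmax : ℝ}

theorem vmax_pos (h : Admissible m M Vbar vmin vmax) : 0 < vmax :=
  h.vmin_pos.trans h.vmin_lt

theorem abs_atomAfter_le (h : Admissible m M Vbar vmin vmax) {V v : ℝ}
    (hV : |V| ≤ Vbar) (hv : |v| ≤ vmax) : |atomAfter m M V v| ≤ 3 * vmax := by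
  have hM := h.M_pos
  have hm := h.m_pos
  have hs : 0 < M + m := add_pos hM hm
  have hV' : |V| ≤ vmax := hV.trans (h.Vbar_lt.trans h.vmin_lt).le
  have hmM : |M - m| ≤ M + m := abs_le.2 ⟨by linarith, by linarith⟩
  have heq : atomAfter m M V v = (2 * M * V - (M - m) * v) / (M + m) := by
    rw [atomAfter]
    ring
  rw [heq, abs_div, abs_of_pos hs, div_le_iff₀ hs]
  calc |2 * M * V - (M - m) * v| ≤ |2 * M * V| + |(M - m) * v| := abs_sub _ _
    _ = 2 * M * |V| + |M - m| * |v| := by rw [abs_mul, abs_mul (M - m), abs_of_pos (by positivity)]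
    _ ≤ 2 * M * vmax + (M + m) * vmax := by gcongr
    _ ≤ 3 * vmax * (M + m) := by nlinarith [mul_pos hm h.vmax_pos]

theorem abs_jump_le (h : Admissible m M Vbar vmin vmax) {φ : ℝ → ℝ} {B : ℝ}
    (hB : ∀ w, |w| ≤ Vbar → |φ w| ≤ B) {u v : ℝ} (hu : |u| ≤ Vbar) (hv : |v| ≤ vmax) :
    |jump m M Vbar φ u v| ≤ 2 * B := by
  refine (abs_sub _ _).trans ?_
  linarith [hB _ (h.abs_reflectVel_pistonAfter_le hu hv), hB u hu]

end Admissible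

namespace IsRegularMotion

variable {m M Vbar vmin vmax u t B : ℝ} {Γ : Set (ℝ × ℝ)} {W : ℝ → ℝ} {c : ℝ × ℝ → ℝ → ℝ}
  {z : ℝ × ℝ} {φ ψ : ℝ → ℝ}

theorem abs_leftGain_le (h : IsRegularMotion m M Vbar vmin vmax Γ u W c) (ht : 0 ≤ t)
    (hB : ∀ v, |v| ≤ 3 * vmax → |ψ v| ≤ B) (hfin : (Γ ∩ window vmax Vbar t).Finite) :
    |leftGain ψ Γ c t| ≤ 2 * B * (Γ ∩ window vmax Vbar t).ncard := by
  have hvmax := h.admissible.vmax_pos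
  have hB0 : 0 ≤ B := (abs_nonneg _).trans (hB 0 (by rw [abs_zero]; positivity))
  refine abs_tsum_le_mul_ncard (F := fun z => ψ (c z t) - ψ z.2) (by positivity)
    (fun z hz hzt => by rw [h.atom_eq_of_notMem_window hz ht hzt, sub_self]) (fun z hz => ?_) hfin
  have hv : |z.2| ≤ vmax := (h.generic z hz).abs_snd_lt.le
  have hc : |c z t| ≤ 3 * vmax := by
    rcases h.atom_eq_or_exists hz ht with heq | ⟨V, hV, heq⟩
    · rw [heq]
      linarith
    · rw [heq]
      exact h.admissible.abs_atomAfter_le hV hv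
  refine (abs_sub _ _).trans ?_
  linarith [hB _ hc, hB z.2 (by linarith)]

theorem leftGain_eq_hitValue (h : IsRegularMotion m M Vbar vmin vmax Γ u W c) (ht : 0 ≤ t)
    (hz : Γ ∩ window vmax Vbar t = {z}) :
    leftGain ψ Γ c t =
      hitValue vmin vmax u t (fun v => ψ (atomAfter m M u v) - ψ v) (fun _ => 0) z := by
  classical
  rw [leftGain, tsum_eq_of_inter_eq_singleton (F := fun z => ψ (c z t) - ψ z.2)
    (fun y hy hyt => by rw [h.atom_eq_of_notMem_window hy ht hyt, sub_self]) hz]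
  rcases h.single_atom ht hz with ⟨hhit | hhit, hc, -⟩ | ⟨hhit, hc, -⟩
  · rw [if_pos hhit.1, hitValue_of_mem_hitL hhit, hc]
  · rw [if_neg hhit.1.not_gt, hitValue_of_mem_hitR hhit]
  · rw [hitValue_of_notMem hhit, hc, sub_self, ite_self]

theorem abs_pistonGain_le (h : IsRegularMotion m M Vbar vmin vmax Γ u W c) (ht : 0 ≤ t)
    (hB : ∀ w, |w| ≤ Vbar → |φ w| ≤ B) (hfin : (Γ ∩ window vmax Vbar t).Finite) :
    |φ (W t) - φ u| ≤ 2 * B * (Γ ∩ window vmax Vbar t).ncard := by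
  have hB0 : 0 ≤ B := (abs_nonneg _).trans (hB u h.abs_init_le)
  rcases (Γ ∩ window vmax Vbar t).eq_empty_or_nonempty with he | hne
  · rw [h.piston_eq_of_inter_window_eq_empty ht he, sub_self, abs_zero]
    positivity
  · have hone : (1 : ℝ) ≤ (Γ ∩ window vmax Vbar t).ncard :=
      Nat.one_le_cast.2 ((ncard_pos hfin).2 hne)
    refine (abs_sub _ _).trans ?_
    nlinarith [hB _ (h.abs_piston_le ht), hB u h.abs_init_le]

theorem pistonGain_eq_hitValue (h : IsRegularMotion m M Vbar vmin vmax Γ u W c) (ht : 0 ≤ t)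
    (hz : Γ ∩ window vmax Vbar t = {z}) :
    φ (W t) - φ u = hitValue vmin vmax u t (jump m M Vbar φ u) (jump m M Vbar φ u) z := by
  rcases h.single_atom ht hz with ⟨hhit | hhit, -, hW⟩ | ⟨hhit, -, hW⟩
  · rw [hW, hitValue_of_mem_hitL hhit, jump]
  · rw [hW, hitValue_of_mem_hitR hhit, jump]
  · rw [hW, hitValue_of_notMem hhit, sub_self]

end IsRegularMotion

namespace IsPistonInGas

variable {Ω : Type*} [MeasurableSpace Ω] {P : Measure Ω} [IsProbabilityMeasure P]
  {m M Vbar vmin vmax : ℝ} {pL pR : ℝ → ℝ} {Γ : Ω → Set (ℝ × ℝ)} {W : ℝ → Ω → ℝ → ℝ}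
  {c : ℝ → Ω → ℝ × ℝ → ℝ → ℝ} {u t B : ℝ} {φ ψ : ℝ → ℝ}

theorem ae_isRegularMotion (h : IsPistonInGas P m M Vbar vmin vmax pL pR Γ W c)
    (hu : |u| ≤ Vbar) :
    ∀ᵐ ω ∂P, IsRegularMotion m M Vbar vmin vmax (Γ ω) u (W u ω) (c u ω) := by
  filter_upwards [h.process.motion u (abs_le.1 hu), ae_isGeneric h.gasL h.gasR h.poisson]
    with ω hmotion hgeneric
  exact ⟨hmotion, h.admissible, hgeneric, hu⟩

theorem abs_integral_sub_rate_le (h : IsPistonInGas P m M Vbar vmin vmax pL pR Γ W c)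
    (ht : 0 ≤ t) (hu : |u| ≤ Vbar) {gL gR : ℝ → ℝ} (hgL : Measurable gL) (hgR : Measurable gR)
    {K : ℝ} (hK : 0 ≤ K) (hKL : ∀ v, |v| < vmax → |gL v| ≤ K) (hKR : ∀ v, |v| < vmax → |gR v| ≤ K)
    {Y : Ω → ℝ} (hY : AEStronglyMeasurable Y P)
    (hbound : ∀ᵐ ω ∂P, (Γ ω ∩ window vmax Vbar t).Finite →
      |Y ω| ≤ K * (Γ ω ∩ window vmax Vbar t).ncard)
    (hsingle : ∀ᵐ ω ∂P, ∀ z, Γ ω ∩ window vmax Vbar t = {z} →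
      Y ω = hitValue vmin vmax u t gL gR z) :
    Integrable Y P ∧ |∫ ω, Y ω ∂P - t * rate vmin vmax pL pR u gL gR| ≤
      2 * K * windowRate vmax Vbar pL pR ^ 2 * t ^ 2 := by
  have hadm := h.admissible
  have hV : 0 ≤ vmax + Vbar := by linarith [hadm.vmax_pos, hadm.Vbar_pos]
  obtain ⟨hint, hle⟩ := h.poisson.abs_integral_sub_le measurableSet_window
    (gasIntensity_window_ne_top h.gasL h.gasR)
    (measurable_hitValue (vmin := vmin) (vmax := vmax) (u := u) (t := t) hgL hgR) hK
    (abs_hitValue_le hadm.vmin_pos.le hK hKL hKR) hY hbound hsingle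
  rw [setIntegral_hitValue h.gasL h.gasR hadm.vmin_pos.le hadm.vmin_lt.le hadm.Vbar_lt.le ht hu
    hgL hgR hK hKL hKR] at hle
  refine ⟨hint, hle.trans ?_⟩
  calc 2 * K * (gasIntensity pL pR).real (window vmax Vbar t) ^ 2
      ≤ 2 * K * (2 * (vmax + Vbar) * t * ((∫ v, pL v) + ∫ v, pR v)) ^ 2 := by
        gcongr
        exact gasIntensity_real_window_le h.gasL h.gasR hV ht
    _ = 2 * K * windowRate vmax Vbar pL pR ^ 2 * t ^ 2 := by
        rw [windowRate]
        ring

theorem abs_integral_leftGain_sub_le (h : IsPistonInGas P m M Vbar vmin vmax pL pR Γ W c)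
    (ht : 0 ≤ t) (hu : |u| ≤ Vbar) (hψ : Measurable ψ) (hB : ∀ v, |v| ≤ 3 * vmax → |ψ v| ≤ B)
    (hmeas : AEStronglyMeasurable (fun ω => leftGain ψ (Γ ω) (c u ω) t) P) :
    Integrable (fun ω => leftGain ψ (Γ ω) (c u ω) t) P ∧
      |∫ ω, leftGain ψ (Γ ω) (c u ω) t ∂P -
        t * rate vmin vmax pL pR u (fun v => ψ (atomAfter m M u v) - ψ v) (fun _ => 0)| ≤
      2 * (2 * B) * windowRate vmax Vbar pL pR ^ 2 * t ^ 2 := by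
  have hvmax := h.admissible.vmax_pos
  have hB0 : 0 ≤ B := (abs_nonneg _).trans (hB 0 (by rw [abs_zero]; positivity))
  have hgain : ∀ v, |v| < vmax → |ψ (atomAfter m M u v) - ψ v| ≤ 2 * B := fun v hv =>
    (abs_sub _ _).trans (by
      linarith [hB _ (h.admissible.abs_atomAfter_le hu hv.le), hB v (by linarith)])
  have hmeasurable : Measurable fun v => ψ (atomAfter m M u v) - ψ v :=
    (hψ.comp ((measurable_atomAfter m M).comp measurable_prodMk_left)).sub hψ
  refine h.abs_integral_sub_rate_le ht hu hmeasurable measurable_const (by positivity) hgain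
    (fun v _ => ?_) hmeas ?_ ?_
  · rw [abs_zero]
    positivity
  · filter_upwards [h.ae_isRegularMotion hu] with ω hω using hω.abs_leftGain_le ht hB
  · filter_upwards [h.ae_isRegularMotion hu] with ω hω z hz using hω.leftGain_eq_hitValue ht hz

theorem abs_integral_sub_generator_le (h : IsPistonInGas P m M Vbar vmin vmax pL pR Γ W c)
    (ht : 0 ≤ t) (hu : |u| ≤ Vbar) (hφ : Measurable φ) (hB : ∀ w, |w| ≤ Vbar → |φ w| ≤ B) :
    Integrable (fun ω => φ (W u ω t) - φ u) P ∧
      |∫ ω, (φ (W u ω t) - φ u) ∂P - t * generator m M Vbar vmin vmax pL pR φ u| ≤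
      2 * (2 * B) * windowRate vmax Vbar pL pR ^ 2 * t ^ 2 := by
  have hB0 : 0 ≤ B := (abs_nonneg _).trans (hB u hu)
  have hjump : Measurable (jump m M Vbar φ u) := (measurable_jump hφ).comp measurable_prodMk_left
  refine h.abs_integral_sub_rate_le ht hu hjump hjump (by positivity)
    (fun v hv => h.admissible.abs_jump_le hB hu hv.le)
    (fun v hv => h.admissible.abs_jump_le hB hu hv.le) ?_ ?_ ?_
  · exact ((hφ.comp ((h.process.measurable_velocity t ht).comp
      measurable_prodMk_left)).sub_const _).aestronglyMeasurable
  · filter_upwards [h.ae_isRegularMotion hu] with ω hω using hω.abs_pistonGain_le ht hB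
  · filter_upwards [h.ae_isRegularMotion hu] with ω hω z hz using hω.pistonGain_eq_hitValue ht hz

end IsPistonInGas

/-! ### Stationary measures -/

theorem exists_abs_le_of_continuous {φ : ℝ → ℝ} (hφ : Continuous φ) (R : ℝ) :
    ∃ B, ∀ x, |x| ≤ R → |φ x| ≤ B := by
  obtain ⟨B, hB⟩ := isCompact_Icc.exists_bound_of_continuousOn
    (hφ.continuousOn (s := Icc (-R) R))
  exact ⟨B, fun x hx => hB x (abs_le.1 hx)⟩

theorem eq_zero_of_forall_abs_le_mul {x C : ℝ} (h : ∀ t, 0 < t → |x| ≤ C * t) : x = 0 := by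
  have hlim : Tendsto (fun t : ℝ => C * t) (𝓝[>] 0) (𝓝 (C * 0)) :=
    (continuous_const_mul C).continuousWithinAt
  rw [mul_zero] at hlim
  exact abs_nonpos_iff.1 (ge_of_tendsto hlim (eventually_mem_nhdsWithin.mono h))

namespace IsStationary

variable {Ω : Type*} [MeasurableSpace Ω] {P : Measure Ω} {Vbar : ℝ} {W : ℝ → Ω → ℝ → ℝ}
  {μ : Measure ℝ} {φ : ℝ → ℝ} {t : ℝ}

theorem ae_abs_le (hμ : IsStationary P Vbar W μ) : ∀ᵐ u ∂μ, |u| ≤ Vbar :=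
  (show ∀ᵐ u ∂μ, u ∈ Icc (-Vbar) Vbar from hμ.supp).mono fun _ => abs_le.2

theorem integrable_of_abs_le (hμ : IsStationary P Vbar W μ) (hφ : Measurable φ) {B : ℝ}
    (hB : ∀ u, |u| ≤ Vbar → |φ u| ≤ B) : Integrable φ μ :=
  have := hμ.prob
  Integrable.of_bound hφ.aestronglyMeasurable B (hμ.ae_abs_le.mono hB)

theorem integrable_of_continuous (hμ : IsStationary P Vbar W μ) (hφ : Continuous φ) :
    Integrable φ μ :=
  have ⟨_, hB⟩ := exists_abs_le_of_continuous hφ Vbar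
  hμ.integrable_of_abs_le hφ.measurable hB

variable [IsProbabilityMeasure P]

theorem map_prod (hμ : IsStationary P Vbar W μ) (ht : 0 ≤ t)
    (hW : Measurable fun q : ℝ × Ω => W q.1 q.2 t) :
    (μ.prod P).map (fun q => W q.1 q.2 t) = μ := by
  have := hμ.prob
  refine Measure.ext fun A hA => ?_
  rw [Measure.map_apply hW hA, Measure.prod_apply (hW hA), ← hμ.invariant t ht A hA]
  exact lintegral_congr fun u => (Measure.map_apply (hW.comp measurable_prodMk_left) hA).symm

theorem integral_integral_sub_eq_zero (hμ : IsStationary P Vbar W μ) (ht : 0 ≤ t)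
    (hW : Measurable fun q : ℝ × Ω => W q.1 q.2 t) (hφ : Integrable φ μ) :
    Integrable (fun u => ∫ ω, (φ (W u ω t) - φ u) ∂P) μ ∧
      ∫ u, ∫ ω, (φ (W u ω t) - φ u) ∂P ∂μ = 0 := by
  have := hμ.prob
  have hmap := hμ.map_prod ht hW
  have hφ' : Integrable φ ((μ.prod P).map fun q => W q.1 q.2 t) := by rwa [hmap]
  have hend : Integrable (fun q : ℝ × Ω => φ (W q.1 q.2 t)) (μ.prod P) := hφ'.comp_measurable hW
  have hstart : Integrable (fun q : ℝ × Ω => φ q.1) (μ.prod P) := hφ.comp_fst P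
  refine ⟨(hend.sub hstart).integral_prod_left, ?_⟩
  refine (integral_prod _ (hend.sub hstart)).symm.trans ?_
  simp only [Pi.sub_apply]
  rw [integral_sub hend hstart, ← integral_map hW.aemeasurable hφ'.aestronglyMeasurable, hmap,
    integral_fun_fst, probReal_univ, one_smul, sub_self]

end IsStationary

theorem measurable_rate {vmin vmax : ℝ} {pL pR : ℝ → ℝ} (hL : Measurable pL) (hR : Measurable pR)
    {gL gR : ℝ → ℝ → ℝ} (hgL : Measurable fun q : ℝ × ℝ => gL q.1 q.2)
    (hgR : Measurable fun q : ℝ × ℝ => gR q.1 q.2) :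
    Measurable fun u => rate vmin vmax pL pR u (gL u) (gR u) := by
  have hleft : StronglyMeasurable fun q : ℝ × ℝ => (q.2 - q.1) * gL q.1 q.2 * pL q.2 :=
    (((measurable_snd.sub measurable_fst).mul hgL).mul
      (hL.comp measurable_snd)).stronglyMeasurable
  have hright : StronglyMeasurable fun q : ℝ × ℝ => (q.1 - q.2) * gR q.1 q.2 * pR q.2 :=
    (((measurable_fst.sub measurable_snd).mul hgR).mul
      (hR.comp measurable_snd)).stronglyMeasurable
  unfold rate intervalIntegral
  exact ((hleft.integral_prod_right.sub hleft.integral_prod_right).add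
    (hright.integral_prod_right.sub hright.integral_prod_right)).measurable

namespace IsPistonInGas

variable {Ω : Type*} [MeasurableSpace Ω] {P : Measure Ω} [IsProbabilityMeasure P]
  {m M Vbar vmin vmax : ℝ} {pL pR : ℝ → ℝ} {Γ : Ω → Set (ℝ × ℝ)} {W : ℝ → Ω → ℝ → ℝ}
  {c : ℝ → Ω → ℝ × ℝ → ℝ → ℝ} {μ : Measure ℝ} {B : ℝ} {φ ψ χ : ℝ → ℝ}

theorem integral_generator_eq_zero (h : IsPistonInGas P m M Vbar vmin vmax pL pR Γ W c)
    (hμ : IsStationary P Vbar W μ) (hφ : Measurable φ) (hB : ∀ w, |w| ≤ Vbar → |φ w| ≤ B) :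
    Integrable (generator m M Vbar vmin vmax pL pR φ) μ ∧
      ∫ u, generator m M Vbar vmin vmax pL pR φ u ∂μ = 0 := by
  have := hμ.prob
  set C := 2 * (2 * B) * windowRate vmax Vbar pL pR ^ 2
  have hmean := fun t (ht : 0 ≤ t) => hμ.integral_integral_sub_eq_zero ht
    (h.process.measurable_velocity t ht) (hμ.integrable_of_abs_le hφ hB)
  have hclose : ∀ t, 0 ≤ t → ∀ᵐ u ∂μ, |∫ ω, (φ (W u ω t) - φ u) ∂P -
      t * generator m M Vbar vmin vmax pL pR φ u| ≤ C * t ^ 2 := fun t ht =>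
    hμ.ae_abs_le.mono fun u hu => (h.abs_integral_sub_generator_le ht hu hφ hB).2
  have hgen : Integrable (generator m M Vbar vmin vmax pL pR φ) μ := by
    refine ((hmean 1 zero_le_one).1.abs.add (integrable_const C)).mono'
      (measurable_rate h.gasL.measurable h.gasR.measurable (measurable_jump hφ)
        (measurable_jump hφ)).aestronglyMeasurable ?_
    filter_upwards [hclose 1 zero_le_one] with u hu
    rw [one_mul, one_pow, mul_one, abs_sub_comm] at hu
    simp only [Pi.add_apply, Real.norm_eq_abs]
    linarith [abs_sub_abs_le_abs_sub (generator m M Vbar vmin vmax pL pR φ u)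
      (∫ ω, (φ (W u ω 1) - φ u) ∂P)]
  refine ⟨hgen, eq_zero_of_forall_abs_le_mul (C := C) fun t ht => ?_⟩
  have hle := norm_integral_le_of_norm_le_const (f := fun u => (∫ ω, (φ (W u ω t) - φ u) ∂P) -
    t * generator m M Vbar vmin vmax pL pR φ u) (hclose t ht.le)
  rw [integral_sub (hmean t ht.le).1 (hgen.const_mul t), (hmean t ht.le).2, zero_sub, norm_neg,
    integral_const_mul, Real.norm_eq_abs, abs_mul, abs_of_pos ht, probReal_univ, mul_one] at hle
  exact le_of_mul_le_mul_left (by linarith) ht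

theorem integral_nonneg_of_generator_le (h : IsPistonInGas P m M Vbar vmin vmax pL pR Γ W c)
    (hμ : IsStationary P Vbar W μ) (hφ : Measurable φ) (hB : ∀ w, |w| ≤ Vbar → |φ w| ≤ B)
    (hψ : Integrable ψ μ)
    (hle : ∀ u, |u| ≤ Vbar → generator m M Vbar vmin vmax pL pR φ u ≤ ψ u) :
    0 ≤ ∫ u, ψ u ∂μ := by
  obtain ⟨hint, hzero⟩ := h.integral_generator_eq_zero hμ hφ hB
  exact hzero.symm.trans_le (integral_mono_ae hint hψ (hμ.ae_abs_le.mono hle))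

theorem abs_integral_le_of_abs_generator_sub_le
    (h : IsPistonInGas P m M Vbar vmin vmax pL pR Γ W c) (hμ : IsStationary P Vbar W μ)
    (hφ : Measurable φ) (hB : ∀ w, |w| ≤ Vbar → |φ w| ≤ B) (hψ : Integrable ψ μ)
    (hχ : Integrable χ μ)
    (hle : ∀ u, |u| ≤ Vbar → |generator m M Vbar vmin vmax pL pR φ u - ψ u| ≤ χ u) :
    |∫ u, ψ u ∂μ| ≤ ∫ u, χ u ∂μ := by
  obtain ⟨hint, hzero⟩ := h.integral_generator_eq_zero hμ hφ hB
  have hbound := norm_integral_le_of_norm_le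
    (f := fun u => generator m M Vbar vmin vmax pL pR φ u - ψ u) hχ (hμ.ae_abs_le.mono hle)
  rwa [integral_sub hint hψ, hzero, zero_sub, norm_neg, Real.norm_eq_abs] at hbound

end IsPistonInGas

/-! ### The flux of collisions -/

/-- The density of the velocities of the atoms that collide, per unit time, with a piston of
velocity `u`. -/
noncomputable def flux (pL pR : ℝ → ℝ) (u v : ℝ) : ℝ :=
  max (v - u) 0 * pL v + max (u - v) 0 * pR v

/-- The moment of order `j` of the velocity relative to the piston, for the flux of collisions. -/
noncomputable def fluxMoment (pL pR : ℝ → ℝ) (j : ℕ) (u : ℝ) : ℝ :=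
  ∫ v, (v - u) ^ j * flux pL pR u v

/-- The difference `Q_k = F_k^- - F_k^+` of the moments of the two gases. -/
noncomputable def momentDiff (vmin vmax : ℝ) (pL pR : ℝ → ℝ) (k : ℕ) : ℝ :=
  momentL vmin vmax pL k - momentR vmin vmax pR k

/-- A common bound for the first five moments of the flux of collisions. -/
noncomputable def fluxBound (vmax Vbar : ℝ) (pL pR : ℝ → ℝ) : ℝ :=
  (vmax + Vbar + 1) ^ 5 * ((∫ v, pL v) + ∫ v, pR v)

theorem integral_sub_pow_mul {p : ℝ → ℝ} {a b : ℝ} (hp : IntervalIntegrable p volume a b) (u : ℝ)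
    (j : ℕ) :
    ∫ v in a..b, (v - u) ^ j * p v =
      ∑ i ∈ Finset.range (j + 1), (-u) ^ (j - i) * j.choose i * ∫ v in a..b, v ^ i * p v := by
  simp_rw [sub_eq_add_neg _ u, add_pow, Finset.sum_mul, ← intervalIntegral.integral_const_mul]
  rw [intervalIntegral.integral_finsetSum fun i _ => hp.continuousOn_mul (by fun_prop)]
  refine Finset.sum_congr rfl fun i _ => intervalIntegral.integral_congr fun v _ => ?_
  ring

namespace IsGasDensity

variable {vmin vmax u K : ℝ} {p g : ℝ → ℝ}

theorem comp_neg (hp : IsGasDensity vmin vmax p) : IsGasDensity vmin vmax fun v => p (-v) where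
  measurable := hp.measurable.comp measurable_neg
  nonneg v := hp.nonneg (-v)
  integrable := hp.integrable.comp_neg
  cutoff v hv := hp.cutoff (-v) (by rwa [abs_neg])

theorem zero : IsGasDensity vmin vmax fun _ => 0 where
  measurable := measurable_const
  nonneg _ := le_rfl
  integrable := integrable_zero _ _ _
  cutoff _ _ := rfl

theorem max_sub_mul (hp : IsGasDensity vmin vmax p) (hu : |u| ≤ vmin) (v : ℝ) :
    max (v - u) 0 * p v = (Ioo vmin vmax).indicator (fun v => v - u) v * p v := by
  by_cases hcut : |v| ≤ vmin ∨ vmax ≤ |v|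
  · rw [hp.cutoff v hcut, mul_zero, mul_zero]
  obtain ⟨hlo, hhi⟩ := not_or.1 hcut
  rw [abs_le] at hu
  rw [not_le, abs_lt] at hhi
  rcases lt_abs.1 (not_le.1 hlo) with hpos | hneg
  · rw [indicator_of_mem (show v ∈ Ioo vmin vmax from ⟨hpos, hhi.2⟩), max_eq_left (by linarith)]
  · rw [indicator_of_notMem fun h => by linarith [h.1], max_eq_right (by linarith)]

theorem max_sub_mul' (hp : IsGasDensity vmin vmax p) (hu : |u| ≤ vmin) (v : ℝ) :
    max (u - v) 0 * p v = (Ioo (-vmax) (-vmin)).indicator (fun v => u - v) v * p v := by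
  have h := hp.comp_neg.max_sub_mul (u := -u) (by rwa [abs_neg]) (-v)
  rw [neg_neg, neg_sub_neg] at h
  rw [h]
  congr 1
  simp only [indicator_apply, mem_Ioo, neg_sub_neg, lt_neg, neg_lt, and_comm]

theorem abs_integral_mul_le (hp : IsGasDensity vmin vmax p) (hK : ∀ v, |v| < vmax → |g v| ≤ K) :
    |∫ v, g v * p v| ≤ K * ∫ v, p v := by
  rw [← integral_const_mul]
  refine norm_integral_le_of_norm_le (f := fun v => g v * p v) (hp.integrable.const_mul K)
    (Eventually.of_forall fun v => ?_)
  rw [Real.norm_eq_abs, abs_mul, abs_of_nonneg (hp.nonneg v)]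
  rcases lt_or_ge |v| vmax with hv | hv
  · exact mul_le_mul_of_nonneg_right (hK v hv) (hp.nonneg v)
  · rw [hp.cutoff v (Or.inr hv), mul_zero, mul_zero]

theorem integral_mul_nonpos (hp : IsGasDensity vmin vmax p) (hg : ∀ v, |v| < vmax → g v ≤ 0) :
    ∫ v, g v * p v ≤ 0 := by
  refine integral_nonpos fun v => ?_
  rcases lt_or_ge |v| vmax with hv | hv
  · exact mul_nonpos_of_nonpos_of_nonneg (hg v hv) (hp.nonneg v)
  · simp only [hp.cutoff v (Or.inr hv), mul_zero, Pi.zero_apply, le_refl]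

end IsGasDensity

section Flux

variable {vmin vmax Vbar u : ℝ} {pL pR : ℝ → ℝ}

theorem abs_sub_le_of_abs_lt {v : ℝ} (hu : |u| ≤ Vbar) (hv : |v| < vmax) :
    |v - u| ≤ vmax + Vbar :=
  (abs_sub _ _).trans (add_le_add hv.le hu)

theorem abs_max_zero_le (x : ℝ) : |max x 0| ≤ |x| := by
  rw [abs_of_nonneg (le_max_right _ _)]
  exact max_le (le_abs_self x) (abs_nonneg x)

theorem abs_max_sub_le {v : ℝ} (hu : |u| ≤ Vbar) (hv : |v| < vmax) :
    |max (v - u) 0| ≤ vmax + Vbar :=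
  (abs_max_zero_le _).trans (abs_sub_le_of_abs_lt hu hv)

theorem abs_max_sub_le' {v : ℝ} (hu : |u| ≤ Vbar) (hv : |v| < vmax) :
    |max (u - v) 0| ≤ vmax + Vbar :=
  (abs_max_zero_le _).trans (abs_sub_comm u v ▸ abs_sub_le_of_abs_lt hu hv)

theorem isGasDensity_flux (hL : IsGasDensity vmin vmax pL) (hR : IsGasDensity vmin vmax pR)
    (u : ℝ) : IsGasDensity vmin vmax (flux pL pR u) where
  measurable := ((by fun_prop : Measurable fun v => max (v - u) 0).mul hL.measurable).add
    ((by fun_prop : Measurable fun v => max (u - v) 0).mul hR.measurable)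
  nonneg v := add_nonneg (mul_nonneg (le_max_right _ _) (hL.nonneg v))
    (mul_nonneg (le_max_right _ _) (hR.nonneg v))
  integrable := (hL.integrable_mul (by fun_prop) fun _ hv => abs_max_sub_le le_rfl hv).add
    (hR.integrable_mul (by fun_prop) fun _ hv => abs_max_sub_le' le_rfl hv)
  cutoff v hv := by simp only [flux, hL.cutoff v hv, hR.cutoff v hv, mul_zero, add_zero]

theorem rate_eq_integral_flux
    (hL : IsGasDensity vmin vmax pL) (hR : IsGasDensity vmin vmax pR)
    (hv : vmin ≤ vmax) (hu : |u| ≤ vmin) {g : ℝ → ℝ}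
    (hg : Measurable g) {K : ℝ} (hK : ∀ v, |v| < vmax → |g v| ≤ K) :
    rate vmin vmax pL pR u g g = ∫ v, g v * flux pL pR u v := by
  have hleft := (isGasDensity_flux hL IsGasDensity.zero u).integrable_mul hg hK
  have hright := (isGasDensity_flux IsGasDensity.zero hR u).integrable_mul hg hK
  have hsplit : ∀ v, g v * flux pL pR u v =
      g v * flux pL (fun _ => 0) u v + g v * flux (fun _ => 0) pR u v := fun v => by
    simp only [flux]
    ring
  simp_rw [hsplit]
  rw [integral_add hleft hright]
  simp only [flux, mul_zero, add_zero, zero_add, hL.max_sub_mul hu, hR.max_sub_mul' hu, rate,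
    mul_left_comm (g _)]
  rw [integral_indicator_Ioo_mul hv, integral_indicator_Ioo_mul (neg_le_neg hv)]
  simp only [mul_assoc]

theorem fluxMoment_eq_sum_momentDiff
    (hL : IsGasDensity vmin vmax pL) (hR : IsGasDensity vmin vmax pR)
    (hv : vmin ≤ vmax) (hu : |u| ≤ vmin) (j : ℕ) :
    fluxMoment pL pR j u = ∑ i ∈ Finset.range (j + 2),
      (-u) ^ (j + 1 - i) * (j + 1).choose i * momentDiff vmin vmax pL pR i := by
  have hbound : ∀ v, |v| < vmax → |(v - u) ^ j| ≤ (vmax + |u|) ^ j := fun v hv' => by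
    rw [abs_pow]
    exact pow_le_pow_left₀ (abs_nonneg _) (abs_sub_le_of_abs_lt le_rfl hv') j
  have hneg : ∀ v, (u - v) * (v - u) ^ j * pR v = -((v - u) ^ (j + 1) * pR v) := fun v => by ring
  rw [fluxMoment, ← rate_eq_integral_flux hL hR hv hu (by fun_prop) hbound, rate]
  simp_rw [hneg, ← pow_succ']
  rw [intervalIntegral.integral_neg, ← sub_eq_add_neg,
    integral_sub_pow_mul hL.integrable.intervalIntegrable,
    integral_sub_pow_mul hR.integrable.intervalIntegrable, ← Finset.sum_sub_distrib]
  exact Finset.sum_congr rfl fun i _ => (mul_sub _ _ _).symm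

theorem fluxMoment_one
    (hL : IsGasDensity vmin vmax pL) (hR : IsGasDensity vmin vmax pR)
    (hv : vmin ≤ vmax) (hu : |u| ≤ vmin) :
    fluxMoment pL pR 1 u = momentDiff vmin vmax pL pR 2 - 2 * u * momentDiff vmin vmax pL pR 1 +
      u ^ 2 * momentDiff vmin vmax pL pR 0 := by
  rw [fluxMoment_eq_sum_momentDiff hL hR hv hu]
  simp only [Finset.sum_range_succ, Finset.sum_range_zero, Nat.choose]
  push_cast
  ring

theorem fluxMoment_two
    (hL : IsGasDensity vmin vmax pL) (hR : IsGasDensity vmin vmax pR)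
    (hv : vmin ≤ vmax) (hu : |u| ≤ vmin) :
    fluxMoment pL pR 2 u = momentDiff vmin vmax pL pR 3 - 3 * u * momentDiff vmin vmax pL pR 2 +
      3 * u ^ 2 * momentDiff vmin vmax pL pR 1 - u ^ 3 * momentDiff vmin vmax pL pR 0 := by
  rw [fluxMoment_eq_sum_momentDiff hL hR hv hu]
  simp only [Finset.sum_range_succ, Finset.sum_range_zero, Nat.choose]
  push_cast
  ring

theorem integral_flux_le
    (hL : IsGasDensity vmin vmax pL) (hR : IsGasDensity vmin vmax pR)
    (hu : |u| ≤ Vbar) :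
    ∫ v, flux pL pR u v ≤ (vmax + Vbar) * ((∫ v, pL v) + ∫ v, pR v) := by
  simp only [flux]
  rw [integral_add (hL.integrable_mul (by fun_prop) fun _ hv => abs_max_sub_le hu hv)
    (hR.integrable_mul (by fun_prop) fun _ hv => abs_max_sub_le' hu hv), mul_add]
  exact add_le_add
    ((le_abs_self _).trans (hL.abs_integral_mul_le fun _ hv => abs_max_sub_le hu hv))
    ((le_abs_self _).trans (hR.abs_integral_mul_le fun _ hv => abs_max_sub_le' hu hv))

theorem abs_fluxMoment_le_fluxBound
    (hL : IsGasDensity vmin vmax pL) (hR : IsGasDensity vmin vmax pR)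
    (hvmax : 0 ≤ vmax) (hu : |u| ≤ Vbar) {j : ℕ} (hj : j ≤ 4) :
    |fluxMoment pL pR j u| ≤ fluxBound vmax Vbar pL pR := by
  have hV : 0 ≤ Vbar := (abs_nonneg u).trans hu
  have hmass : 0 ≤ (∫ v, pL v) + ∫ v, pR v :=
    add_nonneg (integral_nonneg hL.nonneg) (integral_nonneg hR.nonneg)
  calc |fluxMoment pL pR j u| ≤ (vmax + Vbar) ^ j * ∫ v, flux pL pR u v :=
        (isGasDensity_flux hL hR u).abs_integral_mul_le fun v hv => by
          rw [abs_pow]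
          exact pow_le_pow_left₀ (abs_nonneg _) (abs_sub_le_of_abs_lt hu hv) j
    _ ≤ (vmax + Vbar) ^ j * ((vmax + Vbar) * ((∫ v, pL v) + ∫ v, pR v)) := by
        gcongr
        exact integral_flux_le hL hR hu
    _ = (vmax + Vbar) ^ (j + 1) * ((∫ v, pL v) + ∫ v, pR v) := by ring
    _ ≤ (vmax + Vbar + 1) ^ (j + 1) * ((∫ v, pL v) + ∫ v, pR v) := by
        gcongr ?_ ^ (j + 1) * _
        exact le_add_of_nonneg_right zero_le_one
    _ ≤ fluxBound vmax Vbar pL pR := by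
        unfold fluxBound
        gcongr
        · linarith
        · lia

theorem integral_flux_le_fluxBound
    (hL : IsGasDensity vmin vmax pL) (hR : IsGasDensity vmin vmax pR)
    (hvmax : 0 ≤ vmax) (hu : |u| ≤ Vbar) :
    ∫ v, flux pL pR u v ≤ fluxBound vmax Vbar pL pR := by
  simpa only [fluxMoment, pow_zero, one_mul] using
    (le_abs_self _).trans (abs_fluxMoment_le_fluxBound hL hR hvmax hu (Nat.zero_le 4))

end Flux

/-- The generator of the velocity process of a piston that is not reflected at `±Vbar`. -/
noncomputable def freeGenerator (m M : ℝ) (pL pR φ : ℝ → ℝ) (u : ℝ) : ℝ :=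
  ∫ v, (φ (pistonAfter m M u v) - φ u) * flux pL pR u v

/-- The constant in the bound for the effect of one reflection on the velocity `u` of the piston
after a collision. The bound is quartic in `u` because only a fast piston is reflected. -/
noncomputable def reflectBound (vmax Vbar : ℝ) : ℝ :=
  32 / Vbar ^ 4 * (vmax + Vbar)

theorem abs_reflectVel_le_abs {Vbar : ℝ} (hV : 0 ≤ Vbar) (w : ℝ) : |reflectVel Vbar w| ≤ |w| := by
  unfold reflectVel
  split_ifs with habove hbelow
  · rw [abs_of_pos (hV.trans_lt habove)]
    exact abs_le.2 ⟨by linarith, by linarith⟩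
  · rw [abs_of_neg (show w < 0 by linarith)]
    exact abs_le.2 ⟨by linarith, by linarith⟩
  · exact le_rfl

theorem abs_reflectVel_sub_le {Vbar u w d : ℝ} (hV : 0 < Vbar) (hu : |u| ≤ Vbar)
    (hw : |w - u| ≤ d) (hd : d ≤ Vbar / 2) :
    |reflectVel Vbar w - w| ≤ 32 / Vbar ^ 4 * d * u ^ 4 := by
  have hd0 : 0 ≤ d := (abs_nonneg _).trans hw
  have two_mul_le_of_fast : Vbar / 2 ≤ |u| → 2 * d ≤ 32 / Vbar ^ 4 * d * u ^ 4 := fun hfast => by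
    have hpow := pow_le_pow_left₀ (by positivity) hfast 4
    rw [Even.pow_abs (by decide : Even 4)] at hpow
    calc 2 * d = 32 / Vbar ^ 4 * d * (Vbar / 2) ^ 4 := by field_simp; ring
      _ ≤ 32 / Vbar ^ 4 * d * u ^ 4 := by gcongr
  rw [abs_le] at hu hw
  unfold reflectVel
  split_ifs with habove hbelow
  · exact (abs_le.2 ⟨by linarith, by linarith⟩).trans
      (two_mul_le_of_fast (le_abs.2 (Or.inl (by linarith))))
  · exact (abs_le.2 ⟨by linarith, by linarith⟩).trans
      (two_mul_le_of_fast (le_abs.2 (Or.inr (by linarith))))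
  · rw [sub_self, abs_zero]
    positivity

namespace Admissible

variable {m M Vbar vmin vmax u : ℝ} {pL pR φ : ℝ → ℝ} {k : ℕ}

theorem recoil_le_one (h : Admissible m M Vbar vmin vmax) : recoil m M ≤ 1 :=
  (div_le_one (add_pos h.M_pos h.m_pos)).2 (by linarith [h.m_lt_M])

theorem abs_pistonAfter_le (h : Admissible m M Vbar vmin vmax) {V v : ℝ} (hV : |V| ≤ Vbar)
    (hv : |v| ≤ vmax) : |pistonAfter m M V v| ≤ 3 / 2 * Vbar := by
  have hjump := (h.abs_pistonAfter_sub_le hV hv).trans h.small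
  linarith [abs_sub_abs_le_abs_sub (pistonAfter m M V v) V]

theorem abs_reflectVel_pistonAfter_sub_le (h : Admissible m M Vbar vmin vmax) {V v : ℝ}
    (hV : |V| ≤ Vbar) (hv : |v| ≤ vmax) :
    |reflectVel Vbar (pistonAfter m M V v) - pistonAfter m M V v| ≤
      reflectBound vmax Vbar * recoil m M * V ^ 4 := by
  refine (abs_reflectVel_sub_le h.Vbar_pos hV (h.abs_pistonAfter_sub_le hV hv) h.small).trans_eq ?_
  rw [reflectBound]
  ring

theorem generator_sub_freeGenerator (h : Admissible m M Vbar vmin vmax)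
    (hL : IsGasDensity vmin vmax pL) (hR : IsGasDensity vmin vmax pR) (hφ : Continuous φ)
    (hu : |u| ≤ Vbar) :
    generator m M Vbar vmin vmax pL pR φ u - freeGenerator m M pL pR φ u =
      ∫ v, (φ (reflectVel Vbar (pistonAfter m M u v)) - φ (pistonAfter m M u v)) *
        flux pL pR u v := by
  obtain ⟨B, hB⟩ := exists_abs_le_of_continuous hφ Vbar
  obtain ⟨B', hB'⟩ := exists_abs_le_of_continuous hφ (3 / 2 * Vbar)
  have hflux := isGasDensity_flux hL hR u
  have hjump : Measurable (jump m M Vbar φ u) :=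
    (measurable_jump hφ.measurable).comp measurable_prodMk_left
  have hjump_le := fun v (hv : |v| < vmax) => h.abs_jump_le hB hu hv.le
  have hfree : Integrable fun v => (φ (pistonAfter m M u v) - φ u) * flux pL pR u v := by
    refine hflux.integrable_mul ?_ (K := B' + |φ u|) fun v hv => ?_
    · unfold pistonAfter
      fun_prop
    · exact (abs_sub _ _).trans (add_le_add_left (hB' _ (h.abs_pistonAfter_le hu hv.le)) _)
  rw [generator, rate_eq_integral_flux hL hR h.vmin_lt.le (h.abs_lt_vmin hu).le hjump hjump_le,
    freeGenerator, ← integral_sub (hflux.integrable_mul hjump hjump_le) hfree]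
  simp only [jump, ← sub_mul, sub_sub_sub_cancel_right]

theorem generator_pow_le_of_even (h : Admissible m M Vbar vmin vmax)
    (hL : IsGasDensity vmin vmax pL) (hR : IsGasDensity vmin vmax pR) (hk : Even k)
    (hu : |u| ≤ Vbar) :
    generator m M Vbar vmin vmax pL pR (· ^ k) u ≤ freeGenerator m M pL pR (· ^ k) u := by
  rw [← sub_nonpos, h.generator_sub_freeGenerator hL hR (continuous_pow k) hu]
  refine (isGasDensity_flux hL hR u).integral_mul_nonpos fun v _ => sub_nonpos.2 ?_
  simpa only [hk.pow_abs] using pow_le_pow_left₀ (abs_nonneg _)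
    (abs_reflectVel_le_abs h.Vbar_pos.le (pistonAfter m M u v)) k

theorem abs_generator_pow_sub_le (h : Admissible m M Vbar vmin vmax)
    (hL : IsGasDensity vmin vmax pL) (hR : IsGasDensity vmin vmax pR) (k : ℕ) (hu : |u| ≤ Vbar) :
    |generator m M Vbar vmin vmax pL pR (· ^ k) u - freeGenerator m M pL pR (· ^ k) u| ≤
      reflectBound vmax Vbar * recoil m M * u ^ 4 * k * (3 / 2 * Vbar) ^ (k - 1) *
        fluxBound vmax Vbar pL pR := by
  have ha := h.recoil_pos.le
  have hV := h.Vbar_pos.le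
  have hvmax := h.vmax_pos.le
  have hκ : 0 ≤ reflectBound vmax Vbar := by
    unfold reflectBound
    positivity
  rw [h.generator_sub_freeGenerator hL hR (continuous_pow k) hu]
  calc |∫ v, (reflectVel Vbar (pistonAfter m M u v) ^ k - pistonAfter m M u v ^ k) *
        flux pL pR u v| ≤
      reflectBound vmax Vbar * recoil m M * u ^ 4 * k * (3 / 2 * Vbar) ^ (k - 1) *
        ∫ v, flux pL pR u v := by
        refine (isGasDensity_flux hL hR u).abs_integral_mul_le fun v hv => ?_
        have hw := h.abs_pistonAfter_le hu hv.le
        refine (abs_pow_sub_pow_le _ _ _).trans ?_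
        gcongr
        · exact h.abs_reflectVel_pistonAfter_sub_le hu hv.le
        · exact max_le ((abs_reflectVel_le_abs hV _).trans hw) hw
    _ ≤ _ := by
        gcongr
        exact integral_flux_le_fluxBound hL hR hvmax hu

end Admissible

theorem add_mul_pow_sub_pow (u a y : ℝ) (k : ℕ) :
    (u + a * y) ^ k - u ^ k =
      ∑ i ∈ Finset.range k, k.choose (i + 1) * u ^ (k - (i + 1)) * a ^ (i + 1) * y ^ (i + 1) := by
  rw [add_comm u, add_pow, Finset.sum_range_succ']
  simp only [pow_zero, one_mul, Nat.sub_zero, Nat.choose_zero_right, Nat.cast_one, mul_one,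
    add_sub_cancel_right]
  exact Finset.sum_congr rfl fun i _ => by ring

section FreeGenerator

variable {m M vmin vmax : ℝ} {pL pR : ℝ → ℝ}

theorem freeGenerator_pow (hM : M + m ≠ 0)
    (hL : IsGasDensity vmin vmax pL) (hR : IsGasDensity vmin vmax pR) (k : ℕ) (u : ℝ) :
    freeGenerator m M pL pR (· ^ k) u = ∑ i ∈ Finset.range k,
      k.choose (i + 1) * u ^ (k - (i + 1)) * recoil m M ^ (i + 1) * fluxMoment pL pR (i + 1) u := by
  simp only [freeGenerator, pistonAfter_eq hM, add_mul_pow_sub_pow, Finset.sum_mul, fluxMoment,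
    ← integral_const_mul]
  rw [integral_finsetSum _ fun i _ => ?_]
  · simp only [mul_assoc]
  · simp only [mul_assoc _ _ (flux pL pR u _)]
    exact ((isGasDensity_flux hL hR u).integrable_mul (by fun_prop) fun v hv => by
      rw [abs_pow]
      exact pow_le_pow_left₀ (abs_nonneg _) (abs_sub_le_of_abs_lt le_rfl hv) _).const_mul _


theorem freeGenerator_pow_one (hM : M + m ≠ 0)
    (hL : IsGasDensity vmin vmax pL) (hR : IsGasDensity vmin vmax pR) (u : ℝ) :
    freeGenerator m M pL pR (· ^ 1) u = recoil m M * fluxMoment pL pR 1 u := by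
  rw [freeGenerator_pow hM hL hR]
  simp only [Finset.sum_range_succ, Finset.sum_range_zero, Nat.choose]
  push_cast
  ring

theorem freeGenerator_pow_two (hM : M + m ≠ 0)
    (hL : IsGasDensity vmin vmax pL) (hR : IsGasDensity vmin vmax pR) (u : ℝ) :
    freeGenerator m M pL pR (· ^ 2) u =
      2 * u * recoil m M * fluxMoment pL pR 1 u + recoil m M ^ 2 * fluxMoment pL pR 2 u := by
  rw [freeGenerator_pow hM hL hR]
  simp only [Finset.sum_range_succ, Finset.sum_range_zero, Nat.choose]
  push_cast
  ring

theorem freeGenerator_pow_three (hM : M + m ≠ 0)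
    (hL : IsGasDensity vmin vmax pL) (hR : IsGasDensity vmin vmax pR) (u : ℝ) :
    freeGenerator m M pL pR (· ^ 3) u =
      3 * u ^ 2 * recoil m M * fluxMoment pL pR 1 u +
        3 * u * recoil m M ^ 2 * fluxMoment pL pR 2 u + recoil m M ^ 3 * fluxMoment pL pR 3 u := by
  rw [freeGenerator_pow hM hL hR]
  simp only [Finset.sum_range_succ, Finset.sum_range_zero, Nat.choose]
  push_cast
  ring

theorem freeGenerator_pow_four (hM : M + m ≠ 0)
    (hL : IsGasDensity vmin vmax pL) (hR : IsGasDensity vmin vmax pR) (u : ℝ) :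
    freeGenerator m M pL pR (· ^ 4) u =
      4 * u ^ 3 * recoil m M * fluxMoment pL pR 1 u +
        6 * u ^ 2 * recoil m M ^ 2 * fluxMoment pL pR 2 u +
        4 * u * recoil m M ^ 3 * fluxMoment pL pR 3 u + recoil m M ^ 4 * fluxMoment pL pR 4 u := by
  rw [freeGenerator_pow hM hL hR]
  simp only [Finset.sum_range_succ, Finset.sum_range_zero, Nat.choose]
  push_cast
  ring

end FreeGenerator

/-! ### Moments of a stationary measure -/

section Moments

variable {vmin vmax Vbar u : ℝ} {p pL pR : ℝ → ℝ}

theorem momentR_eq (vmin vmax : ℝ) (p : ℝ → ℝ) (k : ℕ) :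
    momentR vmin vmax p k = (-1) ^ k * momentL vmin vmax (fun v => p (-v)) k := by
  rw [momentR, momentL, ← intervalIntegral.integral_comp_neg fun v => v ^ k * p v,
    ← intervalIntegral.integral_const_mul]
  refine intervalIntegral.integral_congr fun v _ => ?_
  simp only [neg_pow v k, mul_assoc]

theorem momentL_zero_nonneg (hp : IsGasDensity vmin vmax p) (hv : vmin ≤ vmax) :
    0 ≤ momentL vmin vmax p 0 :=
  intervalIntegral.integral_nonneg hv fun v _ => by
    simpa only [pow_zero, one_mul] using hp.nonneg v

theorem vmin_mul_momentL_zero_le (hp : IsGasDensity vmin vmax p) (hv : vmin ≤ vmax) :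
    vmin * momentL vmin vmax p 0 ≤ momentL vmin vmax p 1 := by
  have hint : ∀ k, IntervalIntegrable (fun v => v ^ k * p v) volume vmin vmax := fun k =>
    hp.integrable.intervalIntegrable.continuousOn_mul (by fun_prop)
  rw [momentL, momentL, ← intervalIntegral.integral_const_mul]
  refine intervalIntegral.integral_mono_on hv ((hint 0).const_mul vmin) (hint 1) fun v hv => ?_
  simpa only [pow_zero, one_mul, pow_one] using mul_le_mul_of_nonneg_right hv.1 (hp.nonneg v)

theorem vmin_mul_abs_momentDiff_zero_le (hL : IsGasDensity vmin vmax pL)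
    (hR : IsGasDensity vmin vmax pR) (hmin : 0 ≤ vmin) (hv : vmin ≤ vmax) :
    vmin * |momentDiff vmin vmax pL pR 0| ≤ momentDiff vmin vmax pL pR 1 := by
  have hL₀ := mul_nonneg hmin (momentL_zero_nonneg hL hv)
  have hR₀ := mul_nonneg hmin (momentL_zero_nonneg hR.comp_neg hv)
  have hL₁ := vmin_mul_momentL_zero_le hL hv
  have hR₁ := vmin_mul_momentL_zero_le hR.comp_neg hv
  rw [← abs_of_nonneg hmin, ← abs_mul, abs_of_nonneg hmin, momentDiff, momentDiff, momentR_eq,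
    momentR_eq, mul_sub]
  exact abs_le.2 ⟨by linarith, by linarith⟩

theorem mul_momentDiff_zero_le (hL : IsGasDensity vmin vmax pL) (hR : IsGasDensity vmin vmax pR)
    (hv : vmin ≤ vmax) (hV : 3 * Vbar ≤ vmin) (hu : |u| ≤ Vbar) :
    u * momentDiff vmin vmax pL pR 0 ≤ momentDiff vmin vmax pL pR 1 / 3 := by
  have hu' : |u| ≤ vmin / 3 := by linarith
  have hmin : 0 ≤ vmin := by linarith [abs_nonneg u]
  calc u * momentDiff vmin vmax pL pR 0 ≤ |u| * |momentDiff vmin vmax pL pR 0| :=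
        (le_abs_self _).trans_eq (abs_mul _ _)
    _ ≤ vmin / 3 * |momentDiff vmin vmax pL pR 0| := by gcongr
    _ ≤ momentDiff vmin vmax pL pR 1 / 3 := by
        linarith [vmin_mul_abs_momentDiff_zero_le hL hR hmin hv]

theorem momentL_zero_pos {f : ℝ → ℝ} {n : ℝ} (hmin : 0 ≤ vmin) (hv : vmin ≤ vmax)
    (hf : IsVelocityDensity vmin vmax f) (hn : 0 < n) (hp : ∀ v, p v = n * f v) :
    0 < momentL vmin vmax p 0 := by
  have heven : ∀ v, f |v| = f v := fun v => by
    rcases abs_choice v with habs | habs <;> simp only [habs, hf.even]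
  have hmass : 2 * ∫ v in Ioi (0 : ℝ), f v = 1 := by
    rw [← integral_comp_abs, ← hf.integral_eq_one]
    simp only [heven]
  have hsupport : ∫ v in Ioi (0 : ℝ), f v = ∫ v in Ioc vmin vmax, f v := by
    refine setIntegral_eq_of_subset_of_forall_sdiff_eq_zero measurableSet_Ioi
      (fun v hv' => hmin.trans_lt hv'.1) fun v hv' => hf.cutoff v ?_
    rw [abs_of_pos hv'.1, or_iff_not_imp_left, not_le]
    exact fun hlt => (not_le.1 fun hle => hv'.2 ⟨hlt, hle⟩).le
  simp only [momentL, pow_zero, one_mul, hp]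
  rw [intervalIntegral.integral_const_mul, intervalIntegral.integral_of_le hv, ← hsupport]
  exact mul_pos hn (by linarith)

theorem momentDiff_one_pos (hL : IsGasDensity vmin vmax pL) (hR : IsGasDensity vmin vmax pR)
    (hmin : 0 < vmin) (hv : vmin ≤ vmax) (h : 0 < momentL vmin vmax pL 0) :
    0 < momentDiff vmin vmax pL pR 1 := by
  have hleft := (mul_pos hmin h).trans_le (vmin_mul_momentL_zero_le hL hv)
  have hright := (mul_nonneg hmin.le (momentL_zero_nonneg hR.comp_neg hv)).trans
    (vmin_mul_momentL_zero_le hR.comp_neg hv)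
  rw [momentDiff, momentR_eq]
  linarith

end Moments

/-- Relations between the first four moments `b k` of a stationary measure of the velocity of the
piston, for balanced gases with moment differences `Q k`. Here `a` is the recoil factor, `V` the
cutoff, `B` a bound for the moments of the flux and `κ` the constant in the bound for the effect of
a reflection. -/
structure MomentRelations (a V B κ : ℝ) (Q b : ℕ → ℝ) : Prop where
  two_nonneg : 0 ≤ b 2
  four_nonneg : 0 ≤ b 4
  abs_three_le : |b 3| ≤ V * b 2
  two_le : 10 / 3 * Q 1 * b 2 ≤ a * B
  four_le : 20 / 3 * Q 1 * b 4 ≤ 6 * a * B * b 2 + a ^ 2 * (B * (4 * V + 1))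
  first : |-2 * Q 1 * b 1 + Q 0 * b 2| ≤ κ * B * b 4
  second : |-4 * Q 1 * b 2 + 2 * Q 0 * b 3 + a * (Q 3 + 3 * Q 1 * b 2 - Q 0 * b 3)| ≤
    3 * V * κ * B * b 4
  third : |-6 * Q 1 * b 3 + 3 * Q 0 * b 4 + a * (3 * Q 3 * b 1 + 9 * Q 1 * b 3 - 3 * Q 0 * b 4)| ≤
    a ^ 2 * B + 27 / 4 * V ^ 2 * κ * B * b 4

section Stationary

variable {Ω : Type*} [MeasurableSpace Ω] {P : Measure Ω}
  {m M Vbar vmin vmax : ℝ} {pL pR : ℝ → ℝ} {Γ : Ω → Set (ℝ × ℝ)} {W : ℝ → Ω → ℝ → ℝ}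
  {c : ℝ → Ω → ℝ × ℝ → ℝ → ℝ} {μ : Measure ℝ} {ψ : ℝ → ℝ} {k : ℕ}

theorem IsStationary.integral_quartic (hμ : IsStationary P Vbar W μ) (α₀ α₁ α₂ α₃ α₄ : ℝ) :
    ∫ u, (α₀ + α₁ * u ^ 1 + α₂ * u ^ 2 + α₃ * u ^ 3 + α₄ * u ^ 4) ∂μ =
      α₀ + α₁ * (∫ u, u ^ 1 ∂μ) + α₂ * (∫ u, u ^ 2 ∂μ) + α₃ * (∫ u, u ^ 3 ∂μ) +
        α₄ * ∫ u, u ^ 4 ∂μ := by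
  have := hμ.prob
  have hint : ∀ {φ : ℝ → ℝ}, Continuous φ → Integrable φ μ := hμ.integrable_of_continuous
  rw [integral_add (hint (by fun_prop)) (hint (by fun_prop)),
    integral_add (hint (by fun_prop)) (hint (by fun_prop)),
    integral_add (hint (by fun_prop)) (hint (by fun_prop)),
    integral_add (hint (by fun_prop)) (hint (by fun_prop))]
  simp only [integral_const_mul, integral_const, probReal_univ, one_smul]

theorem IsStationary.abs_integral_pow_three_le (hμ : IsStationary P Vbar W μ) :
    |∫ u, u ^ 3 ∂μ| ≤ Vbar * ∫ u, u ^ 2 ∂μ := by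
  rw [← integral_const_mul]
  refine norm_integral_le_of_norm_le (f := fun u : ℝ => u ^ 3)
    (hμ.integrable_of_continuous (by fun_prop)) (hμ.ae_abs_le.mono fun u hu => ?_)
  rw [Real.norm_eq_abs, abs_pow, pow_succ', sq_abs]
  exact mul_le_mul_of_nonneg_right hu (sq_nonneg u)

namespace IsPistonInGas

theorem fluxMoment_one_of_balanced (h : IsPistonInGas P m M Vbar vmin vmax pL pR Γ W c)
    (hbalance : momentDiff vmin vmax pL pR 2 = 0) {u : ℝ} (hu : |u| ≤ Vbar) :
    fluxMoment pL pR 1 u =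
      -2 * u * momentDiff vmin vmax pL pR 1 + u ^ 2 * momentDiff vmin vmax pL pR 0 := by
  rw [fluxMoment_one h.gasL h.gasR h.admissible.vmin_lt.le (h.admissible.abs_lt_vmin hu).le,
    hbalance]
  ring

theorem fluxMoment_two_of_balanced (h : IsPistonInGas P m M Vbar vmin vmax pL pR Γ W c)
    (hbalance : momentDiff vmin vmax pL pR 2 = 0) {u : ℝ} (hu : |u| ≤ Vbar) :
    fluxMoment pL pR 2 u = momentDiff vmin vmax pL pR 3 +
      3 * u ^ 2 * momentDiff vmin vmax pL pR 1 - u ^ 3 * momentDiff vmin vmax pL pR 0 := by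
  rw [fluxMoment_two h.gasL h.gasR h.admissible.vmin_lt.le (h.admissible.abs_lt_vmin hu).le,
    hbalance]
  ring

theorem abs_fluxMoment_le (h : IsPistonInGas P m M Vbar vmin vmax pL pR Γ W c) {u : ℝ}
    (hu : |u| ≤ Vbar) {j : ℕ} (hj : j ≤ 4) :
    |fluxMoment pL pR j u| ≤ fluxBound vmax Vbar pL pR :=
  abs_fluxMoment_le_fluxBound h.gasL h.gasR h.admissible.vmax_pos.le hu hj

theorem mul_fluxMoment_one_le (h : IsPistonInGas P m M Vbar vmin vmax pL pR Γ W c)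
    (hbalance : momentDiff vmin vmax pL pR 2 = 0) {u : ℝ} (hu : |u| ≤ Vbar) :
    u * fluxMoment pL pR 1 u ≤ -(5 / 3) * momentDiff vmin vmax pL pR 1 * u ^ 2 := by
  have hdrift := mul_momentDiff_zero_le h.gasL h.gasR h.admissible.vmin_lt.le
    h.admissible.three_mul_Vbar_lt.le hu
  rw [h.fluxMoment_one_of_balanced hbalance hu]
  linarith [mul_le_mul_of_nonneg_left hdrift (sq_nonneg u)]

variable [IsProbabilityMeasure P]

theorem integral_nonneg_of_freeGenerator_pow_le
    (h : IsPistonInGas P m M Vbar vmin vmax pL pR Γ W c) (hμ : IsStationary P Vbar W μ)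
    (hk : Even k) (hψ : Continuous ψ)
    (hle : ∀ u, |u| ≤ Vbar → freeGenerator m M pL pR (· ^ k) u ≤ recoil m M * ψ u) :
    0 ≤ ∫ u, ψ u ∂μ := by
  obtain ⟨B, hB⟩ := exists_abs_le_of_continuous (continuous_pow k) Vbar
  have hnonneg := h.integral_nonneg_of_generator_le hμ (measurable_id.pow_const k) hB
    ((hμ.integrable_of_continuous hψ).const_mul (recoil m M)) fun u hu =>
      (h.admissible.generator_pow_le_of_even h.gasL h.gasR hk hu).trans (hle u hu)
  rw [integral_const_mul] at hnonneg
  exact nonneg_of_mul_nonneg_right hnonneg h.admissible.recoil_pos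

theorem abs_integral_le_of_abs_freeGenerator_pow_sub_le
    (h : IsPistonInGas P m M Vbar vmin vmax pL pR Γ W c) (hμ : IsStationary P Vbar W μ)
    (k : ℕ) (hψ : Continuous ψ) {χ : ℝ}
    (hle : ∀ u, |u| ≤ Vbar →
      |freeGenerator m M pL pR (· ^ k) u - recoil m M * ψ u| ≤ recoil m M * χ) :
    |∫ u, ψ u ∂μ| ≤ χ + reflectBound vmax Vbar * k * (3 / 2 * Vbar) ^ (k - 1) *
      fluxBound vmax Vbar pL pR * ∫ u, u ^ 4 ∂μ := by
  set κ := reflectBound vmax Vbar * k * (3 / 2 * Vbar) ^ (k - 1) * fluxBound vmax Vbar pL pR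
  have ha := h.admissible.recoil_pos
  obtain ⟨B, hB⟩ := exists_abs_le_of_continuous (continuous_pow k) Vbar
  have hbound := h.abs_integral_le_of_abs_generator_sub_le hμ (measurable_id.pow_const k) hB
    ((hμ.integrable_of_continuous hψ).const_mul (recoil m M))
    (χ := fun u => recoil m M * (χ + 0 * u ^ 1 + 0 * u ^ 2 + 0 * u ^ 3 + κ * u ^ 4))
    (hμ.integrable_of_continuous (by fun_prop)) fun u hu =>
      ((abs_sub_le _ _ _).trans (add_le_add
        (h.admissible.abs_generator_pow_sub_le h.gasL h.gasR k hu) (hle u hu))).trans_eq (by ring)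
  rw [integral_const_mul, integral_const_mul, abs_mul, abs_of_pos ha, hμ.integral_quartic] at hbound
  linarith [le_of_mul_le_mul_left hbound ha]

theorem second_moment_le (h : IsPistonInGas P m M Vbar vmin vmax pL pR Γ W c)
    (hμ : IsStationary P Vbar W μ) (hbalance : momentDiff vmin vmax pL pR 2 = 0) :
    10 / 3 * momentDiff vmin vmax pL pR 1 * ∫ u, u ^ 2 ∂μ ≤
      recoil m M * fluxBound vmax Vbar pL pR := by
  have ha := h.admissible.recoil_pos
  have hnonneg := h.integral_nonneg_of_freeGenerator_pow_le hμ even_two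
    (ψ := fun u => recoil m M * fluxBound vmax Vbar pL pR + 0 * u ^ 1 +
      (-(10 / 3) * momentDiff vmin vmax pL pR 1) * u ^ 2 + 0 * u ^ 3 + 0 * u ^ 4)
    (by fun_prop) fun u hu => ?_
  · rw [hμ.integral_quartic] at hnonneg
    linarith
  · have hdrift := mul_le_mul_of_nonneg_left (h.mul_fluxMoment_one_le hbalance hu) ha.le
    have hdiffusion := mul_le_mul_of_nonneg_left
      (abs_le.1 (h.abs_fluxMoment_le hu (j := 2) (by lia))).2 (sq_nonneg (recoil m M))
    rw [freeGenerator_pow_two h.admissible.add_ne_zero h.gasL h.gasR]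
    linarith

theorem fourth_moment_le (h : IsPistonInGas P m M Vbar vmin vmax pL pR Γ W c)
    (hμ : IsStationary P Vbar W μ) (hbalance : momentDiff vmin vmax pL pR 2 = 0) :
    20 / 3 * momentDiff vmin vmax pL pR 1 * ∫ u, u ^ 4 ∂μ ≤
      6 * recoil m M * fluxBound vmax Vbar pL pR * (∫ u, u ^ 2 ∂μ) +
        recoil m M ^ 2 * (fluxBound vmax Vbar pL pR * (4 * Vbar + 1)) := by
  have ha := h.admissible.recoil_pos
  set a := recoil m M
  set B := fluxBound vmax Vbar pL pR
  have hnonneg := h.integral_nonneg_of_freeGenerator_pow_le hμ (by decide : Even 4)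
    (ψ := fun u => a ^ 2 * (B * (4 * Vbar + 1)) + 0 * u ^ 1 + (6 * a * B) * u ^ 2 + 0 * u ^ 3 +
      (-(20 / 3) * momentDiff vmin vmax pL pR 1) * u ^ 4)
    (by fun_prop) fun u hu => ?_
  · rw [hμ.integral_quartic] at hnonneg
    linarith
  · have hdrift : u ^ 3 * a * fluxMoment pL pR 1 u ≤
        a * (-(5 / 3) * momentDiff vmin vmax pL pR 1 * u ^ 4) := by
      linarith [mul_le_mul_of_nonneg_left (h.mul_fluxMoment_one_le hbalance hu)
        (show 0 ≤ a * u ^ 2 by positivity)]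
    have htwo : u ^ 2 * a ^ 2 * fluxMoment pL pR 2 u ≤ u ^ 2 * a ^ 2 * B :=
      mul_le_mul_of_nonneg_left (abs_le.1 (h.abs_fluxMoment_le hu (by lia))).2 (by positivity)
    have hthree : u * a ^ 3 * fluxMoment pL pR 3 u ≤ Vbar * a ^ 3 * B := by
      refine (le_abs_self _).trans ?_
      rw [abs_mul, abs_mul, abs_of_pos (pow_pos ha 3)]
      have hB := h.abs_fluxMoment_le hu (j := 3) (by lia)
      have hV := h.admissible.Vbar_pos.le
      gcongr
    have hfour : a ^ 4 * fluxMoment pL pR 4 u ≤ a ^ 3 * B := by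
      have hB := h.abs_fluxMoment_le hu (j := 4) le_rfl
      have ha₁ : a ^ 4 ≤ a ^ 3 :=
        pow_le_pow_of_le_one ha.le h.admissible.recoil_le_one (by lia)
      have hB₀ : 0 ≤ B := (abs_nonneg _).trans hB
      exact (mul_le_mul_of_nonneg_left (abs_le.1 hB).2 (by positivity)).trans
        (mul_le_mul_of_nonneg_right ha₁ hB₀)
    rw [freeGenerator_pow_four h.admissible.add_ne_zero h.gasL h.gasR]
    linarith

theorem first_moment_relation (h : IsPistonInGas P m M Vbar vmin vmax pL pR Γ W c)
    (hμ : IsStationary P Vbar W μ) (hbalance : momentDiff vmin vmax pL pR 2 = 0) :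
    |-2 * momentDiff vmin vmax pL pR 1 * (∫ u, u ^ 1 ∂μ) +
        momentDiff vmin vmax pL pR 0 * ∫ u, u ^ 2 ∂μ| ≤
      reflectBound vmax Vbar * fluxBound vmax Vbar pL pR * ∫ u, u ^ 4 ∂μ := by
  set Q := momentDiff vmin vmax pL pR with hQ
  have hbound := h.abs_integral_le_of_abs_freeGenerator_pow_sub_le hμ 1 (χ := 0)
    (ψ := fun u => 0 + (-2 * Q 1) * u ^ 1 + Q 0 * u ^ 2 + 0 * u ^ 3 + 0 * u ^ 4)
    (by fun_prop) fun u hu => ?_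
  · rw [hμ.integral_quartic] at hbound
    simpa only [zero_add, zero_mul, add_zero, Nat.cast_one, mul_one, Nat.sub_self, pow_zero]
      using hbound
  · rw [freeGenerator_pow_one h.admissible.add_ne_zero h.gasL h.gasR, mul_zero, abs_nonpos_iff,
      sub_eq_zero, h.fluxMoment_one_of_balanced hbalance hu, ← hQ]
    ring

theorem second_moment_relation (h : IsPistonInGas P m M Vbar vmin vmax pL pR Γ W c)
    (hμ : IsStationary P Vbar W μ) (hbalance : momentDiff vmin vmax pL pR 2 = 0) :
    |-4 * momentDiff vmin vmax pL pR 1 * (∫ u, u ^ 2 ∂μ) +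
        2 * momentDiff vmin vmax pL pR 0 * (∫ u, u ^ 3 ∂μ) +
        recoil m M * (momentDiff vmin vmax pL pR 3 +
          3 * momentDiff vmin vmax pL pR 1 * (∫ u, u ^ 2 ∂μ) -
          momentDiff vmin vmax pL pR 0 * ∫ u, u ^ 3 ∂μ)| ≤
      3 * Vbar * reflectBound vmax Vbar * fluxBound vmax Vbar pL pR * ∫ u, u ^ 4 ∂μ := by
  set Q := momentDiff vmin vmax pL pR with hQ
  set a := recoil m M
  have hbound := h.abs_integral_le_of_abs_freeGenerator_pow_sub_le hμ 2 (χ := 0)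
    (ψ := fun u => a * Q 3 + 0 * u ^ 1 + (-4 * Q 1 + 3 * a * Q 1) * u ^ 2 +
      (2 * Q 0 - a * Q 0) * u ^ 3 + 0 * u ^ 4)
    (by fun_prop) fun u hu => ?_
  · rw [hμ.integral_quartic] at hbound
    convert hbound using 2
    · ring
    · push_cast
      ring
  · rw [freeGenerator_pow_two h.admissible.add_ne_zero h.gasL h.gasR, mul_zero, abs_nonpos_iff,
      sub_eq_zero, h.fluxMoment_one_of_balanced hbalance hu,
      h.fluxMoment_two_of_balanced hbalance hu, ← hQ]
    ring

theorem third_moment_relation (h : IsPistonInGas P m M Vbar vmin vmax pL pR Γ W c)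
    (hμ : IsStationary P Vbar W μ) (hbalance : momentDiff vmin vmax pL pR 2 = 0) :
    |-6 * momentDiff vmin vmax pL pR 1 * (∫ u, u ^ 3 ∂μ) +
        3 * momentDiff vmin vmax pL pR 0 * (∫ u, u ^ 4 ∂μ) +
        recoil m M * (3 * momentDiff vmin vmax pL pR 3 * (∫ u, u ^ 1 ∂μ) +
          9 * momentDiff vmin vmax pL pR 1 * (∫ u, u ^ 3 ∂μ) -
          3 * momentDiff vmin vmax pL pR 0 * ∫ u, u ^ 4 ∂μ)| ≤
      recoil m M ^ 2 * fluxBound vmax Vbar pL pR +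
        27 / 4 * Vbar ^ 2 * reflectBound vmax Vbar * fluxBound vmax Vbar pL pR *
          ∫ u, u ^ 4 ∂μ := by
  have ha := h.admissible.recoil_pos
  set Q := momentDiff vmin vmax pL pR with hQ
  set a := recoil m M
  have hbound := h.abs_integral_le_of_abs_freeGenerator_pow_sub_le hμ 3
    (χ := a ^ 2 * fluxBound vmax Vbar pL pR)
    (ψ := fun u => 0 + 3 * a * Q 3 * u ^ 1 + 0 * u ^ 2 + (-6 * Q 1 + 9 * a * Q 1) * u ^ 3 +
      (3 * Q 0 - 3 * a * Q 0) * u ^ 4)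
    (by fun_prop) fun u hu => ?_
  · rw [hμ.integral_quartic] at hbound
    convert hbound using 2
    · ring
    · push_cast
      ring
  · have hremainder : freeGenerator m M pL pR (· ^ 3) u - a * (0 + 3 * a * Q 3 * u ^ 1 + 0 * u ^ 2 +
        (-6 * Q 1 + 9 * a * Q 1) * u ^ 3 + (3 * Q 0 - 3 * a * Q 0) * u ^ 4) =
        a ^ 3 * fluxMoment pL pR 3 u := by
      rw [freeGenerator_pow_three h.admissible.add_ne_zero h.gasL h.gasR,
        h.fluxMoment_one_of_balanced hbalance hu, h.fluxMoment_two_of_balanced hbalance hu, ← hQ]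
      ring
    rw [hremainder, abs_mul, abs_of_pos (pow_pos ha 3), ← mul_assoc, ← pow_succ']
    exact mul_le_mul_of_nonneg_left (h.abs_fluxMoment_le hu (by lia)) (by positivity)

theorem momentRelations (h : IsPistonInGas P m M Vbar vmin vmax pL pR Γ W c)
    (hμ : IsStationary P Vbar W μ) (hbalance : momentDiff vmin vmax pL pR 2 = 0) :
    MomentRelations (recoil m M) Vbar (fluxBound vmax Vbar pL pR) (reflectBound vmax Vbar)
      (momentDiff vmin vmax pL pR) (fun k => ∫ u, u ^ k ∂μ) where
  two_nonneg := integral_nonneg sq_nonneg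
  four_nonneg := integral_nonneg (by decide : Even 4).pow_nonneg
  abs_three_le := hμ.abs_integral_pow_three_le
  two_le := h.second_moment_le hμ hbalance
  four_le := h.fourth_moment_le hμ hbalance
  first := h.first_moment_relation hμ hbalance
  second := h.second_moment_relation hμ hbalance
  third := h.third_moment_relation hμ hbalance

end IsPistonInGas

end Stationary

section MomentAsymptotics

open Asymptotics

variable {ι : Type*} {l : Filter ι} {a : ι → ℝ} {b : ι → ℕ → ℝ} {V B κ : ℝ} {Q : ℕ → ℝ}

theorem isBigO_of_const_mul_le {f g : ι → ℝ} {C : ℝ} (hC : 0 < C) (hf : ∀ᶠ i in l, 0 ≤ f i)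
    (h : ∀ᶠ i in l, C * f i ≤ g i) : f =O[l] g := by
  refine IsBigO.of_bound C⁻¹ ?_
  filter_upwards [hf, h] with i hfi hi
  rw [Real.norm_of_nonneg hfi, ← div_eq_inv_mul, le_div_iff₀' hC]
  exact hi.trans (Real.le_norm_self _)

theorem isBigO_sq_of_isBigO_one (ha : a =O[l] fun _ => (1 : ℝ)) : (fun i => a i ^ 2) =O[l] a := by
  simpa only [sq, one_mul] using ha.mul (isBigO_refl a l)

theorem isBigO_mul_self_sq {f g : ι → ℝ} (hf : f =O[l] a) (hg : g =O[l] a) :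
    (fun i => f i * g i) =O[l] fun i => a i ^ 2 := by
  simpa only [sq] using hf.mul hg

theorem moment_two_isBigO (hQ : 0 < Q 1) (h : ∀ᶠ i in l, MomentRelations (a i) V B κ Q (b i)) :
    (b · 2) =O[l] a :=
  (isBigO_of_const_mul_le (show 0 < 10 / 3 * Q 1 by positivity) (h.mono fun _ hi => hi.two_nonneg)
    (h.mono fun _ hi => hi.two_le)).trans (isBigO_const_mul_self B a l |>.congr_left fun _ =>
      mul_comm _ _)

theorem moment_four_isBigO (hQ : 0 < Q 1) (h : ∀ᶠ i in l, MomentRelations (a i) V B κ Q (b i)) :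
    (b · 4) =O[l] fun i => a i ^ 2 := by
  have hbound : (fun i => 6 * a i * B * b i 2 + a i ^ 2 * (B * (4 * V + 1))) =O[l]
      fun i => a i ^ 2 := by
    refine (((isBigO_mul_self_sq (isBigO_refl a l) (moment_two_isBigO hQ h)).const_mul_left
      (6 * B)).add (isBigO_const_mul_self (B * (4 * V + 1)) _ l)).congr_left fun i => ?_
    ring
  exact (isBigO_of_const_mul_le (show 0 < 20 / 3 * Q 1 by positivity)
    (h.mono fun _ hi => hi.four_nonneg) (h.mono fun _ hi => hi.four_le)).trans hbound

theorem moment_three_isBigO_self (hQ : 0 < Q 1)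
    (h : ∀ᶠ i in l, MomentRelations (a i) V B κ Q (b i)) : (b · 3) =O[l] a :=
  ((IsBigO.of_norm_eventuallyLE (h.mono fun _ hi => hi.abs_three_le)).trans
    (isBigO_const_mul_self V _ l)).trans (moment_two_isBigO hQ h)

theorem moment_one_isBigO (hQ : 0 < Q 1) (ha : a =O[l] fun _ => (1 : ℝ))
    (h : ∀ᶠ i in l, MomentRelations (a i) V B κ Q (b i)) : (b · 1) =O[l] a := by
  have hfirst : (fun i => -2 * Q 1 * b i 1 + Q 0 * b i 2) =O[l] a :=
    (((IsBigO.of_norm_eventuallyLE (h.mono fun _ hi => hi.first)).trans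
      (isBigO_const_mul_self (κ * B) _ l)).trans (moment_four_isBigO hQ h)).trans
        (isBigO_sq_of_isBigO_one ha)
  refine (((moment_two_isBigO hQ h).const_mul_left (Q 0)).sub hfirst |>.const_mul_left
    (2 * Q 1)⁻¹).congr_left fun i => ?_
  field_simp
  ring

theorem moment_three_isBigO (hQ : 0 < Q 1) (ha : a =O[l] fun _ => (1 : ℝ))
    (h : ∀ᶠ i in l, MomentRelations (a i) V B κ Q (b i)) :
    (b · 3) =O[l] fun i => a i ^ 2 := by
  have hb₄ := moment_four_isBigO hQ h
  have hthird : (fun i => -6 * Q 1 * b i 3 + 3 * Q 0 * b i 4 +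
      a i * (3 * Q 3 * b i 1 + 9 * Q 1 * b i 3 - 3 * Q 0 * b i 4)) =O[l] fun i => a i ^ 2 :=
    (IsBigO.of_norm_eventuallyLE (h.mono fun _ hi => hi.third)).trans
      (((isBigO_const_mul_self B _ l).congr_left fun _ => mul_comm _ _).add
        (hb₄.const_mul_left _))
  have hcorrection : (fun i => a i * (3 * Q 3 * b i 1 + 9 * Q 1 * b i 3 - 3 * Q 0 * b i 4)) =O[l]
      fun i => a i ^ 2 :=
    isBigO_mul_self_sq (isBigO_refl a l) ((((moment_one_isBigO hQ ha h).const_mul_left _).add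
      ((moment_three_isBigO_self hQ h).const_mul_left _)).sub
        ((hb₄.trans (isBigO_sq_of_isBigO_one ha)).const_mul_left _))
  refine (((hcorrection.sub hthird).add (hb₄.const_mul_left (3 * Q 0))).const_mul_left
    (6 * Q 1)⁻¹).congr_left fun i => ?_
  field_simp
  ring

theorem moment_two_sub_isBigO (hQ : 0 < Q 1) (ha : a =O[l] fun _ => (1 : ℝ))
    (h : ∀ᶠ i in l, MomentRelations (a i) V B κ Q (b i)) :
    (fun i => b i 2 - a i * Q 3 / (4 * Q 1)) =O[l] fun i => a i ^ 2 := by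
  have hsecond : (fun i => -4 * Q 1 * b i 2 + 2 * Q 0 * b i 3 +
      a i * (Q 3 + 3 * Q 1 * b i 2 - Q 0 * b i 3)) =O[l] fun i => a i ^ 2 :=
    ((IsBigO.of_norm_eventuallyLE (h.mono fun _ hi => hi.second)).trans
      (isBigO_const_mul_self (3 * V * κ * B) _ l)).trans (moment_four_isBigO hQ h)
  have hcorrection : (fun i => a i * (3 * Q 1 * b i 2 - Q 0 * b i 3)) =O[l] fun i => a i ^ 2 :=
    isBigO_mul_self_sq (isBigO_refl a l) (((moment_two_isBigO hQ h).const_mul_left _).sub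
      ((moment_three_isBigO_self hQ h).const_mul_left _))
  refine (((hcorrection.sub hsecond).add
    ((moment_three_isBigO hQ ha h).const_mul_left (2 * Q 0))).const_mul_left
      (4 * Q 1)⁻¹).congr_left fun i => ?_
  field_simp
  ring

end MomentAsymptotics

/-- The heat flow per unit mass of an atom, in terms of the moments `F k` of the left gas, the
recoil factor `a` and the moments `b k` of the stationary measure. -/
noncomputable def reducedHeat (F : ℕ → ℝ) (a : ℝ) (b : ℕ → ℝ) : ℝ :=
  (2 - a) * (2 * b 2 * F 1 - b 3 * F 0 - a / 2 * F 3 +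
    a / 2 * (3 * b 1 * F 2 - 3 * b 2 * F 1 + b 3 * F 0) - 2 * b 1 ^ 2 * F 1 + b 1 * b 2 * F 0)

section HeatAsymptotics

open Asymptotics

variable {V B κ : ℝ} {Q : ℕ → ℝ}

theorem reducedHeat_sub_isBigO {ι : Type*} {l : Filter ι} {a : ι → ℝ} {b : ι → ℕ → ℝ}
    (hQ : 0 < Q 1) (ha : a =O[l] fun _ => (1 : ℝ))
    (h : ∀ᶠ i in l, MomentRelations (a i) V B κ Q (b i)) (F : ℕ → ℝ) :
    (fun i => reducedHeat F (a i) (b i) - a i * ((Q 3 * F 1 - F 3 * Q 1) / Q 1)) =O[l]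
      fun i => a i ^ 2 := by
  have hb₁ := moment_one_isBigO hQ ha h
  have hb₂ := moment_two_isBigO hQ h
  have hb₃ := moment_three_isBigO hQ ha h
  have hlinear : (fun i => a i * (3 * F 2 * b i 1 - 3 * F 1 * b i 2)) =O[l] fun i => a i ^ 2 :=
    isBigO_mul_self_sq (isBigO_refl a l) ((hb₁.const_mul_left _).sub (hb₂.const_mul_left _))
  have hcubic : (fun i => a i * b i 3) =O[l] fun i => a i ^ 2 := by
    simpa only [one_mul] using ha.mul hb₃
  have hprefactor : (fun i => 2 - a i) =O[l] fun _ => (1 : ℝ) :=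
    (isBigO_const_const (2 : ℝ) one_ne_zero _).sub ha
  have hremainder := (((((moment_two_sub_isBigO hQ ha h).const_mul_left (2 * F 1)).sub
    (hb₃.const_mul_left (F 0))).add (hlinear.const_mul_left (1 / 2))).add
    (hcubic.const_mul_left (F 0 / 2))).sub
    ((isBigO_mul_self_sq hb₁ hb₁).const_mul_left (2 * F 1)) |>.add
    ((isBigO_mul_self_sq hb₁ hb₂).const_mul_left (F 0))
  refine (((hprefactor.mul hremainder).congr_right fun i => one_mul _).sub
    (isBigO_const_mul_self ((Q 3 * F 1 - F 3 * Q 1) / (2 * Q 1)) _ l)).congr_left fun i => ?_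
  rw [reducedHeat]
  field_simp
  ring

theorem exists_abs_reducedHeat_sub_le (hQ : 0 < Q 1) (V B κ : ℝ) (F : ℕ → ℝ) :
    ∃ C, ∀ a b, |a| ≤ 1 → MomentRelations a V B κ Q b →
      |reducedHeat F a b - a * ((Q 3 * F 1 - F 3 * Q 1) / Q 1)| ≤ C * a ^ 2 := by
  let S : Set (ℝ × (ℕ → ℝ)) := {x | |x.1| ≤ 1 ∧ MomentRelations x.1 V B κ Q x.2}
  have hone : (fun x : ℝ × (ℕ → ℝ) => x.1) =O[𝓟 S] fun _ => (1 : ℝ) :=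
    isBigO_principal.2 ⟨1, fun x hx => by
      simpa only [norm_one, mul_one, Real.norm_eq_abs] using hx.1⟩
  obtain ⟨C, hC⟩ := isBigO_principal.1 (reducedHeat_sub_isBigO (b := Prod.snd) hQ hone
    (eventually_principal.2 fun x hx => hx.2) F)
  refine ⟨C, fun a b ha h => ?_⟩
  simpa only [Real.norm_eq_abs, abs_pow, sq_abs] using hC (a, b) ⟨ha, h⟩

end HeatAsymptotics

/-! ### The heat flow -/

theorem hasDerivWithinAt_of_abs_sub_le_mul_sq {f : ℝ → ℝ} {L C : ℝ}
    (h : ∀ t, 0 ≤ t → |f t - t * L| ≤ C * t ^ 2) : HasDerivWithinAt f L (Ici 0) 0 := by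
  have h0 : f 0 = 0 := by simpa using h 0 le_rfl
  rw [hasDerivWithinAt_iff_isLittleO]
  simp only [h0, sub_zero, smul_eq_mul]
  have hquadratic : (fun t : ℝ => f t - t * L) =O[𝓝[≥] 0] fun t => t ^ 2 := by
    refine Asymptotics.IsBigO.of_bound C ?_
    filter_upwards [self_mem_nhdsWithin] with t ht
    simpa using h t ht
  exact hquadratic.trans_isLittleO
    ((Asymptotics.isLittleO_pow_id one_lt_two).mono nhdsWithin_le_nhds)

theorem rate_left_quadratic {vmin vmax : ℝ} {pL : ℝ → ℝ}
    (hL : IntervalIntegrable pL volume vmin vmax) (pR : ℝ → ℝ) (u α β : ℝ) :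
    rate vmin vmax pL pR u (fun v => α * (v - u) + β * (v - u) ^ 2) (fun _ => 0) =
      α * (momentL vmin vmax pL 2 - 2 * u * momentL vmin vmax pL 1 +
        u ^ 2 * momentL vmin vmax pL 0) +
      β * (momentL vmin vmax pL 3 - 3 * u * momentL vmin vmax pL 2 +
        3 * u ^ 2 * momentL vmin vmax pL 1 - u ^ 3 * momentL vmin vmax pL 0) := by
  have hint : ∀ j, IntervalIntegrable (fun v => (v - u) ^ j * pL v) volume vmin vmax := fun j =>
    hL.continuousOn_mul (by fun_prop)
  have hexpand : ∀ v, (v - u) * (α * (v - u) + β * (v - u) ^ 2) * pL v =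
      α * ((v - u) ^ 2 * pL v) + β * ((v - u) ^ 3 * pL v) := fun v => by ring
  simp only [rate, hexpand, mul_zero, zero_mul, intervalIntegral.integral_zero, add_zero]
  rw [intervalIntegral.integral_add ((hint 2).const_mul α) ((hint 3).const_mul β),
    intervalIntegral.integral_const_mul, intervalIntegral.integral_const_mul,
    integral_sub_pow_mul hL, integral_sub_pow_mul hL]
  simp only [Finset.sum_range_succ, Finset.sum_range_zero, Nat.choose, momentL]
  push_cast
  ring

section HeatFlow

variable {Ω : Type*} [MeasurableSpace Ω] {P : Measure Ω}
  {m M Vbar vmin vmax u : ℝ} {pL pR : ℝ → ℝ} {Γ : Ω → Set (ℝ × ℝ)} {W : ℝ → Ω → ℝ → ℝ}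
  {c : ℝ → Ω → ℝ × ℝ → ℝ → ℝ} {μ : Measure ℝ}

theorem IsStationary.integral_quadratic (hμ : IsStationary P Vbar W μ) (α₀ α₁ α₂ : ℝ) :
    ∫ u, (α₀ - α₁ * u + α₂ * u ^ 2) ∂μ = α₀ - α₁ * (∫ u, u ∂μ) + α₂ * ∫ u, u ^ 2 ∂μ := by
  simpa only [pow_one, zero_mul, add_zero, neg_mul, ← sub_eq_add_neg] using
    hμ.integral_quartic α₀ (-α₁) α₂ 0 0

theorem IsStationary.integral_cubic (hμ : IsStationary P Vbar W μ) (α₀ α₁ α₂ α₃ : ℝ) :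
    ∫ u, (α₀ + α₁ * u + α₂ * u ^ 2 + α₃ * u ^ 3) ∂μ =
      α₀ + α₁ * (∫ u, u ∂μ) + α₂ * (∫ u, u ^ 2 ∂μ) + α₃ * ∫ u, u ^ 3 ∂μ := by
  simpa only [pow_one, zero_mul, add_zero] using hμ.integral_quartic α₀ α₁ α₂ α₃ 0

variable [IsProbabilityMeasure P]

namespace IsPistonInGas

theorem integrable_and_hasDerivWithinAt_leftGain
    (h : IsPistonInGas P m M Vbar vmin vmax pL pR Γ W c) (hu : |u| ≤ Vbar) {ψ : ℝ → ℝ}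
    (hψ : Continuous ψ)
    (hmeas : ∀ t, 0 ≤ t → AEStronglyMeasurable (fun ω => leftGain ψ (Γ ω) (c u ω) t) P) :
    (∀ t, 0 ≤ t → Integrable (fun ω => leftGain ψ (Γ ω) (c u ω) t) P) ∧
      HasDerivWithinAt (fun t => ∫ ω, leftGain ψ (Γ ω) (c u ω) t ∂P)
        (rate vmin vmax pL pR u (fun v => ψ (atomAfter m M u v) - ψ v) (fun _ => 0)) (Ici 0) 0 := by
  obtain ⟨B, hB⟩ := exists_abs_le_of_continuous hψ (3 * vmax)
  have hgain := fun t (ht : 0 ≤ t) =>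
    h.abs_integral_leftGain_sub_le ht hu hψ.measurable hB (hmeas t ht)
  exact ⟨fun t ht => (hgain t ht).1,
    hasDerivWithinAt_of_abs_sub_le_mul_sq fun t ht => (hgain t ht).2⟩

theorem integrable_and_hasDerivWithinAt_energy
    (h : IsPistonInGas P m M Vbar vmin vmax pL pR Γ W c) (hu : |u| ≤ Vbar) :
    (∀ t, 0 ≤ t → Integrable (fun ω => leftEnergyGain m (Γ ω) (c u ω) t) P) ∧
      HasDerivWithinAt (meanEnergyGain P m Γ c u)
        (rate vmin vmax pL pR u
          (fun v => m / 2 * atomAfter m M u v ^ 2 - m / 2 * v ^ 2) (fun _ => 0)) (Ici 0) 0 :=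
  h.integrable_and_hasDerivWithinAt_leftGain hu (ψ := fun x => m / 2 * x ^ 2) (by fun_prop)
    (h.process.measurable_energy u (abs_le.1 hu))

theorem integrable_and_hasDerivWithinAt_momentum
    (h : IsPistonInGas P m M Vbar vmin vmax pL pR Γ W c) (hu : |u| ≤ Vbar) :
    (∀ t, 0 ≤ t → Integrable (fun ω => leftMomentumGain m (Γ ω) (c u ω) t) P) ∧
      HasDerivWithinAt (meanMomentumGain P m Γ c u)
        (rate vmin vmax pL pR u (fun v => m * atomAfter m M u v - m * v) (fun _ => 0))
        (Ici 0) 0 :=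
  h.integrable_and_hasDerivWithinAt_leftGain hu (ψ := fun x => m * x) (by fun_prop)
    (h.process.measurable_momentum u (abs_le.1 hu))

theorem energyRate_eq (h : IsPistonInGas P m M Vbar vmin vmax pL pR Γ W c) (hu : |u| ≤ Vbar) :
    energyRate P m Γ c u = -(m / 2 * (2 - recoil m M)) *
      (recoil m M * momentL vmin vmax pL 3 + (2 - 3 * recoil m M) * momentL vmin vmax pL 2 * u +
        (3 * recoil m M - 4) * momentL vmin vmax pL 1 * u ^ 2 +
        (2 - recoil m M) * momentL vmin vmax pL 0 * u ^ 3) := by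
  have hgain : ∀ v, m / 2 * atomAfter m M u v ^ 2 - m / 2 * v ^ 2 =
      -(m * (2 - recoil m M) * u) * (v - u) +
        -(m / 2 * (2 - recoil m M) * recoil m M) * (v - u) ^ 2 := fun v => by
    rw [atomAfter_eq h.admissible.add_ne_zero]
    ring
  rw [energyRate, (h.integrable_and_hasDerivWithinAt_energy hu).2.derivWithin
    (uniqueDiffWithinAt_Ici 0)]
  simp only [hgain, rate_left_quadratic h.gasL.integrable.intervalIntegrable]
  ring

theorem momentumRate_eq (h : IsPistonInGas P m M Vbar vmin vmax pL pR Γ W c) (hu : |u| ≤ Vbar) :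
    momentumRate P m Γ c u = -(m * (2 - recoil m M)) *
      (momentL vmin vmax pL 2 - 2 * momentL vmin vmax pL 1 * u +
        momentL vmin vmax pL 0 * u ^ 2) := by
  have hgain : ∀ v, m * atomAfter m M u v - m * v =
      -(m * (2 - recoil m M)) * (v - u) + 0 * (v - u) ^ 2 := fun v => by
    rw [atomAfter_eq h.admissible.add_ne_zero]
    ring
  rw [momentumRate, (h.integrable_and_hasDerivWithinAt_momentum hu).2.derivWithin
    (uniqueDiffWithinAt_Ici 0)]
  simp only [hgain, rate_left_quadratic h.gasL.integrable.intervalIntegrable]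
  ring

theorem heatFlowExists (h : IsPistonInGas P m M Vbar vmin vmax pL pR Γ W c)
    (hμ : IsStationary P Vbar W μ) : HeatFlowExists P m Vbar Γ c μ where
  integrable_energy _ hu := (h.integrable_and_hasDerivWithinAt_energy (abs_le.2 hu)).1
  integrable_momentum _ hu := (h.integrable_and_hasDerivWithinAt_momentum (abs_le.2 hu)).1
  differentiable_energy _ hu :=
    (h.integrable_and_hasDerivWithinAt_energy (abs_le.2 hu)).2.differentiableWithinAt
  differentiable_momentum _ hu :=
    (h.integrable_and_hasDerivWithinAt_momentum (abs_le.2 hu)).2.differentiableWithinAt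
  integrable_energyRate := by
    refine (hμ.integrable_of_continuous ?_).congr
      (hμ.ae_abs_le.mono fun _ hu => (h.energyRate_eq hu).symm)
    fun_prop
  integrable_momentumRate := by
    refine (hμ.integrable_of_continuous ?_).congr
      (hμ.ae_abs_le.mono fun _ hu => (h.momentumRate_eq hu).symm)
    fun_prop
  integrable_velocity := hμ.integrable_of_continuous continuous_id

theorem heatFlow_eq (h : IsPistonInGas P m M Vbar vmin vmax pL pR Γ W c)
    (hμ : IsStationary P Vbar W μ) :
    heatFlow P m Γ c μ =
      m * reducedHeat (momentL vmin vmax pL) (recoil m M) (fun k => ∫ u, u ^ k ∂μ) := by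
  rw [heatFlow, integral_congr_ae (hμ.ae_abs_le.mono fun _ hu => h.energyRate_eq hu),
    integral_congr_ae (hμ.ae_abs_le.mono fun _ hu => h.momentumRate_eq hu), integral_const_mul,
    integral_const_mul, hμ.integral_cubic, hμ.integral_quadratic, reducedHeat]
  simp only [pow_one]
  ring

end IsPistonInGas

end HeatFlow

section Masses

variable {m M : ℝ}

theorem recoil_le_two_mul_div (hm : 0 ≤ m) (hM : 0 < M) : recoil m M ≤ 2 * (m / M) := by
  rw [recoil, ← mul_div_assoc]
  gcongr
  exact le_add_of_nonneg_right hm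

theorem abs_recoil_sub_two_mul_div_le (hm : 0 ≤ m) (hM : 0 < M) :
    |recoil m M - 2 * (m / M)| ≤ 2 * (m / M) ^ 2 := by
  have hdiff : recoil m M - 2 * (m / M) = -(m / M * recoil m M) := by
    rw [recoil]
    field_simp
    ring
  have hrecoil : 0 ≤ recoil m M := by
    rw [recoil]
    positivity
  rw [hdiff, abs_neg, abs_of_nonneg (by positivity)]
  calc m / M * recoil m M ≤ m / M * (2 * (m / M)) := by
        gcongr
        exact recoil_le_two_mul_div hm hM
    _ = 2 * (m / M) ^ 2 := by ring

theorem abs_sub_two_mul_div_mul_le (hm : 0 ≤ m) (hM : 0 < M) {C R X : ℝ}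
    (h : |R - recoil m M * X| ≤ C * recoil m M ^ 2) :
    |R - 2 * (m / M) * X| ≤ (4 * |C| + 2 * |X|) * (m / M) ^ 2 := by
  have hrecoil : 0 ≤ recoil m M := by
    rw [recoil]
    positivity
  calc |R - 2 * (m / M) * X|
      ≤ |R - recoil m M * X| + |recoil m M * X - 2 * (m / M) * X| := abs_sub_le _ _ _
    _ ≤ |C| * (2 * (m / M)) ^ 2 + 2 * (m / M) ^ 2 * |X| := by
        rw [← sub_mul, abs_mul]
        gcongr ?_ + ?_ * _
        · refine h.trans (mul_le_mul (le_abs_self C) ?_ (sq_nonneg _) (abs_nonneg C))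
          exact pow_le_pow_left₀ hrecoil (recoil_le_two_mul_div hm hM) 2
        · exact abs_recoil_sub_two_mul_div_le hm hM
    _ = (4 * |C| + 2 * |X|) * (m / M) ^ 2 := by ring

theorem Admissible.of_div_lt {Vbar vmin vmax : ℝ} (hm : 0 < m) (hM : 0 < M) (hV : 0 < Vbar)
    (hmin : 0 < vmin) (hv : vmin < vmax) (hcutoff : Vbar < vMax m M vmin)
    (hratio : m / M < Vbar / (4 * (vmax + Vbar))) : Admissible m M Vbar vmin vmax where
  m_pos := hm
  M_pos := hM
  Vbar_pos := hV
  vmin_pos := hmin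
  vmin_lt := hv
  cutoff := hcutoff
  small := by
    have hsum : 0 < vmax + Vbar := by linarith
    rw [lt_div_iff₀ (by positivity)] at hratio
    linarith [mul_le_mul_of_nonneg_right (recoil_le_two_mul_div hm.le hM) hsum.le]

end Masses

theorem exists_abs_heatFlow_sub_le {vmin vmax : ℝ} {pL pR : ℝ → ℝ} (Vbar : ℝ)
    (hQ : 0 < momentDiff vmin vmax pL pR 1) (hbalance : momentDiff vmin vmax pL pR 2 = 0) :
    ∃ C, ∀ {m M : ℝ} {Ω : Type*} [MeasurableSpace Ω] {P : Measure Ω} [IsProbabilityMeasure P]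
      {Γ : Ω → Set (ℝ × ℝ)} {W : ℝ → Ω → ℝ → ℝ} {c : ℝ → Ω → ℝ × ℝ → ℝ → ℝ} {μ : Measure ℝ},
      IsPistonInGas P m M Vbar vmin vmax pL pR Γ W c → IsStationary P Vbar W μ →
        |heatFlow P m Γ c μ - 2 * m * (m / M) / momentDiff vmin vmax pL pR 1 *
            (momentR vmin vmax pR 1 * momentL vmin vmax pL 3 -
              momentL vmin vmax pL 1 * momentR vmin vmax pR 3)| ≤ C * m * (m / M) ^ 2 := by
  set Q := momentDiff vmin vmax pL pR
  set F := momentL vmin vmax pL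
  set X := (Q 3 * F 1 - F 3 * Q 1) / Q 1 with hX
  obtain ⟨C, hC⟩ := exists_abs_reducedHeat_sub_le hQ Vbar (fluxBound vmax Vbar pL pR)
    (reflectBound vmax Vbar) F
  refine ⟨4 * |C| + 2 * |X|, fun {m M Ω _ P _ Γ W c μ} h hμ => ?_⟩
  have hadm := h.admissible
  have hrecoil : |recoil m M| ≤ 1 := (abs_of_pos hadm.recoil_pos).trans_le hadm.recoil_le_one
  have hreduced := abs_sub_two_mul_div_mul_le hadm.m_pos.le hadm.M_pos
    (hC _ _ hrecoil (h.momentRelations hμ hbalance))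
  have hleading : 2 * m * (m / M) / Q 1 * (momentR vmin vmax pR 1 * F 3 -
      F 1 * momentR vmin vmax pR 3) = m * (2 * (m / M) * X) := by
    have hR : ∀ k, momentR vmin vmax pR k = F k - Q k := fun k => (sub_sub_cancel _ _).symm
    rw [hX, hR, hR]
    field_simp
    ring
  rw [h.heatFlow_eq hμ, hleading, ← mul_sub, abs_mul, abs_of_pos hadm.m_pos]
  exact (mul_le_mul_of_nonneg_left hreduced hadm.m_pos.le).trans_eq (by ring)

end Piston

theorem mainTheorem4_general
    (vmin vmax : ℝ) (hvmin : 0 < vmin) (hvmax : vmin < vmax)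
    (pL pR : ℝ → ℝ)
    (hpL : Piston.IsGasDensity vmin vmax pL) (hpR : Piston.IsGasDensity vmin vmax pR)
    (FL FR Q : ℕ → ℝ)
    (hFL : ∀ k, FL k = Piston.momentL vmin vmax pL k)
    (hFR : ∀ k, FR k = Piston.momentR vmin vmax pR k)
    (hQ : ∀ k, Q k = FL k - FR k)
    (hpos : 0 < Q 1) (hbalance : Q 2 = 0)
    (Vbar : ℝ) (hVbar : 0 < Vbar) :
    ∃ C ε₀ : ℝ, 0 < ε₀ ∧
      ∀ m M ε : ℝ, 0 < m → 0 < M → ε = m / M → ε < ε₀ → Vbar < Piston.vMax m M vmin →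
      ∀ {Ω : Type*} [MeasurableSpace Ω] (P : Measure Ω) [IsProbabilityMeasure P]
        (Γ : Ω → Set (ℝ × ℝ)) (W : ℝ → Ω → ℝ → ℝ) (c : ℝ → Ω → ℝ × ℝ → ℝ → ℝ)
        (μ : Measure ℝ),
        Piston.IsPoissonProcess Γ (Piston.gasIntensity pL pR) P →
        Piston.IsPistonProcess P m M Vbar Γ W c →
        Piston.IsStationary P Vbar W μ →
          Piston.HeatFlowExists P m Vbar Γ c μ ∧
          |Piston.heatFlow P m Γ c μ
              - 2 * m * ε / Q 1 * (FR 1 * FL 3 - FL 1 * FR 3)| ≤ C * m * ε ^ 2 := by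
  obtain rfl : FL = Piston.momentL vmin vmax pL := funext hFL
  obtain rfl : FR = Piston.momentR vmin vmax pR := funext hFR
  obtain rfl : Q = Piston.momentDiff vmin vmax pL pR := funext hQ
  obtain ⟨C, hC⟩ := Piston.exists_abs_heatFlow_sub_le Vbar hpos hbalance
  have hsum : 0 < vmax + Vbar := by linarith
  refine ⟨C, Vbar / (4 * (vmax + Vbar)), by positivity, ?_⟩
  rintro m M _ hm hM rfl hε hcutoff Ω _ P _ Γ W c μ hpoisson hprocess hμ
  have hgas : Piston.IsPistonInGas P m M Vbar vmin vmax pL pR Γ W c :=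
    ⟨.of_div_lt hm hM hVbar hvmin hvmax hcutoff hε, hpL, hpR, hpoisson, hprocess⟩
  exact ⟨hgas.heatFlowExists hμ, hC hgas hμ⟩

theorem mainTheorem4
    (vmin vmax : ℝ) (hvmin : 0 < vmin) (hvmax : vmin < vmax)
    (nL nR : ℝ) (hnL : 0 < nL) (hnR : 0 < nR)
    (fL fR pL pR : ℝ → ℝ)
    (hfL : Piston.IsVelocityDensity vmin vmax fL)
    (hfR : Piston.IsVelocityDensity vmin vmax fR)
    (hpL : ∀ v, pL v = nL * fL v) (hpR : ∀ v, pR v = nR * fR v)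
    (FL FR Q : ℕ → ℝ)
    (hFL : ∀ k, FL k = Piston.momentL vmin vmax pL k)
    (hFR : ∀ k, FR k = Piston.momentR vmin vmax pR k)
    (hQ : ∀ k, Q k = FL k - FR k)
    (hbalance : Q 2 = 0)
    (Vbar : ℝ) (hVbar : 0 < Vbar) :
    ∃ C ε₀ : ℝ, 0 < ε₀ ∧
      ∀ m M ε : ℝ, 0 < m → 0 < M → ε = m / M → ε < ε₀ → Vbar < Piston.vMax m M vmin →
      ∀ {Ω : Type*} [MeasurableSpace Ω] (P : Measure Ω) [IsProbabilityMeasure P]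
        (Γ : Ω → Set (ℝ × ℝ)) (W : ℝ → Ω → ℝ → ℝ) (c : ℝ → Ω → ℝ × ℝ → ℝ → ℝ)
        (μ : Measure ℝ),
        Piston.IsPoissonProcess Γ (Piston.gasIntensity pL pR) P →
        Piston.IsPistonProcess P m M Vbar Γ W c →
        Piston.IsStationary P Vbar W μ →
          Piston.HeatFlowExists P m Vbar Γ c μ ∧
          |Piston.heatFlow P m Γ c μ
              - 2 * m * ε / Q 1 * (FR 1 * FL 3 - FL 1 * FR 3)| ≤ C * m * ε ^ 2 := by
  refine mainTheorem4_general vmin vmax hvmin hvmax pL pR (hfL.isGasDensity hnL.le hpL)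
    (hfR.isGasDensity hnR.le hpR) FL FR Q hFL hFR hQ ?_ hbalance Vbar hVbar
  rw [hQ, hFL, hFR]
  exact Piston.momentDiff_one_pos (hfL.isGasDensity hnL.le hpL) (hfR.isGasDensity hnR.le hpR) hvmin
    hvmax.le (Piston.momentL_zero_pos hvmin.le hvmax.le hfL hnL hpL)
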